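/- **Thompson's group.** Finite rooted binary trees $T$ encode standard dyadic partitions of $[0,1]$ (the one-leaf tree is the trivial partition, a caret cuts an interval into its two halves). $F$ is the group of increasing homeomorphisms $g$ of $[0,1]$ for which there are trees $T_+,T_-$ with the same number $n$ of leaves such that, for each $i$, $g$ maps the $i$-th interval of the partition $T_+$ affinely onto the $i$-th interval of the partition $T_-$; we then say that the pair $(T_+,T_-)$ represents $g$. **The representation.** Work with the Temperley–Lieb planar algebra with loop value $\delta=\sqrt2$ and the 2-box $R=2^{1/4}\bigl(\mathrm{id}_2-\tfrac1{\sqrt2}E\bigr)$, a multiple of the second Jones–Wenzl idempotent. For a standard dyadic partition $T$ with $n$ intervals, let $\mathcal H(T)$ be the complex vector space spanned by the Temperley–Lieb diagrams (crossingless pairings) with one boundary point at the bottom and, at the top, boundary points at the $n$ midpoints and the $n-1$ inner endpoints of the intervals. Its positive semidefinite inner product is given by $\langle p,q\rangle=\delta^{\ell(p,q)-1}$, where $\ell(p,q)$ is the number of closed loops obtained by gluing $p$ to the mirror image of $q$. When an interval is cut into halves, one maps the space of the old partition into the space of the new one by attaching $R$ to the string at the old midpoint, the three other boundary points of $R$ becoming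 the left new midpoint, the new endpoint and the right new midpoint. Here $\mathrm{id}_2$ continues the old string to the left new midpoint and joins the new endpoint to the right new midpoint by an arc; $E$ joins the left new midpoint to the new endpoint by an arc and continues the old string to the right new midpoint. These maps preserve the inner product and define a direct system over the standard dyadic partitions, ordered by refinement; let $\mathcal H$ be the Hilbert space completion of its direct limit (null vectors being divided out). Thompson's group acts on $\mathcal H$ by a unitary representation $\pi$: if $(T_+,T_-)$ represents $g$, then $\pi(g)$ sends the vector given by a diagram in $\mathcal H(T_+)$ to the vector given by the same diagram in $\mathcal H(T_-)$, the $i$-th top boundary point of $T_+$ being moved to the $i$-th one of $T_-$. The vacuum vector $\xi\in\mathcal H$ is the diagram consisting of a single vertical string, in the space of the trivial partition. The Jones subgroup is $$\vec F=\{g\in F:\ \pi(g)\xi=\xi\}.$$ **The graph.** Let $T_+,T_-$ have $n$ leaves each. Draw $T_+$ in the upper half plane and $T_-$, upside down, in the lower half plane, both with the leaves $(1/2,0),(3/2,0),\dots,((2n-1)/2,0)$ and with straight edges. The simple graph $\Gamma(T_+,T_-)$ has the vertices $(0,0),(1,0),\dots,(n-1,0)$; two of them are adjacent if and only if the regions containing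 them, in the upper or in the lower half plane, are separated by an edge of $T_+$ or of $T_-$ that leads from a vertex to its left child. **The group $F_3$.** For $N\ge2$ let $$F_N=\langle x_1,x_2,\dots\mid x_k^{-1}x_nx_k=x_{n+N-1}\ \text{ for all } 1\le k<n\rangle .$$ **Theorem.** The Jones subgroup $\vec F$ is isomorphic to $F_3$. Moreover, for every $g\in F$ and every pair of trees $(T_+,T_-)$ representing $g$, one has $g\in\vec F$ if and only if the graph $\Gamma(T_+,T_-)$ is bipartite. -/

import Mathlib

open scoped ComplexConjugate

namespace JonesThompson

/-- The number of connected components of the graph on the points `0, …, N - 1` in which every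
point `a` is joined to `f a` for every `f` in the list `L`. -/
noncomputable def components (N : ℕ) (L : List (ℕ → ℕ)) : ℕ :=
  Nat.card (Quot fun a b : Fin N => ∃ f ∈ L, f a = b)

/-- A Temperley–Lieb diagram with `2 * size` boundary points `0, …, 2 * size - 1`: a
crossingless perfect matching of the boundary points, recorded as a fixed-point free involution
(extended by the identity to all of `ℕ`). -/
@[ext] structure Diagram where
  size : ℕ
  pair : ℕ → ℕ
  pair_lt : ∀ i, i < 2 * size → pair i < 2 * size
  pair_eq : ∀ i, 2 * size ≤ i → pair i = i
  pair_pair : ∀ i, pair (pair i) = i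
  pair_ne : ∀ i, i < 2 * size → pair i ≠ i
  noncrossing : ∀ i j, i < j → j < pair i → pair j ≤ pair i

/-- The number of closed loops that appear when `p` and the mirror image of `q` are glued along
their boundary points. -/
noncomputable def Diagram.loops (p q : Diagram) : ℕ :=
  components (2 * p.size) [p.pair, q.pair]

/-- Renumbering of points when two new points are put in front of point `j`. -/
def up (j i : ℕ) : ℕ := if i < j then i else i + 2

/-- Renumbering of points when the points `j` and `j + 1` are removed. -/
def down (j i : ℕ) : ℕ := if i < j then i else i - 2

def insertFun (j : ℕ) (p : ℕ → ℕ) (i : ℕ) : ℕ :=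
  if i = j then j + 1 else if i = j + 1 then j else up j (p (down j i))

theorem down_up (j i : ℕ) : down j (up j i) = i := by unfold up down; grind

theorem up_ne (j i : ℕ) : up j i ≠ j ∧ up j i ≠ j + 1 := by unfold up; grind

theorem up_cases (j x : ℕ) : x = j ∨ x = j + 1 ∨ ∃ i, x = up j i := by
  by_cases h : x < j
  · exact .inr (.inr ⟨x, by unfold up; grind⟩)
  · by_cases h1 : x = j
    · exact .inl h1
    · by_cases h2 : x = j + 1
      · exact .inr (.inl h2)
      · exact .inr (.inr ⟨x - 2, by unfold up; grind⟩)

theorem up_lt_up (j a b : ℕ) : up j a < up j b ↔ a < b := by unfold up; grind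

theorem up_inj (j a b : ℕ) : up j a = up j b ↔ a = b := by unfold up; grind

theorem up_lt_bound {j N : ℕ} (hj : j ≤ N) (i : ℕ) : up j i < N + 2 ↔ i < N := by
  unfold up; grind

theorem insertFun_left (j : ℕ) (p : ℕ → ℕ) : insertFun j p j = j + 1 := by simp [insertFun]

theorem insertFun_right (j : ℕ) (p : ℕ → ℕ) : insertFun j p (j + 1) = j := by simp [insertFun]

theorem insertFun_up (j : ℕ) (p : ℕ → ℕ) (i : ℕ) : insertFun j p (up j i) = up j (p i) := by
  simp [insertFun, up_ne, down_up]

/-- Insert a new arc joining two new neighbouring points, which get the numbers `j` and `j + 1`;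
the old points from `j` on are shifted by two. -/
def Diagram.insertCup (p : Diagram) (j : ℕ) (hj : j ≤ 2 * p.size) : Diagram where
  size := p.size + 1
  pair := insertFun j p.pair
  pair_lt i hi := by
    rcases up_cases j i with rfl | rfl | ⟨i, rfl⟩
    · rw [insertFun_left]; omega
    · rw [insertFun_right]; omega
    · rw [insertFun_up]
      rw [mul_add, mul_one, up_lt_bound hj] at *
      exact p.pair_lt i hi
  pair_eq i hi := by
    rcases up_cases j i with rfl | rfl | ⟨i, rfl⟩
    · omega
    · omega
    · rw [insertFun_up, p.pair_eq]
      rw [mul_add, mul_one, ← not_lt, up_lt_bound hj, not_lt] at hi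
      exact hi
  pair_pair i := by
    rcases up_cases j i with rfl | rfl | ⟨i, rfl⟩
    · rw [insertFun_left, insertFun_right]
    · rw [insertFun_right, insertFun_left]
    · rw [insertFun_up, insertFun_up, p.pair_pair]
  pair_ne i hi := by
    rcases up_cases j i with rfl | rfl | ⟨i, rfl⟩
    · rw [insertFun_left]; omega
    · rw [insertFun_right]; omega
    · rw [insertFun_up, Ne, up_inj]
      rw [mul_add, mul_one, up_lt_bound hj] at hi
      exact p.pair_ne i hi
  noncrossing i k := by
    rcases up_cases j i with rfl | rfl | ⟨i, rfl⟩
    · rw [insertFun_left]; omega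
    · rw [insertFun_right]; omega
    · rcases up_cases j k with rfl | rfl | ⟨k, rfl⟩
      · rw [insertFun_left, insertFun_up]
        have := up_ne k (p.pair i)
        omega
      · rw [insertFun_right, insertFun_up]; omega
      · simp only [insertFun_up, up_lt_up, ← not_lt]
        have := p.noncrossing i k
        omega

/-- The pairing in which the partners of `j` and `j + 1` are joined to each other. -/
def joinFun (j : ℕ) (q : ℕ → ℕ) (x : ℕ) : ℕ :=
  if q x = j then q (j + 1) else if q x = j + 1 then q j else q x

def capFun (j : ℕ) (q : ℕ → ℕ) (i : ℕ) : ℕ := down j (joinFun j q (up j i))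

theorem up_capFun {j N : ℕ} (q : ℕ → ℕ) (hq : ∀ i, q (q i) = i) (hn : ∀ i, i < N → q i ≠ i)
    (hj : j + 1 < N) (i : ℕ) : up j (capFun j q i) = joinFun j q (up j i) := by
  have h1 := up_ne j i
  have h2 := hq (up j i)
  have h3 := hq j
  have h4 := hq (j + 1)
  have h5 := hn j
  have h6 := hn (j + 1)
  rcases up_cases j (joinFun j q (up j i)) with h | h | ⟨k, h⟩
  · unfold joinFun at h; grind
  · unfold joinFun at h; grind
  · rw [capFun, h, down_up]

/-- Join the points `j` and `j + 1` of a diagram by an arc and remove them. -/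
def Diagram.cap (q : Diagram) (n : ℕ) (hn : q.size = n + 1) (j : ℕ) (hj : j ≤ 2 * n) :
    Diagram where
  size := n
  pair := capFun j q.pair
  pair_lt i hi := by
    rw [← up_lt_bound hj, up_capFun q.pair q.pair_pair q.pair_ne (by omega)]
    have h1 := q.pair_lt (up j i)
    have h2 := q.pair_lt j
    have h3 := q.pair_lt (j+1)
    have h4 := (up_lt_bound hj i).2 hi
    unfold joinFun
    grind
  pair_eq i hi := by
    rw [← up_inj j, up_capFun q.pair q.pair_pair q.pair_ne (by omega)]
    have h4 := up_lt_bound hj i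
    have h1 := q.pair_eq (up j i)
    have h5 := up_ne j i
    unfold joinFun
    grind
  pair_pair i := by
    rw [← up_inj j, up_capFun q.pair q.pair_pair q.pair_ne (by omega),
      up_capFun q.pair q.pair_pair q.pair_ne (by omega)]
    have h4 := q.pair_pair (up j i)
    have h5 := q.pair_pair j
    have h6 := q.pair_pair (j+1)
    have h7 := q.pair_ne j
    have h8 := q.pair_ne (j+1)
    have h9 := up_ne j i
    unfold joinFun
    grind
  pair_ne i hi := by
    rw [Ne, ← up_inj j, up_capFun q.pair q.pair_pair q.pair_ne (by omega)]
    have h4 := q.pair_pair (up j i)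
    have h5 := q.pair_pair j
    have h6 := q.pair_pair (j+1)
    have h7 := q.pair_ne (up j i)
    have h8 := (up_lt_bound hj i).2 hi
    have h9 := up_ne j i
    unfold joinFun
    grind
  noncrossing i k := by
    rw [← not_lt, ← up_lt_up j i k, ← up_lt_up j k, ← up_lt_up j (capFun j q.pair i),
      up_capFun q.pair q.pair_pair q.pair_ne (by omega),
      up_capFun q.pair q.pair_pair q.pair_ne (by omega)]
    have a1 := q.pair_pair (up j i)
    have a2 := q.pair_pair (up j k)
    have h5 := q.pair_pair j
    have h6 := q.pair_pair (j+1)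
    have e1 := up_ne j i
    have e2 := up_ne j k
    have c1 : q.pair (up j i) = j + 1 → up j i = q.pair (j + 1) := fun h => by rw [← h, a1]
    have c2 : q.pair (up j k) = j + 1 → up j k = q.pair (j + 1) := fun h => by rw [← h, a2]
    have c3 : q.pair (up j i) = j → up j i = q.pair j := fun h => a1.symm.trans (congrArg q.pair h)
    have c4 : q.pair (up j k) = j → up j k = q.pair j := fun h => a2.symm.trans (congrArg q.pair h)
    generalize up j i = x at *
    generalize up j k = y at *
    have n1 := q.noncrossing x y
    have n2 := q.noncrossing x (q.pair y)
    have n3 := q.noncrossing (q.pair x) y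
    have n4 := q.noncrossing y x
    have n5 := q.noncrossing y (q.pair x)
    have n6 := q.noncrossing (q.pair y) x
    have n7 := q.noncrossing x j
    have n8 := q.noncrossing x (j+1)
    have n9 := q.noncrossing y j
    have n10 := q.noncrossing y (j+1)
    have m1 := q.noncrossing j x
    have m2 := q.noncrossing (j+1) x
    have m3 := q.noncrossing j y
    have m4 := q.noncrossing (j+1) y
    have m5 := q.noncrossing (q.pair j) x
    have m6 := q.noncrossing (q.pair (j+1)) x
    have m7 := q.noncrossing (q.pair j) y
    have m8 := q.noncrossing (q.pair (j+1)) y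
    have k1 := q.noncrossing x (q.pair j)
    have k2 := q.noncrossing x (q.pair (j+1))
    have k3 := q.noncrossing y (q.pair j)
    have k4 := q.noncrossing y (q.pair (j+1))
    clear n2 n3 n5 n6
    rw [h5, h6] at *
    unfold joinFun
    intro hik hk
    split_ifs at hk ⊢ <;> grind (splits := 30)

/-- `f` restricts to a fixed-point free involution of `0, …, N - 1`. -/
structure IsMatching (N : ℕ) (f : ℕ → ℕ) : Prop where
  lt : ∀ i, i < N → f i < N
  invol : ∀ i, f (f i) = i
  ne : ∀ i, i < N → f i ≠ i

theorem Diagram.isMatching (p : Diagram) : IsMatching (2 * p.size) p.pair :=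
  ⟨p.pair_lt, p.pair_pair, p.pair_ne⟩

def Rel (N : ℕ) (L : List (ℕ → ℕ)) (a b : Fin N) : Prop := ∃ f ∈ L, f a = b

def RelJ (N : ℕ) (L : List (ℕ → ℕ)) (j : ℕ) (a b : Fin N) : Prop :=
  Rel N L a b ∨ ((a : ℕ) = j ∧ (b : ℕ) = j + 1)

theorem components_def (N : ℕ) (L : List (ℕ → ℕ)) : components N L = Nat.card (Quot (Rel N L)) :=
  rfl

theorem components_congr (N : ℕ) {L L' : List (ℕ → ℕ)} (h : ∀ f, f ∈ L ↔ f ∈ L') :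
    components N L = components N L' := by
  unfold components
  simp only [h]

theorem mk_eq_of_rel {N : ℕ} {L : List (ℕ → ℕ)} {f : ℕ → ℕ} (hf : f ∈ L) {a b : Fin N}
    (h : f a = b) : Quot.mk (Rel N L) a = Quot.mk (Rel N L) b := Quot.sound ⟨f, hf, h⟩

theorem mk_mono {N : ℕ} {L L' : List (ℕ → ℕ)} (hL : ∀ f ∈ L, f ∈ L') {a b : Fin N}
    (h : Quot.mk (Rel N L) a = Quot.mk (Rel N L) b) :
    Quot.mk (Rel N L') a = Quot.mk (Rel N L') b := by
  have := congrArg (Quot.map (rb := Rel N L') id fun a b ⟨f, hf, h⟩ => ⟨f, hL f hf, h⟩) h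
  exact this

theorem capFun_up {j : ℕ} {f : ℕ → ℕ} {a b : ℕ}
    (h : f (up j a) = up j b) : capFun j f a = b := by
  have h1 := up_ne j b
  rw [capFun, joinFun, if_neg (by rw [h]; exact h1.1), if_neg (by rw [h]; exact h1.2), h, down_up]

theorem capFun_join {M j : ℕ} {f : ℕ → ℕ} (hf : IsMatching (M + 2) f) {a b : ℕ}
    (ha : f j = up j a) (hb : f (j + 1) = up j b) : capFun j f a = b := by
  rw [capFun, joinFun, if_pos (by rw [← ha, hf.invol]), hb, down_up]

/-- If `j` is not joined to `j + 1`, then the partners of `j` and `j + 1` are old points. -/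
theorem exists_partners {M j : ℕ} (hj : j ≤ M) {f : ℕ → ℕ} (hf : IsMatching (M + 2) f)
    (h : f j ≠ j + 1) : ∃ a b, a < M ∧ b < M ∧ f j = up j a ∧ f (j + 1) = up j b := by
  have h1 := hf.ne j (by omega)
  have h2 := hf.ne (j + 1) (by omega)
  have h3 := hf.invol (j + 1)
  rcases up_cases j (f j) with h' | h' | ⟨a, ha⟩
  · exact absurd h' h1
  · exact absurd h' h
  · rcases up_cases j (f (j + 1)) with h' | h' | ⟨b, hb⟩
    · rw [h'] at h3; exact absurd h3 h
    · exact absurd h' h2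
    · refine ⟨a, b, ?_, ?_, ha, hb⟩
      · rw [← up_lt_bound hj, ← ha]; exact hf.lt _ (by omega)
      · rw [← up_lt_bound hj, ← hb]; exact hf.lt _ (by omega)

theorem capFun_lt {M j : ℕ} (hj : j ≤ M) {f : ℕ → ℕ} (hf : IsMatching (M + 2) f) {a : ℕ}
    (ha : a < M) : capFun j f a < M := by
  rw [← up_lt_bound hj, up_capFun f hf.invol hf.ne (by omega)]
  have h1 := hf.lt _ ((up_lt_bound hj a).2 ha)
  have h2 := hf.lt j (by omega)
  have h3 := hf.lt (j + 1) (by omega)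
  unfold joinFun
  split_ifs <;> assumption

/-- The class of the old point `x` after capping (the point `z` is used for `j` and `j + 1`). -/
noncomputable def fwd (M j : ℕ) (hj : j ≤ M) (Q : Type) (c : Fin M → Q) (z : Q) (x : Fin (M + 2)) :
    Q :=
  if h : (x : ℕ) = j ∨ (x : ℕ) = j + 1 then z else c ⟨down j x, by
    have := x.2; push Not at h; unfold down; split_ifs <;> omega⟩

theorem fwd_up {M j : ℕ} (hj : j ≤ M) {Q : Type} (c : Fin M → Q) (z : Q) (x : Fin (M + 2))
    (i : Fin M) (h : (x : ℕ) = up j i) : fwd M j hj Q c z x = c i := by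
  have := up_ne j i
  rw [fwd, dif_neg (by omega)]
  congr 1
  ext
  simp [h, down_up]

theorem fwd_new {M j : ℕ} (hj : j ≤ M) {Q : Type} (c : Fin M → Q) (z : Q) (x : Fin (M + 2))
    (h : (x : ℕ) = j ∨ (x : ℕ) = j + 1) : fwd M j hj Q c z x = z := by
  rw [fwd, dif_pos h]

theorem fin_cases_up {M j : ℕ} (hj : j ≤ M) (x : Fin (M + 2)) :
    (x : ℕ) = j ∨ (x : ℕ) = j + 1 ∨ ∃ i : Fin M, (x : ℕ) = up j i := by
  rcases up_cases j x with h | h | ⟨i, h⟩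
  · exact .inl h
  · exact .inr (.inl h)
  · exact .inr (.inr ⟨⟨i, by rw [← up_lt_bound hj, ← h]; exact x.2⟩, h⟩)

def upFin {M j : ℕ} (hj : j ≤ M) (i : Fin M) : Fin (M + 2) := ⟨up j i, (up_lt_bound hj i).2 i.2⟩

theorem card_relJ {M j : ℕ} (hj : j ≤ M) (L : List (ℕ → ℕ)) (hL : ∀ f ∈ L, IsMatching (M + 2) f)
    (z : Quot (Rel M (L.map (capFun j))))
    (hz : ∀ f ∈ L, ∀ a : Fin M, f j = up j a → Quot.mk _ a = z)
    (hex : ∃ f ∈ L, f j ≠ j + 1) :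
    Nat.card (Quot (RelJ (M + 2) L j)) = components M (L.map (capFun j)) := by
  rw [components_def]
  have hz' : ∀ f ∈ L, ∀ b : Fin M, f (j + 1) = up j b → Quot.mk _ b = z := by
    intro f hf b hb
    have hm := hL f hf
    have hne : f j ≠ j + 1 := by
      intro h
      have := hm.invol j
      rw [h, hb] at this
      exact (up_ne j b).1 this
    obtain ⟨a, b', ha, hb', e1, e2⟩ := exists_partners hj hm hne
    rw [← hz f hf ⟨a, ha⟩ e1]
    exact (mk_eq_of_rel (List.mem_map_of_mem hf) (capFun_join hm e1 hb)).symm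
  have hF : ∀ a b, RelJ (M + 2) L j a b →
      fwd M j hj _ (Quot.mk (Rel M (L.map (capFun j)))) z a =
      fwd M j hj _ (Quot.mk (Rel M (L.map (capFun j)))) z b := by
    rintro a b (⟨f, hf, hab⟩ | ⟨ha, hb⟩)
    · have hba : f b = a := by rw [← hab, (hL f hf).invol]
      rcases fin_cases_up hj a with ha | ha | ⟨a', ha⟩ <;>
      rcases fin_cases_up hj b with hb | hb | ⟨b', hb⟩
      · rw [fwd_new _ _ _ _ (by tauto), fwd_new _ _ _ _ (by tauto)]
      · rw [fwd_new _ _ _ _ (by tauto), fwd_new _ _ _ _ (by tauto)]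
      · rw [fwd_new _ _ _ _ (by tauto), fwd_up _ _ _ _ _ hb]
        exact (hz f hf b' (by rw [ha] at hab; omega)).symm
      · rw [fwd_new _ _ _ _ (by tauto), fwd_new _ _ _ _ (by tauto)]
      · rw [fwd_new _ _ _ _ (by tauto), fwd_new _ _ _ _ (by tauto)]
      · rw [fwd_new _ _ _ _ (by tauto), fwd_up _ _ _ _ _ hb]
        exact (hz' f hf b' (by rw [ha] at hab; omega)).symm
      · rw [fwd_new _ _ _ b (by tauto), fwd_up _ _ _ _ _ ha]
        exact hz f hf a' (by rw [hb] at hba; omega)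
      · rw [fwd_new _ _ _ b (by tauto), fwd_up _ _ _ _ _ ha]
        exact hz' f hf a' (by rw [hb] at hba; omega)
      · rw [fwd_up _ _ _ _ _ ha, fwd_up _ _ _ _ _ hb]
        exact mk_eq_of_rel (List.mem_map_of_mem hf) (capFun_up (by rw [← ha, hab, hb]))
    · rw [fwd_new _ _ _ _ (by tauto), fwd_new _ _ _ _ (by tauto)]
  let J : Fin (M + 2) := ⟨j, by omega⟩
  let J1 : Fin (M + 2) := ⟨j + 1, by omega⟩
  have hJ : Quot.mk (RelJ (M + 2) L j) J = Quot.mk _ J1 := Quot.sound (.inr ⟨rfl, rfl⟩)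
  have hR : ∀ f ∈ L, ∀ a b : Fin (M + 2), f a = b →
      Quot.mk (RelJ (M + 2) L j) a = Quot.mk _ b :=
    fun f hf a b h => Quot.sound (.inl ⟨f, hf, h⟩)
  have hG : ∀ a b, Rel M (L.map (capFun j)) a b →
      Quot.mk (RelJ (M + 2) L j) (upFin hj a) = Quot.mk _ (upFin hj b) := by
    rintro a b ⟨g, hg, hab⟩
    obtain ⟨f, hf, rfl⟩ := List.mem_map.1 hg
    have hm := hL f hf
    have h1 := up_capFun f hm.invol hm.ne (j := j) (by omega) a
    rw [hab] at h1
    unfold joinFun at h1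
    split_ifs at h1 with h2 h3
    · rw [hR f hf (upFin hj a) J h2, hJ, hR f hf J1 (upFin hj b) h1.symm]
    · rw [hR f hf (upFin hj a) J1 h3, ← hJ, hR f hf J (upFin hj b) h1.symm]
    · exact hR f hf _ _ h1.symm
  refine Nat.card_congr ⟨Quot.lift _ hF, Quot.lift (fun i => Quot.mk _ (upFin hj i)) hG, ?_, ?_⟩
  · rintro ⟨x⟩
    have hzJ : Quot.lift (fun i => Quot.mk (RelJ (M + 2) L j) (upFin hj i)) hG z =
        Quot.mk _ J := by
      obtain ⟨f, hf, hne⟩ := hex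
      obtain ⟨a, b, ha, hb, e1, e2⟩ := exists_partners hj (hL f hf) hne
      rw [← hz f hf ⟨a, ha⟩ e1]
      exact (hR f hf J (upFin hj ⟨a, ha⟩) e1).symm
    change Quot.lift _ hG (fwd M j hj _ _ z x) = _
    rcases fin_cases_up hj x with h | h | ⟨i, h⟩
    · rw [fwd_new _ _ _ _ (by tauto), hzJ]; congr 1; ext; exact h.symm
    · rw [fwd_new _ _ _ _ (by tauto), hzJ, hJ]; congr 1; ext; exact h.symm
    · rw [fwd_up _ _ _ _ _ h]
      change Quot.mk _ (upFin hj i) = _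
      congr 1; ext; exact h.symm
  · rintro ⟨i⟩
    exact fwd_up hj _ _ _ i rfl

theorem card_relJ_of_mem {M j : ℕ} (L : List (ℕ → ℕ)) (hex : ∃ f ∈ L, f j = j + 1) :
    Nat.card (Quot (RelJ (M + 2) L j)) = components (M + 2) L := by
  rw [components_def]
  congr 2
  funext a b
  refine propext ⟨?_, .inl⟩
  rintro (h | ⟨ha, hb⟩)
  · exact h
  · obtain ⟨f, hf, h⟩ := hex
    exact ⟨f, hf, by rw [ha, hb, h]⟩

theorem components_all {M j : ℕ} (hj : j ≤ M) (L : List (ℕ → ℕ))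
    (hL : ∀ f ∈ L, IsMatching (M + 2) f) (hne : L ≠ []) (h : ∀ f ∈ L, f j = j + 1) :
    components (M + 2) L = components M (L.map (capFun j)) + 1 := by
  rw [components_def, components_def]
  have h' : ∀ f ∈ L, f (j + 1) = j := fun f hf => by rw [← h f hf, (hL f hf).invol]
  have hF : ∀ a b, Rel (M + 2) L a b →
      fwd M j hj _ (fun i => some (Quot.mk (Rel M (L.map (capFun j))) i)) none a =
      fwd M j hj _ (fun i => some (Quot.mk (Rel M (L.map (capFun j))) i)) none b := by
    rintro a b ⟨f, hf, hab⟩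
    have hba : f b = a := by rw [← hab, (hL f hf).invol]
    have e1 := h f hf
    have e2 := h' f hf
    rcases fin_cases_up hj a with ha | ha | ⟨a', ha⟩
    · rw [fwd_new _ _ _ _ (by tauto), fwd_new _ _ _ _ (by rw [ha] at hab; omega)]
    · rw [fwd_new _ _ _ _ (by tauto), fwd_new _ _ _ _ (by rw [ha] at hab; omega)]
    · have := up_ne j a'
      rcases fin_cases_up hj b with hb | hb | ⟨b', hb⟩
      · rw [hb] at hba; omega
      · rw [hb] at hba; omega
      · rw [fwd_up _ _ _ _ _ ha, fwd_up _ _ _ _ _ hb]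
        exact congrArg some
          (mk_eq_of_rel (List.mem_map_of_mem hf) (capFun_up (by rw [← ha, hab, hb])))
  have hG : ∀ a b, Rel M (L.map (capFun j)) a b →
      Quot.mk (Rel (M + 2) L) (upFin hj a) = Quot.mk _ (upFin hj b) := by
    rintro a b ⟨g, hg, hab⟩
    obtain ⟨f, hf, rfl⟩ := List.mem_map.1 hg
    have hm := hL f hf
    have h1 := up_capFun f hm.invol hm.ne (j := j) (by omega) a
    rw [hab] at h1
    unfold joinFun at h1
    have e1 := h f hf
    have e2 := h' f hf
    have e3 := hm.invol (up j a)
    have e4 := up_ne j a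
    split_ifs at h1 with h2 h3
    · rw [h2] at e3; omega
    · rw [h3] at e3; omega
    · exact mk_eq_of_rel hf h1.symm
  let J : Fin (M + 2) := ⟨j, by omega⟩
  let J1 : Fin (M + 2) := ⟨j + 1, by omega⟩
  have hJ : Quot.mk (Rel (M + 2) L) J = Quot.mk _ J1 := by
    obtain ⟨f, hf⟩ := List.exists_mem_of_ne_nil L hne
    exact mk_eq_of_rel hf (h f hf)
  rw [← Finite.card_option]
  refine Nat.card_congr ⟨Quot.lift _ hF,
    fun o => o.elim (Quot.mk _ J) (Quot.lift (fun i => Quot.mk _ (upFin hj i)) hG), ?_, ?_⟩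
  · rintro ⟨x⟩
    change Option.elim (fwd M j hj _ _ none x) _ _ = _
    rcases fin_cases_up hj x with h | h | ⟨i, h⟩
    · rw [fwd_new _ _ _ _ (by tauto)]; simp only [Option.elim]; congr 1; ext; exact h.symm
    · rw [fwd_new _ _ _ _ (by tauto)]; simp only [Option.elim]; rw [hJ]; congr 1; ext; exact h.symm
    · rw [fwd_up _ _ _ _ _ h]
      change Quot.mk _ (upFin hj i) = _
      congr 1; ext; exact h.symm
  · rintro (_ | ⟨⟨i⟩⟩)
    · exact fwd_new hj _ _ J (.inl rfl)
    · exact fwd_up hj _ _ _ i rfl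

open Classical in
theorem components_of_ne {M j : ℕ} (L : List (ℕ → ℕ)) (hj : j ≤ M)
    (h : Quot.mk (Rel (M + 2) L) ⟨j, by omega⟩ ≠ Quot.mk _ ⟨j + 1, by omega⟩) :
    components (M + 2) L = Nat.card (Quot (RelJ (M + 2) L j)) + 1 := by
  rw [components_def, ← Finite.card_option]
  set J : Fin (M + 2) := ⟨j, by omega⟩
  set J1 : Fin (M + 2) := ⟨j + 1, by omega⟩
  have hJ : Quot.mk (RelJ (M + 2) L j) J = Quot.mk _ J1 := Quot.sound (.inr ⟨rfl, rfl⟩)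
  let φ : Quot (Rel (M + 2) L) → Quot (RelJ (M + 2) L j) := Quot.map id fun a b h => .inl h
  have hG : ∀ a b, RelJ (M + 2) L j a b →
      (if Quot.mk (Rel (M + 2) L) a = Quot.mk _ J1 then Quot.mk (Rel (M + 2) L) J else Quot.mk _ a) =
      (if Quot.mk (Rel (M + 2) L) b = Quot.mk _ J1 then Quot.mk _ J else Quot.mk _ b) := by
    rintro a b (hab | ⟨ha, hb⟩)
    · rw [Quot.sound hab]
    · have ha : a = J := Fin.ext ha
      have hb : b = J1 := Fin.ext hb
      rw [ha, hb, if_neg h, if_pos rfl]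
  refine Nat.card_congr ⟨fun c => if c = Quot.mk _ J1 then none else some (φ c),
    fun o => o.elim (Quot.mk _ J1) (Quot.lift _ hG), ?_, ?_⟩
  · rintro ⟨x⟩
    by_cases hx : Quot.mk (Rel (M + 2) L) x = Quot.mk _ J1
    · simp [hx]
    · simp only [if_neg hx, Option.elim, φ, Quot.map, id]
  · rintro (_ | ⟨⟨x⟩⟩)
    · simp
    · by_cases hx : Quot.mk (Rel (M + 2) L) x = Quot.mk _ J1
      · have hx' : Quot.mk (RelJ (M + 2) L j) x = Quot.mk _ J1 := congrArg φ hx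
        simp only [Option.elim, if_pos hx, if_neg h]
        rw [hx', ← hJ]
        rfl
      · simp only [Option.elim, if_neg hx]
        rfl

theorem even_card_of_invol (A : Finset ℕ) (f : ℕ → ℕ) (h1 : ∀ a ∈ A, f a ∈ A)
    (h2 : ∀ a ∈ A, f (f a) = a) (h3 : ∀ a ∈ A, f a ≠ a) : Even A.card := by
  have : ∑ a ∈ A, (1 : ZMod 2) = 0 :=
    Finset.sum_involution (fun a _ => f a) (fun _ _ => by decide) (fun a ha _ => h3 a ha)
      (fun a ha => h1 a ha) (fun a ha => h2 a ha)
  rw [Finset.sum_const, nsmul_eq_mul, mul_one, ZMod.natCast_eq_zero_iff] at this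
  exact even_iff_two_dvd.2 this

open Classical in
theorem partners_linked {M j : ℕ} (hj : j ≤ M) {q e : ℕ → ℕ} (hq : IsMatching (M + 2) q)
    (he : IsMatching (M + 2) e) (h : Quot.mk (Rel (M + 2) [q, e]) ⟨j, by omega⟩ ≠
      Quot.mk _ ⟨j + 1, by omega⟩) (a b : Fin M) (ha : q j = up j a) (hb : e j = up j b) :
    Quot.mk (Rel M ([q, e].map (capFun j))) a = Quot.mk _ b := by
  by_contra hab
  set r := Rel M ([q, e].map (capFun j))
  let P : ℕ → Prop := fun x => ∃ i : Fin M, x = up j i ∧ Quot.mk r i = Quot.mk r a ∧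
    Quot.mk (Rel (M + 2) [q, e]) (upFin hj i) = Quot.mk _ ⟨j, by omega⟩
  let A : Finset ℕ := {x ∈ Finset.range (M + 2) | P x}
  have hA : ∀ x, x ∈ A ↔ P x := by
    intro x
    simp only [A, Finset.mem_filter, Finset.mem_range, and_iff_right_iff_imp]
    rintro ⟨i, rfl, -⟩
    exact (up_lt_bound hj i).2 i.2
  -- moving along `f` stays in `A` unless one arrives at `j`
  have key : ∀ f ∈ [q, e], ∀ x ∈ A, f x ≠ j → f x ∈ A := by
    intro f hf x hx hne
    have hm : IsMatching (M + 2) f := by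
      simp only [List.mem_cons, List.not_mem_nil, or_false] at hf
      rcases hf with rfl | rfl <;> assumption
    obtain ⟨i, rfl, h1, h2⟩ := (hA x).1 hx
    have hlt : f (up j i) < M + 2 := hm.lt _ ((up_lt_bound hj i).2 i.2)
    have h3 : Quot.mk (Rel (M + 2) [q, e]) (upFin hj i) = Quot.mk _ ⟨f (up j i), hlt⟩ :=
      mk_eq_of_rel hf rfl
    rcases fin_cases_up hj ⟨f (up j i), hlt⟩ with h4 | h4 | ⟨k, h4⟩
    · exact absurd h4 hne
    · exfalso
      apply h
      rw [← h2, h3]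
      congr 1
      ext
      exact h4
    · refine (hA _).2 ⟨k, h4, ?_, ?_⟩
      · rw [← h1]
        exact (mk_eq_of_rel (List.mem_map_of_mem hf) (capFun_up h4)).symm
      · rw [← h2, h3]
        congr 1
        ext
        exact h4.symm
  have hjA : ∀ x ∈ A, x < M + 2 := fun x hx => by
    obtain ⟨i, rfl, -⟩ := (hA x).1 hx
    exact (up_lt_bound hj i).2 i.2
  have hqj : q j ∈ A := by
    refine (hA _).2 ⟨a, ha, rfl, ?_⟩
    exact mk_eq_of_rel (f := q) (by simp) (by
      change q (up j a) = j
      rw [← ha, hq.invol])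
  have c1 : Even A.card := by
    refine even_card_of_invol A e (fun x hx => key e (by simp) x hx ?_) (fun x _ => he.invol x)
      (fun x hx => he.ne x (hjA x hx))
    intro hxj
    obtain ⟨i, rfl, h1, h2⟩ := (hA x).1 hx
    have : up j i = up j b := by
      have h4 := congrArg e hxj
      rw [he.invol] at h4
      exact h4.trans hb
    rw [up_inj, ← Fin.ext_iff] at this
    rw [this] at h1
    exact hab h1.symm
  have c2 : Even (A.erase (q j)).card := by
    refine even_card_of_invol _ q (fun x hx => ?_) (fun x _ => hq.invol x)
      (fun x hx => hq.ne x (hjA x (Finset.mem_of_mem_erase hx)))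
    obtain ⟨h1, h2⟩ := Finset.mem_erase.1 hx
    refine Finset.mem_erase.2 ⟨?_, key q (by simp) x h2 ?_⟩
    · intro h3
      have := congrArg q h3
      rw [hq.invol, hq.invol] at this
      obtain ⟨i, rfl, -⟩ := (hA x).1 h2
      exact (up_ne j i).1 this
    · intro h3
      exact h1 (by rw [← h3, hq.invol])
  have c3 := Finset.card_erase_add_one hqj
  rw [← c3] at c1
  exact (Nat.even_add_one.1 c1) c2

theorem capFun_insertFun (j : ℕ) (p : ℕ → ℕ) : capFun j (insertFun j p) = p := by
  funext i
  have := up_ne j (p i)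
  rw [capFun, joinFun, insertFun_up, if_neg this.1, if_neg this.2, down_up]

theorem capFun_insertFun_succ {m N : ℕ} {p : ℕ → ℕ} (hp : IsMatching N p) (hm : m < N) :
    capFun m (insertFun (m + 1) p) = p := by
  funext i
  have h1 := hp.ne m hm
  have h2 := hp.invol i
  rcases lt_trichotomy i m with h | h | h
  · have e1 : up m i = i := by simp [up, h]
    have e2 : insertFun (m + 1) p i = up (m + 1) (p i) := by
      have := insertFun_up (m + 1) p i
      rwa [show up (m + 1) i = i by unfold up; grind] at this
    rw [capFun, joinFun, e1, e2, insertFun_left]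
    unfold up down
    grind
  · subst h
    have e1 : up i i = i + 1 + 1 := by simp [up]
    have e2 : insertFun (i + 1) p i = up (i + 1) (p i) := by
      have := insertFun_up (i + 1) p i
      rwa [show up (i + 1) i = i by simp [up]] at this
    rw [capFun, joinFun, e1, e2, insertFun_right]
    unfold up down
    grind
  · have e1 : up m i = up (m + 1) i := by unfold up; grind
    rw [capFun, joinFun, e1, insertFun_up, insertFun_left]
    unfold up down
    grind

theorem components_one {M j : ℕ} (hj : j ≤ M) (L : List (ℕ → ℕ))
    (hL : ∀ f ∈ L, IsMatching (M + 2) f) {f g : ℕ → ℕ} (hf : f ∈ L) (hfj : f j = j + 1)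
    (hg : g ∈ L) (hgj : g j ≠ j + 1)
    (hlink : ∀ f ∈ L, ∀ a b : Fin M, f j = up j a → g j = up j b →
      Quot.mk (Rel M (L.map (capFun j))) a = Quot.mk _ b) :
    components (M + 2) L = components M (L.map (capFun j)) := by
  obtain ⟨a, b, ha, hb, e1, e2⟩ := exists_partners hj (hL g hg) hgj
  rw [← card_relJ_of_mem L ⟨f, hf, hfj⟩]
  exact card_relJ hj L hL (Quot.mk _ ⟨a, ha⟩) (fun f hf a' h => hlink f hf a' ⟨a, ha⟩ h e1)
    ⟨g, hg, hgj⟩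

theorem components_pair_one {M j : ℕ} (hj : j ≤ M) {f g : ℕ → ℕ} (hf : IsMatching (M + 2) f)
    (hg : IsMatching (M + 2) g) (hfj : f j = j + 1) (hgj : g j ≠ j + 1) :
    components (M + 2) [f, g] = components M [capFun j f, capFun j g] := by
  refine components_one hj [f, g] (by simp [hf, hg]) (f := f) (by simp) hfj (g := g) (by simp)
    hgj ?_
  intro f' hf' a b h1 h2
  simp only [List.mem_cons, List.not_mem_nil, or_false] at hf'
  rcases hf' with rfl | rfl
  · exact absurd (h1.symm.trans hfj) (up_ne j a).2
  · rw [h1, up_inj] at h2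
    rw [Fin.ext h2]

theorem components_pair_comm (N : ℕ) (f g : ℕ → ℕ) : components N [f, g] = components N [g, f] :=
  components_congr N (by simp [or_comm])

theorem Diagram.loops_comm (p q : Diagram) (h : p.size = q.size) : p.loops q = q.loops p := by
  rw [loops, loops, h, components_pair_comm]

theorem Diagram.loops_insert_same (p q : Diagram) (h : p.size = q.size) (j : ℕ)
    (hp : j ≤ 2 * p.size) (hq : j ≤ 2 * q.size) :
    (p.insertCup j hp).loops (q.insertCup j hq) = p.loops q + 1 := by
  have h1 := (p.insertCup j hp).isMatching
  have h2 := (q.insertCup j hq).isMatching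
  have e : (q.insertCup j hq).size = (p.insertCup j hp).size := by
    change q.size + 1 = p.size + 1; rw [h]
  rw [e] at h2
  have := components_all hp [insertFun j p.pair, insertFun j q.pair] (by
    intro f hf
    simp only [List.mem_cons, List.not_mem_nil, or_false] at hf
    rcases hf with rfl | rfl
    · exact h1
    · exact h2) (by simp) (by simp [insertFun_left])
  simp only [List.map, capFun_insertFun] at this
  exact this

theorem Diagram.loops_insert_succ (p q : Diagram) (h : p.size = q.size) (j : ℕ)
    (hp : j + 1 ≤ 2 * p.size) (hq : j ≤ 2 * q.size) :
    (p.insertCup (j + 1) hp).loops (q.insertCup j hq) = p.loops q := by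
  have h1 := (p.insertCup (j + 1) hp).isMatching
  have h2 := (q.insertCup j hq).isMatching
  have e : (q.insertCup j hq).size = (p.insertCup (j + 1) hp).size := by
    change q.size + 1 = p.size + 1; rw [h]
  rw [e] at h2
  have hj : j ≤ 2 * p.size := by omega
  have hne : insertFun (j + 1) p.pair j ≠ j + 1 := by
    have h3 := insertFun_up (j + 1) p.pair j
    rw [show up (j + 1) j = j by simp [up]] at h3
    rw [h3]
    exact (up_ne _ _).1
  have := components_pair_one hj h2 h1 (insertFun_left j q.pair) hne
  have e1 := capFun_insertFun_succ p.isMatching (m := j) (by omega)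
  have e2 : capFun j (q.insertCup j hq).pair = q.pair := capFun_insertFun j q.pair
  have e3 : capFun j (p.insertCup (j + 1) hp).pair = p.pair := e1
  rw [e2, e3, components_pair_comm, components_pair_comm (2 * p.size)] at this
  exact this

/-- The diagram in which `2 * k` is joined to `2 * k + 1` for all `k`. -/
def baseDiagram (n : ℕ) : Diagram where
  size := n
  pair i := if i < 2 * n then (if i % 2 = 0 then i + 1 else i - 1) else i
  pair_lt i hi := by grind
  pair_eq i hi := by grind
  pair_pair i := by grind
  pair_ne i hi := by grind
  noncrossing i j := by grind

theorem capFun_base {n j : ℕ} (hj : j ≤ 2 * n) :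
    capFun j (baseDiagram (n + 1)).pair = (baseDiagram n).pair := by
  funext i
  simp only [capFun, joinFun, baseDiagram, up, down]
  grind

theorem Diagram.exists_adjacent_aux (p : Diagram) (d : ℕ) :
    ∀ i, p.pair i = i + d + 1 → ∃ j, p.pair j = j + 1 := by
  induction d using Nat.strong_induction_on with
  | _ d ih =>
    intro i hi
    rcases Nat.eq_zero_or_pos d with rfl | hd
    · exact ⟨i, hi⟩
    · have h1 := p.noncrossing i (i + 1)
      have h2 := p.noncrossing (p.pair (i + 1)) i
      have h3 := p.pair_pair i
      have h4 := p.pair_pair (i + 1)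
      have h5 := p.pair_ne (i + 1)
      have h6 := p.pair_eq (i + 1)
      have h7 := p.pair_lt i
      have h8 := p.pair_eq i
      have h9 : i + 1 < 2 * p.size := by
        by_contra h
        by_cases h10 : i < 2 * p.size
        · have := h7 h10; omega
        · have := h8 (by omega); omega
      have h11 : p.pair (i + 1) ≠ i := fun h => by rw [h] at h4; omega
      have h12 : p.pair (i + 1) ≠ p.pair i := fun h => by rw [h, h3] at h4; omega
      have h13 : i + 1 < p.pair (i + 1) := by
        have := h5 h9
        by_contra h
        have := h2 (by omega) (by omega)
        omega
      have h14 := h1 (by omega) (by omega)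
      exact ih (p.pair (i + 1) - (i + 1) - 1) (by omega) (i + 1) (by omega)

theorem Diagram.exists_adjacent (p : Diagram) {n : ℕ} (hn : p.size = n + 1) :
    ∃ j, j ≤ 2 * n ∧ p.pair j = j + 1 := by
  have h1 := p.pair_ne 0 (by omega)
  obtain ⟨j, hj⟩ := p.exists_adjacent_aux (p.pair 0 - 1) 0 (by omega)
  refine ⟨j, ?_, hj⟩
  have h2 := p.pair_eq j
  have h3 := p.pair_lt j
  by_contra h
  by_cases h4 : j < 2 * p.size
  · have := h3 h4; omega
  · have := h2 (by omega); omega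

theorem Diagram.pair_up (p : Diagram) {n j : ℕ} (hn : p.size = n + 1) (hj : j ≤ 2 * n)
    (hpj : p.pair j = j + 1) (i : ℕ) : p.pair (up j i) = up j ((p.cap n hn j hj).pair i) := by
  have h1 := up_capFun p.pair p.pair_pair p.pair_ne (j := j) (by omega) i
  have h2 := p.pair_pair (up j i)
  have h3 := p.pair_pair j
  have h4 := up_ne j i
  change _ = up j (capFun j p.pair i)
  rw [h1, joinFun]
  grind

theorem Diagram.parity (n : ℕ) : ∀ p : Diagram, p.size = n → ∀ i, i < 2 * n →
    (p.pair i + i) % 2 = 1 := by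
  induction n with
  | zero => intro p hp i hi; omega
  | succ n ih =>
    intro p hp i hi
    obtain ⟨j, hj, hpj⟩ := p.exists_adjacent hp
    have h3 := p.pair_pair j
    rcases up_cases j i with rfl | rfl | ⟨i, rfl⟩
    · omega
    · rw [hpj] at h3; omega
    · rw [p.pair_up hp hj hpj]
      have := ih (p.cap n hp j hj) rfl i ((up_lt_bound hj i).1 hi)
      have e : ∀ x, up j x % 2 = x % 2 := by intro x; unfold up; split_ifs <;> omega
      rw [Nat.add_mod, e, e, ← Nat.add_mod]
      exact this

theorem Diagram.separated (q : Diagram) {n j : ℕ} (hq : q.size = n + 1) (hj : j ≤ 2 * n)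
    (hodd : j % 2 = 1) (hqj : q.pair j ≠ j + 1) :
    Quot.mk (Rel (2 * n + 2) [q.pair, (baseDiagram (n + 1)).pair]) ⟨j, by omega⟩ ≠
      Quot.mk _ ⟨j + 1, by omega⟩ := by
  have hpar := Diagram.parity (n + 1) q hq j (by omega)
  have hne := q.pair_ne j (by omega)
  have hjj := q.pair_pair j
  obtain ⟨S, hSq, hSe, hS⟩ : ∃ S : ℕ → Prop, (∀ x, S x → S (q.pair x)) ∧
      (∀ x, S x → S ((baseDiagram (n + 1)).pair x)) ∧ ¬ (S j ↔ S (j + 1)) := by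
    rcases lt_or_gt_of_ne hne with h | h
    · refine ⟨fun x => q.pair j ≤ x ∧ x ≤ j, ?_, ?_, by omega⟩
      · rintro x ⟨h1, h2⟩
        have a1 := q.noncrossing (q.pair j) x
        have a2 := q.noncrossing (q.pair x) (q.pair j)
        have a3 := q.pair_pair x
        rcases eq_or_ne x j with rfl | h3
        · exact ⟨le_rfl, by omega⟩
        · rcases eq_or_ne x (q.pair j) with rfl | h4
          · rw [hjj]; exact ⟨by omega, le_rfl⟩
          · have a4 := a1 (by omega) (by omega)
            refine ⟨?_, by omega⟩
            by_contra h5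
            have := a2 (by omega) (by omega)
            omega
      · rintro x ⟨h1, h2⟩
        simp only [baseDiagram]
        split_ifs <;> omega
    · refine ⟨fun x => j + 1 ≤ x ∧ x + 1 ≤ q.pair j, ?_, ?_, by omega⟩
      · rintro x ⟨h1, h2⟩
        have a1 := q.noncrossing j x
        have a2 := q.noncrossing (q.pair x) j
        have a3 := q.pair_pair x
        have a4 := a1 (by omega) (by omega)
        have a5 : q.pair x ≠ q.pair j := fun h => by
          have := congrArg q.pair h
          rw [a3, hjj] at this
          omega
        have a6 : q.pair x ≠ j := fun h => by rw [h] at a3; omega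
        refine ⟨?_, by omega⟩
        by_contra h5
        have := a2 (by omega) (by omega)
        omega
      · rintro x ⟨h1, h2⟩
        simp only [baseDiagram]
        split_ifs <;> omega
  intro hEq
  apply hS
  have hresp : ∀ a b : Fin (2 * n + 2), Rel (2 * n + 2) [q.pair, (baseDiagram (n + 1)).pair] a b →
      S a = S b := by
    rintro a b ⟨f, hf, hab⟩
    simp only [List.mem_cons, List.not_mem_nil, or_false] at hf
    rcases hf with rfl | rfl
    · refine propext ⟨fun h => hab ▸ hSq _ h, fun h => ?_⟩
      have := hSq _ h
      rwa [← hab, q.pair_pair] at this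
    · refine propext ⟨fun h => hab ▸ hSe _ h, fun h => ?_⟩
      have := hSe _ h
      rwa [← hab, (baseDiagram (n + 1)).pair_pair] at this
  exact iff_of_eq (congrArg (Quot.lift (fun x : Fin (2 * n + 2) => S x) hresp) hEq)

/-- The number of loops in terms of the regions on one side of the strings. -/
theorem Diagram.loops_formula (n : ℕ) : ∀ p q : Diagram, p.size = n → q.size = n →
    components (2 * n) [p.pair, q.pair] + components (2 * n) [p.pair, (baseDiagram n).pair] +
      components (2 * n) [q.pair, (baseDiagram n).pair] =
    2 * components (2 * n) [p.pair, q.pair, (baseDiagram n).pair] + n := by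
  induction n with
  | zero =>
    intro p q hp hq
    have h0 : ∀ L, components (2 * 0) L = 0 := by
      intro L
      rw [components_def, Nat.card_eq_zero]
      exact .inl ⟨fun x => by obtain ⟨x⟩ := x; exact absurd x.2 (by omega)⟩
    simp only [h0]
  | succ n ih =>
    intro p q hp hq
    obtain ⟨j, hj, hpj⟩ := p.exists_adjacent hp
    have IH := ih (p.cap n hp j hj) (q.cap n hq j hj) rfl rfl
    rw [← capFun_base hj] at IH
    change components (2 * n) [capFun j p.pair, capFun j q.pair] +
      components (2 * n) [capFun j p.pair, capFun j (baseDiagram (n + 1)).pair] +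
      components (2 * n) [capFun j q.pair, capFun j (baseDiagram (n + 1)).pair] =
      2 * components (2 * n) [capFun j p.pair, capFun j q.pair,
        capFun j (baseDiagram (n + 1)).pair] + n at IH
    have mp := p.isMatching
    have mq := q.isMatching
    have me := (baseDiagram (n + 1)).isMatching
    rw [hp] at mp
    rw [hq] at mq
    change IsMatching (2 * n + 2) _ at mp
    change IsMatching (2 * n + 2) _ at mq
    change IsMatching (2 * n + 2) _ at me
    change components (2 * n + 2) _ + components (2 * n + 2) _ + components (2 * n + 2) _ =
      2 * components (2 * n + 2) _ + (n + 1)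
    have hej : (baseDiagram (n + 1)).pair j = j + 1 ↔ j % 2 = 0 := by
      simp only [baseDiagram]; split_ifs <;> omega
    have hsep := fun h => q.separated hq hj h
    generalize (baseDiagram (n + 1)).pair = e at *
    generalize p.pair = p at *
    generalize q.pair = q at *
    have m2 : ∀ {f g : ℕ → ℕ}, IsMatching (2 * n + 2) f → IsMatching (2 * n + 2) g →
        ∀ x ∈ [f, g], IsMatching (2 * n + 2) x := by
      intro f g hf hg x hx
      simp only [List.mem_cons, List.not_mem_nil, or_false] at hx
      rcases hx with rfl | rfl <;> assumption
    have m3 : ∀ x ∈ [p, q, e], IsMatching (2 * n + 2) x := by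
      intro x hx
      simp only [List.mem_cons, List.not_mem_nil, or_false] at hx
      rcases hx with rfl | rfl | rfl <;> assumption
    by_cases cq : q j = j + 1 <;> by_cases ce : e j = j + 1
    · have h1 := components_all hj [p, q] (m2 mp mq) (by simp) (by simp [hpj, cq])
      have h2 := components_all hj [p, e] (m2 mp me) (by simp) (by simp [hpj, ce])
      have h3 := components_all hj [q, e] (m2 mq me) (by simp) (by simp [cq, ce])
      have h4 := components_all hj [p, q, e] m3 (by simp) (by simp [hpj, cq, ce])
      simp only [List.map] at h1 h2 h3 h4
      omega
    · have h1 := components_all hj [p, q] (m2 mp mq) (by simp) (by simp [hpj, cq])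
      have h2 := components_pair_one hj mp me hpj ce
      have h3 := components_pair_one hj mq me cq ce
      have h4 := components_one hj [p, q, e] m3 (f := p) (by simp) hpj (g := e) (by simp) ce (by
        intro f hf a b e1 e2
        simp only [List.mem_cons, List.not_mem_nil, or_false] at hf
        rcases hf with rfl | rfl | rfl
        · exact absurd (e1.symm.trans hpj) (up_ne j a).2
        · exact absurd (e1.symm.trans cq) (up_ne j a).2
        · rw [e1, up_inj] at e2
          rw [Fin.ext e2])
      simp only [List.map] at h1 h2 h3 h4
      omega
    · have h1 := components_pair_one hj mp mq hpj cq
      have h2 := components_all hj [p, e] (m2 mp me) (by simp) (by simp [hpj, ce])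
      have h3 := components_pair_one hj me mq ce cq
      rw [components_pair_comm, components_pair_comm (2 * n)] at h3
      have h4 := components_one hj [p, q, e] m3 (f := p) (by simp) hpj (g := q) (by simp) cq (by
        intro f hf a b e1 e2
        simp only [List.mem_cons, List.not_mem_nil, or_false] at hf
        rcases hf with rfl | rfl | rfl
        · exact absurd (e1.symm.trans hpj) (up_ne j a).2
        · rw [e1, up_inj] at e2
          rw [Fin.ext e2]
        · exact absurd (e1.symm.trans ce) (up_ne j a).2)
      simp only [List.map] at h1 h2 h3 h4
      omega
    · have hs := hsep (by rw [hej] at ce; omega) cq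
      have h1 := components_pair_one hj mp mq hpj cq
      have h2 := components_pair_one hj mp me hpj ce
      have hlink := partners_linked hj mq me hs
      have h3 : components (2 * n + 2) [q, e] = components (2 * n) ([q, e].map (capFun j)) + 1 := by
        obtain ⟨a, b, ha, hb, e1, e2⟩ := exists_partners hj mq cq
        rw [components_of_ne [q, e] hj hs, card_relJ hj [q, e] (m2 mq me) (Quot.mk _ ⟨a, ha⟩) ?_
          ⟨q, by simp, cq⟩]
        intro f hf a' h
        simp only [List.mem_cons, List.not_mem_nil, or_false] at hf
        rcases hf with rfl | rfl
        · rw [e1, up_inj] at h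
          congr 1
          exact Fin.ext h.symm
        · exact (hlink ⟨a, ha⟩ a' e1 h).symm
      have h4 := components_one hj [p, q, e] m3 (f := p) (by simp) hpj (g := q) (by simp) cq (by
        intro f hf a b e1 e2
        simp only [List.mem_cons, List.not_mem_nil, or_false] at hf
        rcases hf with rfl | rfl | rfl
        · exact absurd (e1.symm.trans hpj) (up_ne j a).2
        · rw [e1, up_inj] at e2
          rw [Fin.ext e2]
        · exact (mk_mono (by simp +contextual) (hlink b a e2 e1)).symm)
      simp only [List.map] at h1 h2 h3 h4
      omega

open Classical in
theorem two_pow_components (N : ℕ) (L : List (ℕ → ℕ)) :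
    2 ^ components N L =
      Fintype.card {σ : Fin N → Bool // ∀ a b, Rel N L a b → σ a = σ b} := by
  have e : (Quot (Rel N L) → Bool) ≃ {σ : Fin N → Bool // ∀ a b, Rel N L a b → σ a = σ b} :=
    { toFun := fun f => ⟨fun a => f (Quot.mk _ a), fun a b h => congrArg f (Quot.sound h)⟩
      invFun := fun σ => Quot.lift σ.1 σ.2
      left_inv := fun f => by
        funext c
        induction c using Quot.ind
        rfl
      right_inv := fun σ => rfl }
  rw [← Nat.card_eq_fintype_card, ← Nat.card_congr e, Nat.card_fun, components_def]
  simp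

/-- The loop parameter `√2`. -/
noncomputable def δ : ℝ := √2

theorem δ_sq : δ * δ = 2 := Real.mul_self_sqrt (by norm_num)

theorem δ_pos : 0 < δ := Real.sqrt_pos.2 (by norm_num)

/-- The inner product of two diagrams: `δ` to the number of loops, normalised by `1 / δ` so that
the diagram consisting of one string is a unit vector. Diagrams with different numbers of boundary
points are orthogonal. -/
noncomputable def gram (p q : Diagram) : ℝ := if p.size = q.size then δ ^ p.loops q / δ else 0

theorem gram_comm (p q : Diagram) : gram p q = gram q p := by
  unfold gram
  by_cases h : p.size = q.size
  · rw [if_pos h, if_pos h.symm, p.loops_comm q h]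
  · rw [if_neg h, if_neg (Ne.symm h)]

open Classical in
/-- The spin vector of a diagram. -/
noncomputable def spin (n : ℕ) (p : Diagram) (σ : Fin (2 * n) → Bool) : ℝ :=
  if ∀ a b, Rel (2 * n) [p.pair, (baseDiagram n).pair] a b → σ a = σ b then
    √(δ ^ n / δ) / δ ^ components (2 * n) [p.pair, (baseDiagram n).pair] else 0

open Classical in
theorem gram_eq_sum_spin {n : ℕ} {p q : Diagram} (hp : p.size = n) (hq : q.size = n) :
    gram p q = ∑ σ, spin n p σ * spin n q σ := by
  have h1 : ∀ σ : Fin (2 * n) → Bool, spin n p σ * spin n q σ =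
      if ∀ a b, Rel (2 * n) [p.pair, q.pair, (baseDiagram n).pair] a b → σ a = σ b then
        (δ ^ n / δ) / (δ ^ components (2 * n) [p.pair, (baseDiagram n).pair] *
          δ ^ components (2 * n) [q.pair, (baseDiagram n).pair]) else 0 := by
    intro σ
    have hiff : (∀ a b, Rel (2 * n) [p.pair, q.pair, (baseDiagram n).pair] a b → σ a = σ b) ↔
        (∀ a b, Rel (2 * n) [p.pair, (baseDiagram n).pair] a b → σ a = σ b) ∧
        (∀ a b, Rel (2 * n) [q.pair, (baseDiagram n).pair] a b → σ a = σ b) := by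
      constructor
      · intro h
        refine ⟨fun a b ⟨f, hf, hab⟩ => h a b ⟨f, ?_, hab⟩, fun a b ⟨f, hf, hab⟩ =>
          h a b ⟨f, ?_, hab⟩⟩
        · simp only [List.mem_cons, List.not_mem_nil, or_false] at hf ⊢; tauto
        · simp only [List.mem_cons, List.not_mem_nil, or_false] at hf ⊢; tauto
      · rintro ⟨h2, h3⟩ a b ⟨f, hf, hab⟩
        simp only [List.mem_cons, List.not_mem_nil, or_false] at hf
        rcases hf with rfl | rfl | rfl
        · exact h2 a b ⟨_, by simp, hab⟩
        · exact h3 a b ⟨_, by simp, hab⟩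
        · exact h2 a b ⟨_, by simp, hab⟩
    have hs : √(δ ^ n / δ) * √(δ ^ n / δ) = δ ^ n / δ :=
      Real.mul_self_sqrt (by have := δ_pos; positivity)
    unfold spin
    by_cases h2 : ∀ a b, Rel (2 * n) [p.pair, (baseDiagram n).pair] a b → σ a = σ b
    · by_cases h3 : ∀ a b, Rel (2 * n) [q.pair, (baseDiagram n).pair] a b → σ a = σ b
      · rw [if_pos h2, if_pos h3, if_pos (hiff.2 ⟨h2, h3⟩), div_mul_div_comm, hs]
      · rw [if_neg h3, if_neg (fun h => h3 (hiff.1 h).2), mul_zero]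
    · rw [if_neg h2, if_neg (fun h => h2 (hiff.1 h).1), zero_mul]
  rw [Finset.sum_congr rfl fun σ _ => h1 σ, ← Finset.sum_filter, Finset.sum_const, nsmul_eq_mul,
    ← Fintype.card_subtype, ← two_pow_components, gram, if_pos (hp.trans hq.symm)]
  have hf := Diagram.loops_formula n p q hp hq
  have hl : p.loops q = components (2 * n) [p.pair, q.pair] := by rw [Diagram.loops, hp]
  rw [← hl] at hf
  have hδ := δ_pos
  push_cast
  rw [← δ_sq, ← pow_two, ← pow_mul, ← pow_add, ← mul_div_assoc, ← mul_div_assoc, ← pow_add, ← hf]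
  field_simp
  ring

/-- The vector space spanned by all Temperley–Lieb diagrams. -/
abbrev Diagrams : Type := Diagram →₀ ℂ

/-- The space of Temperley–Lieb diagrams with `2 * n` boundary points. -/
noncomputable def TL (n : ℕ) : Submodule ℂ Diagrams := Finsupp.supported ℂ ℂ {p | p.size = n}

/-- The sesquilinear form that glues two diagrams and evaluates every closed loop to `δ`. -/
noncomputable def form (x y : Diagrams) : ℂ :=
  x.sum fun p a => y.sum fun q b => conj a * b * (gram p q : ℂ)

theorem form_single (p q : Diagram) (a b : ℂ) :
    form (Finsupp.single p a) (Finsupp.single q b) = conj a * b * (gram p q : ℂ) := by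
  unfold form
  rw [Finsupp.sum_single_index (by simp), Finsupp.sum_single_index (by simp)]

theorem form_add_left (x y z : Diagrams) : form (x + y) z = form x z + form y z := by
  unfold form
  rw [Finsupp.sum_add_index' (by simp)]
  intro p a b
  rw [← Finsupp.sum_add]
  simp [add_mul]

theorem form_smul_left (r : ℂ) (x y : Diagrams) : form (r • x) y = conj r * form x y := by
  unfold form
  rw [Finsupp.sum_smul_index (by simp), Finsupp.mul_sum]
  simp only [Finsupp.mul_sum, map_mul, mul_assoc]

theorem form_conj (x y : Diagrams) : conj (form y x) = form x y := by
  unfold form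
  simp only [Finsupp.sum, map_sum, map_mul, Complex.conj_conj, Complex.conj_ofReal]
  rw [Finset.sum_comm]
  refine Finset.sum_congr rfl fun p _ => Finset.sum_congr rfl fun q _ => ?_
  rw [gram_comm, mul_comm (y q)]

theorem form_add_right (x y z : Diagrams) : form x (y + z) = form x y + form x z := by
  rw [← form_conj, form_add_left, map_add, form_conj, form_conj]

theorem form_smul_right (r : ℂ) (x y : Diagrams) : form x (r • y) = r * form x y := by
  rw [← form_conj, form_smul_left, map_mul, form_conj, Complex.conj_conj]

theorem form_zero_left (x : Diagrams) : form 0 x = 0 := by simp [form]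

theorem form_zero_right (x : Diagrams) : form x 0 = 0 := by simp [form]

theorem form_map (A : Diagrams →ₗ[ℂ] Diagrams) (x y : Diagrams) : form (A x) (A y) =
    x.sum fun p a => y.sum fun q b => conj a * b *
      form (A (Finsupp.single p 1)) (A (Finsupp.single q 1)) := by
  induction x using Finsupp.induction_linear with
  | zero => simp [form_zero_left]
  | add x x' h h' =>
    rw [map_add, form_add_left, h, h', Finsupp.sum_add_index' (by simp)]
    intro p a b
    rw [← Finsupp.sum_add]
    simp [add_mul]
  | single p a =>
    rw [Finsupp.sum_single_index (by simp)]
    induction y using Finsupp.induction_linear with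
    | zero => simp [form_zero_right]
    | add y y' h h' =>
      rw [map_add, form_add_right, h, h', Finsupp.sum_add_index' (by simp)]
      intro q c d
      ring
    | single q b =>
      rw [Finsupp.sum_single_index (by simp), ← mul_one a, ← smul_eq_mul, ← Finsupp.smul_single,
        map_smul, ← mul_one b, ← smul_eq_mul, ← Finsupp.smul_single,
        map_smul, form_smul_left, form_smul_right]
      simp only [smul_eq_mul, mul_one]
      ring

theorem mem_TL {n : ℕ} {x : Diagrams} : x ∈ TL n ↔ ∀ p ∈ x.support, p.size = n :=
  Finsupp.mem_supported ℂ x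

theorem form_self_nonneg {n : ℕ} {x : Diagrams} (hx : x ∈ TL n) : 0 ≤ (form x x).re := by
  rw [mem_TL] at hx
  have : form x x = ∑ σ : Fin (2 * n) → Bool,
      ((Complex.normSq (∑ p ∈ x.support, x p * (spin n p σ : ℂ)) : ℝ) : ℂ) := by
    simp only [Complex.normSq_eq_conj_mul_self, map_sum, map_mul, Complex.conj_ofReal,
      Finset.sum_mul_sum]
    rw [Finset.sum_comm]
    unfold form
    refine Finset.sum_congr rfl fun p hp => ?_
    rw [Finset.sum_comm]
    refine Finset.sum_congr rfl fun q hq => ?_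
    dsimp only
    rw [gram_eq_sum_spin (hx p hp) (hx q hq)]
    push_cast
    rw [Finset.mul_sum]
    refine Finset.sum_congr rfl fun σ _ => ?_
    ring
  rw [this, ← Complex.ofReal_sum, Complex.ofReal_re]
  exact Finset.sum_nonneg fun _ _ => Complex.normSq_nonneg _

/-- The effect on one diagram of splitting the interval number `k` (counted from `0`). The boundary
point `0` is the bottom point, the point `2 * k + 1` is the midpoint of the interval number `k`, and
the point `2 * k + 2` is the endpoint between the intervals number `k` and `k + 1`. The string at
the midpoint `2 * k + 1` enters the box `R` from one side, and the three other strings of `R` go to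
the new points `2 * k + 1`, `2 * k + 2`, `2 * k + 3`. In the first summand of `R` the old string
goes on to `2 * k + 1`, while `2 * k + 2` and `2 * k + 3` are joined; in the second summand
`2 * k + 1` and `2 * k + 2` are joined, while the old string goes on to `2 * k + 3`. -/
noncomputable def splitDiagram (k : ℕ) (p : Diagram) : Diagrams :=
  if h : k < p.size then
    (((2 : ℝ) ^ (1 / 4 : ℝ) : ℝ) : ℂ) •
      (Finsupp.single (p.insertCup (2 * k + 2) (by omega)) 1 -
        ((1 / δ : ℝ) : ℂ) • Finsupp.single (p.insertCup (2 * k + 1) (by omega)) 1)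
  else 0

/-- The linear extension of `splitDiagram`. -/
noncomputable def split (k : ℕ) : Diagrams →ₗ[ℂ] Diagrams :=
  Finsupp.linearCombination ℂ (splitDiagram k)

theorem split_single (k : ℕ) (p : Diagram) : split k (Finsupp.single p 1) = splitDiagram k p := by
  simp [split]

theorem form_splitDiagram {k : ℕ} {p q : Diagram} (h : p.size = q.size) (hk : k < p.size) :
    form (splitDiagram k p) (splitDiagram k q) = (gram p q : ℂ) := by
  have hk' : k < q.size := h ▸ hk
  have e1 := p.loops_insert_same q h (2 * k + 2) (by omega) (by omega)
  have e2 := p.loops_insert_same q h (2 * k + 1) (by omega) (by omega)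
  have e3 := p.loops_insert_succ q h (2 * k + 1) (by omega) (by omega)
  have e4 := q.loops_insert_succ p h.symm (2 * k + 1) (by omega) (by omega)
  rw [Diagram.loops_comm q p h.symm, Diagram.loops_comm _ _ (by
    change q.size + 1 = p.size + 1; rw [h])] at e4
  have hs : ∀ i j hi hj, (p.insertCup i hi).size = (q.insertCup j hj).size := by
    intro i j hi hj
    change p.size + 1 = q.size + 1
    rw [h]
  rw [splitDiagram, dif_pos hk, splitDiagram, dif_pos hk']
  simp only [sub_eq_add_neg, ← neg_smul, form_smul_left, form_smul_right, form_add_left,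
    form_add_right, form_single, gram, if_pos (hs _ _ _ _), if_pos h, e1, e2, e3, e4]
  have hc : ((2 : ℝ) ^ (1 / 4 : ℝ)) * ((2 : ℝ) ^ (1 / 4 : ℝ)) = δ := by
    rw [← Real.rpow_add (by norm_num), δ, Real.sqrt_eq_rpow]
    norm_num
  simp only [map_one, map_neg, Complex.conj_ofReal, mul_one, one_mul]
  norm_cast
  rw [pow_succ]
  generalize δ ^ p.loops q = g
  generalize (2 : ℝ) ^ (1 / 4 : ℝ) = c at *
  have h2 := δ_sq
  have hinv : δ⁻¹ = δ / 2 := by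
    have := δ_pos
    field_simp
    linarith
  simp only [div_eq_mul_inv, one_mul, hinv]
  linear_combination (g * δ ^ 4 / 8) * hc + ((δ ^ 2 + 2) * g * δ / 8) * h2

theorem form_split {n k : ℕ} (hk : k < n) {x y : Diagrams} (hx : x ∈ TL n) (hy : y ∈ TL n) :
    form (split k x) (split k y) = form x y := by
  rw [mem_TL] at hx hy
  rw [form_map]
  refine Finset.sum_congr rfl fun p hp => Finset.sum_congr rfl fun q hq => ?_
  have h1 := hx p hp
  have h2 := hy q hq
  dsimp only
  rw [split_single, split_single, form_splitDiagram (h1.trans h2.symm) (by omega)]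

theorem split_mem {n k : ℕ} {x : Diagrams} (hx : x ∈ TL n) : split k x ∈ TL (n + 1) := by
  rw [mem_TL] at hx
  rw [split, Finsupp.linearCombination_apply]
  refine Submodule.sum_mem _ fun p hp => Submodule.smul_mem _ _ ?_
  have hm : ∀ j hj, Finsupp.single (p.insertCup j hj) 1 ∈ TL (n + 1) := fun j hj =>
    Finsupp.single_mem_supported ℂ 1 (by
      change p.size + 1 = n + 1
      rw [hx p hp])
  unfold splitDiagram
  split_ifs
  · exact Submodule.smul_mem _ _ (Submodule.sub_mem _ (hm _ _) (Submodule.smul_mem _ _ (hm _ _)))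
  · exact Submodule.zero_mem _

theorem insertFun_comm {i j : ℕ} (hij : i ≤ j) (p : ℕ → ℕ) :
    insertFun i (insertFun j p) = insertFun (j + 2) (insertFun i p) := by
  funext x
  have hup : ∀ y, up i (up j y) = up (j + 2) (up i y) := by intro y; unfold up; grind
  rcases up_cases i x with rfl | rfl | ⟨x, rfl⟩
  · have e := insertFun_up (j + 2) (insertFun x p) x
    have e1 := insertFun_up (j + 2) (insertFun x p) (x + 1)
    rw [show up (j + 2) x = x by unfold up; grind] at e
    rw [e, insertFun_left, insertFun_left]
    unfold up; grind
  · have e := insertFun_up (j + 2) (insertFun i p) (i + 1)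
    rw [show up (j + 2) (i + 1) = i + 1 by unfold up; grind] at e
    rw [e, insertFun_right, insertFun_right]
    unfold up; grind
  · rw [insertFun_up]
    rcases up_cases j x with rfl | rfl | ⟨x, rfl⟩
    · rw [insertFun_left, show up i x = x + 2 by unfold up; grind, insertFun_left]
      unfold up; grind
    · rw [insertFun_right, show up i (j + 1) = j + 2 + 1 by unfold up; grind, insertFun_right]
      unfold up; grind
    · rw [insertFun_up, hup, hup, insertFun_up, insertFun_up]

theorem insertCup_comm {i j : ℕ} (hij : i ≤ j) (p : Diagram) (h1 : j ≤ 2 * p.size)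
    (h2 : i ≤ 2 * (p.insertCup j h1).size) (h3 : i ≤ 2 * p.size)
    (h4 : j + 2 ≤ 2 * (p.insertCup i h3).size) :
    (p.insertCup j h1).insertCup i h2 = (p.insertCup i h3).insertCup (j + 2) h4 :=
  Diagram.ext rfl (insertFun_comm hij p.pair)

theorem split_comm {k j : ℕ} (hkj : k < j) :
    (split (j + 1)).comp (split k) = (split k).comp (split j) := by
  refine Finsupp.lhom_ext fun p b => ?_
  rw [← mul_one b, ← smul_eq_mul, ← Finsupp.smul_single, map_smul, map_smul]
  congr 1
  simp only [LinearMap.comp_apply, split_single]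
  by_cases hj : j < p.size
  · have hk : k < p.size := by omega
    have a1 : ∀ i hi, k < (p.insertCup i hi).size := fun i hi => by
      change k < p.size + 1; omega
    have a2 : ∀ i hi, j + 1 < (p.insertCup i hi).size := fun i hi => by
      change j + 1 < p.size + 1; omega
    simp only [splitDiagram, dif_pos hj, dif_pos hk, map_smul, map_sub, split_single, dif_pos (a1 _ _),
      dif_pos (a2 _ _)]
    have c : ∀ i i' h1 h2 h3 h4, i < i' → (p.insertCup i' h1).insertCup i h2 =
        (p.insertCup i h3).insertCup (i' + 2) h4 := fun i i' h1 h2 h3 h4 h =>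
      insertCup_comm h.le p h1 h2 h3 h4
    rw [c (2 * k + 2) (2 * j + 2) _ _ (by omega) (by change _ ≤ 2 * (p.size + 1); omega) (by omega),
      c (2 * k + 1) (2 * j + 2) _ _ (by omega) (by change _ ≤ 2 * (p.size + 1); omega) (by omega),
      c (2 * k + 2) (2 * j + 1) _ _ (by omega) (by change _ ≤ 2 * (p.size + 1); omega) (by omega),
      c (2 * k + 1) (2 * j + 1) _ _ (by omega) (by change _ ≤ 2 * (p.size + 1); omega) (by omega)]
    simp only [smul_sub, show 2 * (j + 1) + 2 = 2 * j + 2 + 2 by ring,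
      show 2 * (j + 1) + 1 = 2 * j + 1 + 2 by ring]
    module
  · have e1 : splitDiagram j p = 0 := by rw [splitDiagram, dif_neg hj]
    rw [e1, map_zero]
    by_cases hk : k < p.size
    · have a2 : ∀ i hi, ¬ j + 1 < (p.insertCup i hi).size := fun i hi => by
        change ¬ j + 1 < p.size + 1; omega
      rw [splitDiagram, dif_pos hk]
      simp only [map_smul, map_sub, split_single]
      rw [splitDiagram, dif_neg (a2 _ _), splitDiagram, dif_neg (a2 _ _)]
      simp
    · rw [splitDiagram, dif_neg hk, map_zero]

/-- Finite rooted binary trees, which encode the standard dyadic partitions of `[0, 1]`: the tree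
`leaf` is the partition into the single interval `[0, 1]`, and a caret cuts an interval into its
two halves. -/
inductive BinTree : Type
  | leaf : BinTree
  | node : BinTree → BinTree → BinTree

namespace BinTree

/-- The number of leaves, i.e. the number of intervals of the partition. -/
def leaves : BinTree → ℕ
  | leaf => 1
  | node l r => l.leaves + r.leaves

/-- The number of carets. -/
def carets : BinTree → ℕ
  | leaf => 0
  | node l r => l.carets + r.carets + 1

theorem leaves_eq (t : BinTree) : t.leaves = t.carets + 1 := by
  induction t with
  | leaf => rfl
  | node l r hl hr => simp only [leaves, carets, hl, hr]; omega

/-- The intervals, from left to right, of the partition of `[a, b]` given by a tree, each recorded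
by its two endpoints. -/
noncomputable def cells : BinTree → ℝ → ℝ → List (ℝ × ℝ)
  | leaf, a, b => [(a, b)]
  | node l r, a, b => l.cells a ((a + b) / 2) ++ r.cells ((a + b) / 2) b

/-- The second tree arises from the first one by adding carets, i.e. the second partition refines
the first one. -/
def RefinedBy : BinTree → BinTree → Prop
  | leaf, _ => True
  | node _ _, leaf => False
  | node l r, node l' r' => l.RefinedBy l' ∧ r.RefinedBy r'

instance : Preorder BinTree where
  le := RefinedBy
  le_refl t := by
    induction t with
    | leaf => trivial
    | node l r hl hr => exact ⟨hl, hr⟩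
  le_trans s := by
    induction s with
    | leaf => intros; trivial
    | node l r hl hr =>
      rintro (_ | ⟨l', r'⟩) (_ | ⟨l'', r''⟩) h1 h2
      · exact h1
      · exact h1.elim
      · exact h2.elim
      · exact ⟨hl _ _ h1.1 h2.1, hr _ _ h1.2 h2.2⟩

/-- The common refinement of two partitions. -/
def sup : BinTree → BinTree → BinTree
  | leaf, t => t
  | node l r, leaf => node l r
  | node l r, node l' r' => node (l.sup l') (r.sup r')

theorem le_sup_left (s : BinTree) : ∀ t, s ≤ s.sup t := by
  induction s with
  | leaf => intro t; trivial
  | node l r hl hr =>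
    rintro (_ | ⟨l', r'⟩)
    · exact le_refl _
    · exact ⟨hl l', hr r'⟩

theorem le_sup_right (s : BinTree) : ∀ t, t ≤ s.sup t := by
  induction s with
  | leaf => intro t; exact le_refl t
  | node l r hl hr =>
    rintro (_ | ⟨l', r'⟩)
    · trivial
    · exact ⟨hl l', hr r'⟩

instance : IsDirectedOrder BinTree := ⟨fun s t => ⟨s.sup t, s.le_sup_left t, s.le_sup_right t⟩⟩

instance : Nonempty BinTree := ⟨leaf⟩

/-- The binary forest that leads from a partition to a refinement of it: the list of the trees that
have to be attached to the leaves of the first tree in order to get the second one. -/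
def diff : BinTree → BinTree → List BinTree
  | leaf, t => [t]
  | node _ _, leaf => []
  | node l r, node l' r' => l.diff l' ++ r.diff r'

/-- Attach the trees of a list to the leaves of a tree. -/
def graft : BinTree → List BinTree → BinTree
  | leaf, f => f.headD leaf
  | node l r, f => node (l.graft (f.take l.leaves)) (r.graft (f.drop l.leaves))

theorem length_diff {s : BinTree} : ∀ {t}, s ≤ t → (s.diff t).length = s.leaves := by
  induction s with
  | leaf => intro t _; rfl
  | node l r hl hr =>
    rintro (_ | ⟨l', r'⟩) h
    · exact h.elim
    · simp only [diff, leaves, List.length_append, hl h.1, hr h.2]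

theorem graft_diff {s : BinTree} : ∀ {t}, s ≤ t → s.graft (s.diff t) = t := by
  induction s with
  | leaf => intro t _; rfl
  | node l r hl hr =>
    rintro (_ | ⟨l', r'⟩) h
    · exact h.elim
    · simp only [diff, graft, List.take_left' (length_diff h.1),
        List.drop_left' (length_diff h.1), hl h.1, hr h.2]

theorem le_graft (s : BinTree) : ∀ f : List BinTree, s ≤ s.graft f := by
  induction s with
  | leaf => intro f; trivial
  | node l r hl hr => intro f; exact ⟨hl _, hr _⟩

theorem diff_graft (s : BinTree) :
    ∀ f : List BinTree, f.length = s.leaves → s.diff (s.graft f) = f := by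
  induction s with
  | leaf =>
    intro f hf
    match f, hf with
    | [t], _ => rfl
  | node l r hl hr =>
    intro f hf
    simp only [leaves] at hf
    simp only [graft, diff]
    rw [hl _ (by rw [List.length_take]; omega), hr _ (by rw [List.length_drop]; omega),
      List.take_append_drop]

theorem leaves_graft (s : BinTree) : ∀ f : List BinTree, f.length = s.leaves →
    (s.graft f).leaves = s.leaves + (f.map carets).sum := by
  induction s with
  | leaf =>
    intro f hf
    match f, hf with
    | [t], _ => simp [graft, leaves, leaves_eq]; omega
  | node l r hl hr =>
    intro f hf
    simp only [leaves] at hf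
    simp only [graft, leaves]
    rw [hl _ (by rw [List.length_take]; omega), hr _ (by rw [List.length_drop]; omega)]
    conv_rhs => rw [← List.take_append_drop l.leaves f, List.map_append, List.sum_append]
    omega

theorem length_cells (t : BinTree) : ∀ a b, (t.cells a b).length = t.leaves := by
  induction t with
  | leaf => intro a b; rfl
  | node l r hl hr => intro a b; simp only [cells, leaves, List.length_append, hl, hr]

theorem mem_cells (t : BinTree) : ∀ {a b : ℝ}, a < b → ∀ I ∈ t.cells a b,
    a ≤ I.1 ∧ I.1 < I.2 ∧ I.2 ≤ b := by
  induction t with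
  | leaf =>
    intro a b hab I hI
    simp only [cells, List.mem_singleton] at hI
    subst hI
    exact ⟨le_rfl, hab, le_rfl⟩
  | node l r hl hr =>
    intro a b hab I hI
    rcases List.mem_append.1 hI with h | h
    · have := hl (by linarith) I h
      exact ⟨this.1, this.2.1, by linarith [this.2.2]⟩
    · have := hr (by linarith) I h
      exact ⟨by linarith [this.1], this.2.1, this.2.2⟩

theorem leaves_pos (t : BinTree) : 0 < t.leaves := by rw [leaves_eq]; omega

theorem filter_cells_left (t : BinTree) {a m : ℝ} (h : a < m) :
    (t.cells a m).filter (fun I => decide (I.2 ≤ m)) = t.cells a m :=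
  List.filter_eq_self.2 fun I hI => decide_eq_true (t.mem_cells h I hI).2.2

theorem filter_cells_right (t : BinTree) {m b : ℝ} (h : m < b) :
    (t.cells m b).filter (fun I => decide (I.2 ≤ m)) = [] :=
  List.filter_eq_nil_iff.2 fun I hI => by
    have := t.mem_cells h I hI
    simp only [decide_eq_true_eq, not_le]
    linarith

theorem cells_inj (s : BinTree) : ∀ (t : BinTree) {a b : ℝ}, a < b →
    s.cells a b = t.cells a b → s = t := by
  induction s with
  | leaf =>
    rintro (_ | ⟨l, r⟩) a b hab h
    · rfl
    · have := congrArg List.length h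
      simp only [length_cells, leaves] at this
      have := l.leaves_pos
      have := r.leaves_pos
      omega
  | node l r hl hr =>
    rintro (_ | ⟨l', r'⟩) a b hab h
    · have := congrArg List.length h
      simp only [length_cells, leaves] at this
      have := l.leaves_pos
      have := r.leaves_pos
      omega
    · have h1 : a < (a + b) / 2 := by linarith
      have h2 : (a + b) / 2 < b := by linarith
      simp only [cells] at h
      have h3 := congrArg (List.filter (fun I => decide (I.2 ≤ (a + b) / 2))) h
      rw [List.filter_append, List.filter_append, filter_cells_left _ h1, filter_cells_left _ h1,
        filter_cells_right _ h2, filter_cells_right _ h2, List.append_nil, List.append_nil] at h3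
      rw [h3] at h
      rw [hl l' h1 h3, hr r' h2 (List.append_cancel_left h)]

end BinTree

/-- `g` maps the interval `I` onto the interval `J` by an increasing affine map. -/
def AffineOn (g : unitInterval ≃o unitInterval) (I J : ℝ × ℝ) : Prop :=
  ∀ x : unitInterval, I.1 ≤ x → (x : ℝ) ≤ I.2 →
    (g x : ℝ) = J.1 + (x - I.1) * ((J.2 - J.1) / (I.2 - I.1))

/-- `(T, S)` is a pair of trees representing `g`: the trees have the same number of leaves, and `g`
maps the `i`-th interval of the standard dyadic partition given by `T` affinely onto the `i`-th
interval of the standard dyadic partition given by `S`. -/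
def Represents (g : unitInterval ≃o unitInterval) (T S : BinTree) : Prop :=
  List.Forall₂ (AffineOn g) (T.cells 0 1) (S.cells 0 1)

theorem Represents.leaves_eq {g : unitInterval ≃o unitInterval} {T S : BinTree}
    (h : Represents g T S) : T.leaves = S.leaves := by
  have := List.Forall₂.length_eq h
  rwa [T.length_cells, S.length_cells] at this

theorem affineOn_one (I : ℝ × ℝ) (h : I.1 < I.2) : AffineOn 1 I I := by
  intro x _ _
  rw [div_self (by linarith)]
  simp

theorem AffineOn.mul {g h : unitInterval ≃o unitInterval} {I J K : ℝ × ℝ} (hI : I.1 < I.2)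
    (hJ : J.1 < J.2) (h1 : AffineOn h I J) (h2 : AffineOn g J K) : AffineOn (g * h) I K := by
  intro x hx1 hx2
  have e := h1 x hx1 hx2
  have hI' : 0 < I.2 - I.1 := by linarith
  have hJ' : 0 < J.2 - J.1 := by linarith
  have e1 : J.1 ≤ (h x : ℝ) := by
    rw [e]
    have : 0 ≤ (x - I.1) * ((J.2 - J.1) / (I.2 - I.1)) :=
      mul_nonneg (by linarith) (by positivity)
    linarith
  have e2 : (h x : ℝ) ≤ J.2 := by
    rw [e, mul_div_assoc', ← le_sub_iff_add_le', div_le_iff₀ hI', mul_comm]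
    exact mul_le_mul_of_nonneg_left (by linarith) hJ'.le
  change (g (h x) : ℝ) = _
  rw [h2 (h x) e1 e2, e]
  field_simp
  ring

theorem AffineOn.inv {g : unitInterval ≃o unitInterval} {I J : ℝ × ℝ} (hI : 0 ≤ I.1 ∧ I.1 < I.2 ∧
    I.2 ≤ 1) (hJ : J.1 < J.2) (h : AffineOn g I J) : AffineOn g⁻¹ J I := by
  intro y hy1 hy2
  have hI' : 0 < I.2 - I.1 := by linarith [hI.2.1]
  have hJ' : 0 < J.2 - J.1 := by linarith
  have e1 : 0 ≤ (y - J.1) * ((I.2 - I.1) / (J.2 - J.1)) :=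
    mul_nonneg (by linarith) (by positivity)
  have e2 : (y - J.1) * ((I.2 - I.1) / (J.2 - J.1)) ≤ I.2 - I.1 := by
    rw [mul_div_assoc', div_le_iff₀ hJ', mul_comm]
    exact mul_le_mul_of_nonneg_left (by linarith) hI'.le
  obtain ⟨x, hx⟩ : ∃ x : unitInterval, (x : ℝ) = I.1 + (y - J.1) * ((I.2 - I.1) / (J.2 - J.1)) :=
    ⟨⟨_, by linarith, by linarith⟩, rfl⟩
  have hgx : g x = y := by
    apply Subtype.ext
    rw [h x (by linarith) (by linarith), hx]
    field_simp
    ring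
  have : g⁻¹ y = x := by
    rw [← hgx]
    exact g.symm_apply_apply _
  rw [this, hx]

theorem affineOn_cells {g : unitInterval ≃o unitInterval} (t : BinTree) : ∀ {a b c d : ℝ}, a < b →
    AffineOn g (a, b) (c, d) → List.Forall₂ (AffineOn g) (t.cells a b) (t.cells c d) := by
  induction t with
  | leaf => intro a b c d _ h; exact .cons h .nil
  | node l r hl hr =>
    intro a b c d hab h
    have hab' : 0 < b - a := by linarith
    refine List.rel_append (hl (by linarith) ?_) (hr (by linarith) ?_)
    · intro x hx1 hx2
      dsimp only at hx1 hx2 ⊢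
      rw [h x hx1 (by dsimp only; linarith)]
      have : (a + b) / 2 - a = (b - a) / 2 := by ring
      rw [this]
      field_simp
      ring
    · intro x hx1 hx2
      dsimp only at hx1 hx2 ⊢
      rw [h x (by dsimp only; linarith) hx2]
      have : b - (a + b) / 2 = (b - a) / 2 := by ring
      rw [this]
      field_simp
      ring

/-- The intervals that arise when the trees of a forest are attached to given intervals. -/
noncomputable def subdivide : List (ℝ × ℝ) → List BinTree → List (ℝ × ℝ)
  | I :: A, t :: f => t.cells I.1 I.2 ++ subdivide A f
  | _, _ => []

theorem subdivide_append (A B : List (ℝ × ℝ)) : ∀ f : List BinTree, A.length ≤ f.length →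
    subdivide (A ++ B) f = subdivide A (f.take A.length) ++ subdivide B (f.drop A.length) := by
  induction A with
  | nil => intro f _; simp [subdivide]
  | cons I A ih =>
    rintro (_ | ⟨t, f⟩) h
    · simp at h
    · simp only [List.length_cons, Nat.add_le_add_iff_right] at h
      simp [subdivide, ih f h]

theorem cells_graft (s : BinTree) : ∀ (f : List BinTree) (a b : ℝ), f.length = s.leaves →
    (s.graft f).cells a b = subdivide (s.cells a b) f := by
  induction s with
  | leaf =>
    intro f a b hf
    match f, hf with
    | [t], _ => simp [BinTree.graft, BinTree.cells, subdivide]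
  | node l r hl hr =>
    intro f a b hf
    simp only [BinTree.leaves] at hf
    simp only [BinTree.graft, BinTree.cells]
    rw [subdivide_append _ _ _ (by rw [l.length_cells]; omega), l.length_cells,
      hl _ _ _ (by rw [List.length_take]; omega), hr _ _ _ (by rw [List.length_drop]; omega)]

theorem forall₂_subdivide {g : unitInterval ≃o unitInterval} {A B : List (ℝ × ℝ)}
    (h : List.Forall₂ (AffineOn g) A B) : (∀ I ∈ A, I.1 < I.2) → ∀ f : List BinTree,
    List.Forall₂ (AffineOn g) (subdivide A f) (subdivide B f) := by
  induction h with
  | nil => intro _ f; simp [subdivide]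
  | cons h1 h2 ih =>
    rintro hA (_ | ⟨t, f⟩)
    · simp [subdivide]
    · simp only [subdivide]
      exact List.rel_append (affineOn_cells t (hA _ (by simp)) h1)
        (ih (fun I hI => hA I (List.mem_cons_of_mem _ hI)) f)

theorem Represents.graft {g : unitInterval ≃o unitInterval} {T S : BinTree}
    (h : Represents g T S) {f : List BinTree} (hf : f.length = T.leaves) :
    Represents g (T.graft f) (S.graft f) := by
  unfold Represents
  rw [cells_graft T f 0 1 hf, cells_graft S f 0 1 (hf.trans h.leaves_eq)]
  exact forall₂_subdivide h (fun I hI => (T.mem_cells one_pos I hI).2.1) f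

theorem represents_one (T : BinTree) : Represents 1 T T :=
  List.forall₂_same.2 fun I hI => affineOn_one I (T.mem_cells one_pos I hI).2.1

theorem forall₂_mul {g h : unitInterval ≃o unitInterval} {A B : List (ℝ × ℝ)}
    (h1 : List.Forall₂ (AffineOn h) A B) : (∀ I ∈ A, I.1 < I.2) → (∀ I ∈ B, I.1 < I.2) →
    ∀ C, List.Forall₂ (AffineOn g) B C → List.Forall₂ (AffineOn (g * h)) A C := by
  induction h1 with
  | nil => intro _ _ C hC; cases hC; exact .nil
  | cons h1 h2 ih =>
    intro hA hB C hC
    cases hC with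
    | cons h3 h4 =>
      exact .cons (AffineOn.mul (hA _ (by simp)) (hB _ (by simp)) h1 h3)
        (ih (fun I hI => hA I (List.mem_cons_of_mem _ hI))
          (fun I hI => hB I (List.mem_cons_of_mem _ hI)) _ h4)

theorem Represents.mul {g h : unitInterval ≃o unitInterval} {T S U : BinTree}
    (h1 : Represents h T S) (h2 : Represents g S U) : Represents (g * h) T U :=
  forall₂_mul h1 (fun I hI => (T.mem_cells one_pos I hI).2.1)
    (fun I hI => (S.mem_cells one_pos I hI).2.1) _ h2

theorem forall₂_inv {g : unitInterval ≃o unitInterval} {A B : List (ℝ × ℝ)}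
    (h : List.Forall₂ (AffineOn g) A B) : (∀ I ∈ A, 0 ≤ I.1 ∧ I.1 < I.2 ∧ I.2 ≤ 1) →
    (∀ I ∈ B, I.1 < I.2) → List.Forall₂ (AffineOn g⁻¹) B A := by
  induction h with
  | nil => intro _ _; exact .nil
  | cons h1 h2 ih =>
    intro hA hB
    exact .cons (AffineOn.inv (hA _ (by simp)) (hB _ (by simp)) h1)
      (ih (fun I hI => hA I (List.mem_cons_of_mem _ hI))
        (fun I hI => hB I (List.mem_cons_of_mem _ hI)))

theorem Represents.inv {g : unitInterval ≃o unitInterval} {T S : BinTree}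
    (h : Represents g T S) : Represents g⁻¹ S T :=
  forall₂_inv h (fun I hI => T.mem_cells one_pos I hI)
    (fun I hI => (S.mem_cells one_pos I hI).2.1)

theorem forall₂_unique {g : unitInterval ≃o unitInterval} {A B : List (ℝ × ℝ)}
    (h : List.Forall₂ (AffineOn g) A B) : (∀ I ∈ A, 0 ≤ I.1 ∧ I.1 < I.2 ∧ I.2 ≤ 1) →
    ∀ C, List.Forall₂ (AffineOn g) A C → B = C := by
  induction h with
  | nil => intro _ C hC; cases hC; rfl
  | @cons I J A B h1 h2 ih =>
    intro hA C hC
    cases hC with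
    | @cons _ K _ C h3 h4 =>
      rw [ih (fun I hI => hA I (List.mem_cons_of_mem _ hI)) C h4]
      obtain ⟨i1, i2, i3⟩ := hA I (by simp)
      congr 1
      have hI' : I.2 - I.1 ≠ 0 := by linarith
      have e1 := (h1 ⟨I.1, i1, by linarith⟩ le_rfl i2.le).symm.trans
        (h3 ⟨I.1, i1, by linarith⟩ le_rfl i2.le)
      have e2 := (h1 ⟨I.2, by linarith, i3⟩ i2.le le_rfl).symm.trans
        (h3 ⟨I.2, by linarith, i3⟩ i2.le le_rfl)
      simp only [sub_self, zero_mul, add_zero] at e1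
      simp only [mul_div_cancel₀ _ hI'] at e2
      exact Prod.ext e1 (by linarith)

theorem Represents.unique {g : unitInterval ≃o unitInterval} {T S S' : BinTree}
    (h : Represents g T S) (h' : Represents g T S') : S = S' :=
  S.cells_inj S' one_pos
    (forall₂_unique h (fun I hI => T.mem_cells one_pos I hI) _ h')

/-- Thompson's group `F`: the increasing homeomorphisms of `[0, 1]` that map some standard dyadic
partition, affinely on each of its intervals, onto a standard dyadic partition. -/
def ThompsonF : Subgroup (unitInterval ≃o unitInterval) where
  carrier := {g | ∃ T S, Represents g T S}
  one_mem' := ⟨.leaf, .leaf, represents_one _⟩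
  mul_mem' := by
    rintro g h ⟨S', U, hg⟩ ⟨T, S, hh⟩
    have l1 := S.le_sup_left S'
    have l2 := S.le_sup_right S'
    have a1 := hh.graft (f := S.diff (S.sup S')) ((BinTree.length_diff l1).trans hh.leaves_eq.symm)
    have a2 := hg.graft (f := S'.diff (S.sup S')) (BinTree.length_diff l2)
    rw [BinTree.graft_diff l1] at a1
    rw [BinTree.graft_diff l2] at a2
    exact ⟨_, _, a1.mul a2⟩
  inv_mem' := by
    rintro g ⟨T, S, h⟩
    exact ⟨S, T, h.inv⟩

/-- Split an interval number `k` repeatedly, as prescribed by a tree. -/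
noncomputable def expand : BinTree → ℕ → Diagrams →ₗ[ℂ] Diagrams
  | .leaf, _ => LinearMap.id
  | .node l r, k => (expand l k).comp ((expand r (k + 1)).comp (split k))

/-- Split the consecutive intervals with the numbers `k, k + 1, …` as prescribed by a forest. -/
noncomputable def expandForest : List BinTree → ℕ → Diagrams →ₗ[ℂ] Diagrams
  | [], _ => LinearMap.id
  | t :: f, k => (expand t k).comp (expandForest f (k + 1))

theorem expand_mem (t : BinTree) : ∀ (k : ℕ) {n : ℕ} {x : Diagrams}, x ∈ TL n →
    expand t k x ∈ TL (n + t.carets) := by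
  induction t with
  | leaf => intro k n x hx; exact hx
  | node l r hl hr =>
    intro k n x hx
    have := hl k (hr (k + 1) (split_mem (k := k) hx))
    simp only [BinTree.carets]
    rwa [show n + (l.carets + r.carets + 1) = n + 1 + r.carets + l.carets by ring]

theorem expandForest_mem (f : List BinTree) : ∀ (k : ℕ) {n : ℕ} {x : Diagrams}, x ∈ TL n →
    expandForest f k x ∈ TL (n + (f.map BinTree.carets).sum) := by
  induction f with
  | nil => intro k n x hx; exact hx
  | cons t f ih =>
    intro k n x hx
    have := expand_mem t k (ih (k + 1) hx)
    simp only [List.map_cons, List.sum_cons]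
    rwa [add_comm t.carets, ← add_assoc]

theorem form_expand (t : BinTree) : ∀ {k n : ℕ} {x y : Diagrams}, k < n → x ∈ TL n → y ∈ TL n →
    form (expand t k x) (expand t k y) = form x y := by
  induction t with
  | leaf => intros; rfl
  | node l r hl hr =>
    intro k n x y hk hx hy
    have hx1 := split_mem (k := k) hx
    have hy1 := split_mem (k := k) hy
    simp only [expand, LinearMap.comp_apply]
    rw [hl (n := n + 1 + r.carets) (by omega) (expand_mem r _ hx1) (expand_mem r _ hy1),
      hr (n := n + 1) (by omega) hx1 hy1, form_split hk hx hy]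

theorem form_expandForest (f : List BinTree) : ∀ {k n : ℕ} {x y : Diagrams}, k + f.length ≤ n →
    x ∈ TL n → y ∈ TL n → form (expandForest f k x) (expandForest f k y) = form x y := by
  induction f with
  | nil => intros; rfl
  | cons t f ih =>
    intro k n x y hk hx hy
    simp only [List.length_cons] at hk
    simp only [expandForest, LinearMap.comp_apply]
    rw [form_expand t (n := n + (f.map BinTree.carets).sum) (by omega) (expandForest_mem f _ hx)
      (expandForest_mem f _ hy), ih (by omega) hx hy]

theorem expand_split (t : BinTree) : ∀ {k j : ℕ}, k < j →
    (expand t (j + 1)).comp (split k) = (split k).comp (expand t j) := by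
  induction t with
  | leaf => intros; rfl
  | node l r hl hr =>
    intro k j hkj
    simp only [expand, LinearMap.comp_assoc]
    rw [split_comm hkj, ← LinearMap.comp_assoc (split j), hr (by omega), ← LinearMap.comp_assoc,
      ← LinearMap.comp_assoc, hl hkj]
    simp only [LinearMap.comp_assoc]

theorem expandForest_split (f : List BinTree) : ∀ {k j : ℕ}, k < j →
    (expandForest f (j + 1)).comp (split k) = (split k).comp (expandForest f j) := by
  induction f with
  | nil => intros; rfl
  | cons t f ih =>
    intro k j hkj
    simp only [expandForest, LinearMap.comp_assoc]
    rw [ih (by omega), ← LinearMap.comp_assoc, expand_split t hkj, LinearMap.comp_assoc]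

theorem expandForest_expand (f : List BinTree) (s : BinTree) : ∀ {k j : ℕ}, k < j →
    (expandForest f (j + s.carets)).comp (expand s k) = (expand s k).comp (expandForest f j) := by
  induction s with
  | leaf => intros; rfl
  | node l r hl hr =>
    intro k j hkj
    simp only [expand, BinTree.carets]
    rw [show j + (l.carets + r.carets + 1) = j + 1 + r.carets + l.carets by ring,
      ← LinearMap.comp_assoc, hl (by omega), LinearMap.comp_assoc,
      ← LinearMap.comp_assoc (split k), hr (by omega), LinearMap.comp_assoc,
      expandForest_split f hkj]
    simp only [LinearMap.comp_assoc]

theorem expandForest_comm (f' f : List BinTree) : ∀ {k j : ℕ}, k + f.length ≤ j →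
    (expandForest f' (j + (f.map BinTree.carets).sum)).comp (expandForest f k) =
      (expandForest f k).comp (expandForest f' j) := by
  induction f with
  | nil => intros; rfl
  | cons t f ih =>
    intro k j hkj
    simp only [List.length_cons] at hkj
    simp only [expandForest, List.map_cons, List.sum_cons]
    rw [show j + (t.carets + (f.map BinTree.carets).sum) =
      j + (f.map BinTree.carets).sum + t.carets by ring, ← LinearMap.comp_assoc,
      expandForest_expand f' t (by omega), LinearMap.comp_assoc, ih (by omega),
      LinearMap.comp_assoc]

theorem expandForest_append (f f' : List BinTree) : ∀ k : ℕ,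
    expandForest (f ++ f') k = (expandForest f k).comp (expandForest f' (k + f.length)) := by
  induction f with
  | nil => intro k; rfl
  | cons t f ih =>
    intro k
    simp only [List.cons_append, expandForest, ih, List.length_cons, LinearMap.comp_assoc]
    rw [show k + 1 + f.length = k + (f.length + 1) by ring]

theorem leaves_le_iff {S T : BinTree} (h : S ≤ T) :
    T.leaves = S.leaves + ((S.diff T).map BinTree.carets).sum := by
  conv_lhs => rw [← BinTree.graft_diff h]
  exact S.leaves_graft _ (BinTree.length_diff h)

theorem expandForest_diff_expand (S : BinTree) : ∀ {U : BinTree}, S ≤ U → ∀ k : ℕ,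
    (expandForest (S.diff U) k).comp (expand S k) = expand U k := by
  induction S with
  | leaf => intro U _ k; rfl
  | node l r hl hr =>
    rintro (_ | ⟨l', r'⟩) h k
    · exact h.elim
    · simp only [BinTree.diff, expand]
      rw [expandForest_append, BinTree.length_diff h.1, LinearMap.comp_assoc,
        ← LinearMap.comp_assoc _ (expand l k) (expandForest (r.diff r') _), l.leaves_eq,
        show k + (l.carets + 1) = k + 1 + l.carets by ring, expandForest_expand _ _ (by omega),
        LinearMap.comp_assoc, ← LinearMap.comp_assoc _ (expand r (k + 1)), hr h.2,
        ← LinearMap.comp_assoc, hl h.1]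

theorem expandForest_diff_diff (T : BinTree) : ∀ {S U : BinTree}, T ≤ S → S ≤ U → ∀ k : ℕ,
    (expandForest (S.diff U) k).comp (expandForest (T.diff S) k) =
      expandForest (T.diff U) k := by
  induction T with
  | leaf => intro S U _ h k; exact expandForest_diff_expand S h k
  | node l r hl hr =>
    rintro (_ | ⟨l', r'⟩) (_ | ⟨l'', r''⟩) h1 h2 k
    · exact h1.elim
    · exact h1.elim
    · exact h2.elim
    · simp only [BinTree.diff]
      rw [expandForest_append, expandForest_append, expandForest_append, LinearMap.comp_assoc,
        ← LinearMap.comp_assoc _ (expandForest (l.diff l') k) (expandForest (r'.diff r'') _), BinTree.length_diff h2.1,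
        BinTree.length_diff h1.1, leaves_le_iff h1.1, ← add_assoc,
        expandForest_comm _ _ (by rw [BinTree.length_diff h1.1]), LinearMap.comp_assoc,
        hr h1.2 h2.2, ← LinearMap.comp_assoc, hl h1.1 h2.1,
        BinTree.length_diff (le_trans h1.1 h2.1)]

/-- The space attached to a standard dyadic partition `T` with `n` intervals: the diagrams with
`2 * n` boundary points, namely one point at the bottom and, at the top, the `n` midpoints and the
`n - 1` inner endpoints of the intervals. Its inner product is `form`; the null vectors will be
divided out when the direct limit is completed. -/
def HSpace (T : BinTree) : Type := TL T.leaves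

noncomputable instance (T : BinTree) : AddCommGroup (HSpace T) :=
  inferInstanceAs (AddCommGroup (TL T.leaves))

noncomputable instance (T : BinTree) : Module ℂ (HSpace T) :=
  inferInstanceAs (Module ℂ (TL T.leaves))

instance (T : BinTree) : CoeOut (HSpace T) Diagrams := ⟨Subtype.val⟩

/-- The inclusion of the space of a partition into the space of a refinement. -/
noncomputable def inclusion (T S : BinTree) (h : T ≤ S) : HSpace T →ₗ[ℂ] HSpace S :=
  (expandForest (T.diff S) 0).restrict (p := TL T.leaves) (q := TL S.leaves) fun x hx => by
    rw [leaves_le_iff h]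
    exact expandForest_mem _ 0 hx

theorem coe_inclusion {T S : BinTree} (h : T ≤ S) (x : HSpace T) :
    (inclusion T S h x : Diagrams) = expandForest (T.diff S) 0 x := rfl

theorem inclusion_inclusion {T S U : BinTree} (h : T ≤ S) (h' : S ≤ U) (x : HSpace T) :
    inclusion S U h' (inclusion T S h x) = inclusion T U (h.trans h') x :=
  Subtype.ext (LinearMap.congr_fun (expandForest_diff_diff T h h' 0) (x : Diagrams))

theorem expandForest_self (T : BinTree) : ∀ k, expandForest (T.diff T) k = LinearMap.id := by
  induction T with
  | leaf => intro k; rfl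
  | node l r hl hr =>
    intro k
    simp only [BinTree.diff]
    rw [expandForest_append, hl, hr, LinearMap.comp_id]

theorem inclusion_self (T : BinTree) (x : HSpace T) : inclusion T T le_rfl x = x :=
  Subtype.ext (LinearMap.congr_fun (expandForest_self T 0) (x : Diagrams))

theorem form_inclusion {T S : BinTree} (h : T ≤ S) (x y : HSpace T) :
    form (inclusion T S h x) (inclusion T S h y) = form x y :=
  form_expandForest _ (by rw [BinTree.length_diff h]; omega) x.2 y.2

noncomputable instance : DecidableEq BinTree := Classical.decEq _

instance : DirectedSystem HSpace (fun T S h => inclusion T S h) where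
  map_self T x := inclusion_self T x
  map_map _ _ _ h h' x := inclusion_inclusion h h' x

/-- The direct limit of the spaces of all standard dyadic partitions. -/
def PreHilbert : Type := Module.DirectLimit HSpace inclusion

noncomputable instance : AddCommGroup PreHilbert :=
  inferInstanceAs (AddCommGroup (Module.DirectLimit HSpace inclusion))

noncomputable instance : Module ℂ PreHilbert :=
  inferInstanceAs (Module ℂ (Module.DirectLimit HSpace inclusion))

/-- The canonical map from the space of a partition to the direct limit. -/
noncomputable def toLimit (T : BinTree) : HSpace T →ₗ[ℂ] PreHilbert :=
  Module.DirectLimit.of ℂ BinTree HSpace inclusion T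

theorem toLimit_inclusion {T S : BinTree} (h : T ≤ S) (x : HSpace T) :
    toLimit S (inclusion T S h x) = toLimit T x := Module.DirectLimit.of_f

theorem exists_toLimit (z : PreHilbert) : ∃ T x, toLimit T x = z := Module.DirectLimit.exists_of z

theorem exists_toLimit₂ (z w : PreHilbert) : ∃ T x y, toLimit T x = z ∧ toLimit T y = w :=
  Module.DirectLimit.exists_of₂ z w

theorem exists_toLimit₃ (z w v : PreHilbert) :
    ∃ T x y u, toLimit T x = z ∧ toLimit T y = w ∧ toLimit T u = v := by
  obtain ⟨T, x, y, rfl, rfl⟩ := exists_toLimit₂ z w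
  obtain ⟨S, u, rfl⟩ := exists_toLimit v
  exact ⟨T.sup S, inclusion T _ (T.le_sup_left S) x, inclusion T _ (T.le_sup_left S) y,
    inclusion S _ (T.le_sup_right S) u, toLimit_inclusion _ _, toLimit_inclusion _ _,
    toLimit_inclusion _ _⟩

theorem exists_inclusion_eq {T : BinTree} {x y : HSpace T} (h : toLimit T x = toLimit T y) :
    ∃ S, ∃ hS : T ≤ S, inclusion T S hS x = inclusion T S hS y := by
  have h0 : toLimit T (x - y) = 0 := by rw [map_sub, h, sub_self]
  obtain ⟨S, hS, e⟩ := Module.DirectLimit.of.zero_exact h0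
  exact ⟨S, hS, by rwa [map_sub, sub_eq_zero] at e⟩

theorem form_well_defined {T S : BinTree} {x y : HSpace T} {x' y' : HSpace S}
    (hx : toLimit T x = toLimit S x') (hy : toLimit T y = toLimit S y') :
    form x y = form x' y' := by
  have l1 := T.le_sup_left S
  have l2 := T.le_sup_right S
  rw [← toLimit_inclusion l1, ← toLimit_inclusion l2] at hx hy
  obtain ⟨U, hU, e1⟩ := exists_inclusion_eq hx
  obtain ⟨V, hV, e2⟩ := exists_inclusion_eq hy
  have m1 := U.le_sup_left V
  have m2 := U.le_sup_right V
  rw [← form_inclusion l1 x y, ← form_inclusion (hU.trans m1),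
    ← inclusion_inclusion hU m1, e1, inclusion_inclusion hU m1,
    ← inclusion_inclusion hV m2 (inclusion T _ l1 y), e2, inclusion_inclusion hV m2,
    form_inclusion, form_inclusion]

/-- The inner product of the direct limit: the common value of `form` on representatives in the
space of one partition. -/
noncomputable def innerLimit (z w : PreHilbert) : ℂ :=
  form (exists_toLimit₂ z w).choose_spec.choose
    (exists_toLimit₂ z w).choose_spec.choose_spec.choose

theorem innerLimit_toLimit {T : BinTree} (x y : HSpace T) :
    innerLimit (toLimit T x) (toLimit T y) = form x y :=
  form_well_defined
    (exists_toLimit₂ (toLimit T x) (toLimit T y)).choose_spec.choose_spec.choose_spec.1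
    (exists_toLimit₂ (toLimit T x) (toLimit T y)).choose_spec.choose_spec.choose_spec.2

/-- The direct limit is a pre-Hilbert space. -/
@[reducible] noncomputable def preHilbertCore : PreInnerProductSpace.Core ℂ PreHilbert where
  inner := innerLimit
  conj_inner_symm z w := by
    obtain ⟨T, x, y, rfl, rfl⟩ := exists_toLimit₂ z w
    rw [innerLimit_toLimit, innerLimit_toLimit, form_conj]
  re_inner_nonneg z := by
    obtain ⟨T, x, rfl⟩ := exists_toLimit z
    rw [innerLimit_toLimit]
    exact form_self_nonneg x.2
  add_left z w v := by
    obtain ⟨T, x, y, u, rfl, rfl, rfl⟩ := exists_toLimit₃ z w v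
    rw [← map_add, innerLimit_toLimit, innerLimit_toLimit, innerLimit_toLimit]
    exact form_add_left _ _ _
  smul_left z w r := by
    obtain ⟨T, x, y, rfl, rfl⟩ := exists_toLimit₂ z w
    rw [← map_smul, innerLimit_toLimit, innerLimit_toLimit]
    exact form_smul_left _ _ _

noncomputable instance : SeminormedAddCommGroup PreHilbert :=
  letI := preHilbertCore
  InnerProductSpace.Core.toSeminormedAddCommGroup (𝕜 := ℂ)

noncomputable instance : InnerProductSpace ℂ PreHilbert := InnerProductSpace.ofCore preHilbertCore

/-- The Hilbert space of the representation: the (separated) completion of the direct limit. -/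
abbrev Hilbert : Type := UniformSpace.Completion PreHilbert

theorem inner_toLimit {T : BinTree} (x y : HSpace T) :
    inner ℂ (toLimit T x) (toLimit T y) = form x y := innerLimit_toLimit x y

/-- The identification of the spaces of two partitions with the same number of intervals, which
moves the strings to the new positions. -/
noncomputable def transport {T S : BinTree} (h : T.leaves = S.leaves) : HSpace T →ₗ[ℂ] HSpace S :=
  (LinearEquiv.ofEq (TL T.leaves) (TL S.leaves) (by rw [h])).toLinearMap

theorem coe_transport {T S : BinTree} (h : T.leaves = S.leaves) (x : HSpace T) :
    (transport h x : Diagrams) = x := rfl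

theorem transport_inclusion {g : unitInterval ≃o unitInterval} {T S T' : BinTree}
    (h : Represents g T S) (hT : T ≤ T') : ∃ S', ∃ hS : S ≤ S', ∃ h' : Represents g T' S',
    ∀ x, transport h'.leaves_eq (inclusion T T' hT x) =
      inclusion S S' hS (transport h.leaves_eq x) := by
  have hl := BinTree.length_diff hT
  have h1 := h.graft hl
  rw [BinTree.graft_diff hT] at h1
  refine ⟨S.graft (T.diff T'), S.le_graft _, h1, fun x => Subtype.ext ?_⟩
  rw [coe_transport, coe_inclusion, coe_inclusion, coe_transport,
    S.diff_graft _ (hl.trans h.leaves_eq)]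

theorem exists_good (g : ThompsonF) (T : BinTree) :
    ∃ J S, T ≤ J ∧ Represents (g : unitInterval ≃o unitInterval) J S := by
  obtain ⟨g, U, S, h⟩ := g
  have hl := BinTree.length_diff (U.le_sup_left T)
  have h1 := h.graft hl
  rw [BinTree.graft_diff (U.le_sup_left T)] at h1
  exact ⟨_, _, U.le_sup_right T, h1⟩

theorem action_indep {g : unitInterval ≃o unitInterval} {T J S J' S' : BinTree}
    (hJ : T ≤ J) (h : Represents g J S) (hJ' : T ≤ J') (h' : Represents g J' S') (x : HSpace T) :
    toLimit S (transport h.leaves_eq (inclusion T J hJ x)) =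
      toLimit S' (transport h'.leaves_eq (inclusion T J' hJ' x)) := by
  obtain ⟨U, hU, r, e⟩ := transport_inclusion h (J.le_sup_left J')
  obtain ⟨U', hU', r', e'⟩ := transport_inclusion h' (J.le_sup_right J')
  obtain rfl := r.unique r'
  rw [← toLimit_inclusion hU, ← toLimit_inclusion hU', ← e, ← e', inclusion_inclusion,
    inclusion_inclusion]

/-- The action of `g` on the direct limit: a vector in the space of the partition `T` is first
included into the space of a refinement `J` of `T` which is good for `g`, and then the strings are
moved from `J` to the partition `g(J)`. -/
noncomputable def action (g : ThompsonF) : PreHilbert →ₗ[ℂ] PreHilbert :=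
  Module.DirectLimit.lift ℂ BinTree HSpace inclusion
    (fun T => (toLimit (exists_good g T).choose_spec.choose).comp
      ((transport (exists_good g T).choose_spec.choose_spec.2.leaves_eq).comp
        (inclusion T (exists_good g T).choose (exists_good g T).choose_spec.choose_spec.1)))
    (fun T S h x => by
      simp only [LinearMap.comp_apply]
      rw [inclusion_inclusion]
      exact action_indep _ (exists_good g S).choose_spec.choose_spec.2 _
        (exists_good g T).choose_spec.choose_spec.2 x)

theorem action_toLimit (g : ThompsonF) {T J S : BinTree} (hJ : T ≤ J)
    (h : Represents (g : unitInterval ≃o unitInterval) J S) (x : HSpace T) :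
    action g (toLimit T x) = toLimit S (transport h.leaves_eq (inclusion T J hJ x)) :=
  (Module.DirectLimit.lift_of _ _ x).trans
    (action_indep _ (exists_good g T).choose_spec.choose_spec.2 hJ h x)

theorem action_toLimit_self (g : ThompsonF) {T S : BinTree}
    (h : Represents (g : unitInterval ≃o unitInterval) T S) (x : HSpace T) :
    action g (toLimit T x) = toLimit S (transport h.leaves_eq x) := by
  rw [action_toLimit g le_rfl h, inclusion_self]

theorem action_one : action 1 = LinearMap.id := by
  ext z
  obtain ⟨T, x, rfl⟩ := exists_toLimit z
  exact action_toLimit_self 1 (represents_one T) x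

theorem action_mul (g h : ThompsonF) (z : PreHilbert) :
    action (g * h) z = action g (action h z) := by
  obtain ⟨T, x, rfl⟩ := exists_toLimit z
  obtain ⟨J, S, hJ, r⟩ := exists_good h T
  obtain ⟨K, U, hK, r'⟩ := exists_good g S
  have r1 := r.inv
  obtain ⟨J', hJ', r2, -⟩ := transport_inclusion r1 hK
  have r3 : Represents (h : unitInterval ≃o unitInterval) J' K := by simpa using r2.inv
  rw [action_toLimit h (hJ.trans hJ') r3, action_toLimit_self g r',
    action_toLimit (g * h) (hJ.trans hJ') (r3.mul r')]
  rfl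

theorem inner_action (g : ThompsonF) (z w : PreHilbert) :
    inner ℂ (action g z) (action g w) = inner ℂ z w := by
  obtain ⟨T, x, y, rfl, rfl⟩ := exists_toLimit₂ z w
  obtain ⟨J, S, hJ, r⟩ := exists_good g T
  rw [action_toLimit g hJ r, action_toLimit g hJ r, inner_toLimit, inner_toLimit, coe_transport,
    coe_transport, form_inclusion]

theorem norm_action (g : ThompsonF) (z : PreHilbert) : ‖action g z‖ = ‖z‖ := by
  rw [@norm_eq_sqrt_re_inner ℂ, @norm_eq_sqrt_re_inner ℂ, inner_action]

/-- The action of `g` as a bounded operator on the direct limit. -/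
noncomputable def actionCLM (g : ThompsonF) : PreHilbert →L[ℂ] PreHilbert :=
  (⟨action g, norm_action g⟩ : PreHilbert →ₗᵢ[ℂ] PreHilbert).toContinuousLinearMap

/-- The representation `π` of Thompson's group `F` on the Hilbert space. -/
noncomputable def jonesRep : ThompsonF →* (Hilbert →L[ℂ] Hilbert) where
  toFun g := (actionCLM g).completion
  map_one' := by
    ext z
    induction z using UniformSpace.Completion.induction_on with
    | hp => exact isClosed_eq (ContinuousLinearMap.continuous _) (ContinuousLinearMap.continuous _)
    | ih z =>
      rw [ContinuousLinearMap.completion_apply_coe]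
      exact congrArg _ (LinearMap.congr_fun action_one z)
  map_mul' g h := by
    ext z
    induction z using UniformSpace.Completion.induction_on with
    | hp => exact isClosed_eq (ContinuousLinearMap.continuous _) (ContinuousLinearMap.continuous _)
    | ih z =>
      rw [mul_apply_eq_comp, ContinuousLinearMap.completion_apply_coe,
        ContinuousLinearMap.completion_apply_coe, ContinuousLinearMap.completion_apply_coe]
      exact congrArg _ (action_mul g h z)

/-- The vacuum vector: the diagram consisting of one vertical string, in the space of the trivial
partition. -/
noncomputable def vacuum : Hilbert :=
  ((toLimit .leaf ⟨Finsupp.single (baseDiagram 1) 1, Finsupp.single_mem_supported ℂ 1 rfl⟩ :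
    PreHilbert) : Hilbert)

/-- The Jones subgroup: the stabilizer of the vacuum vector. -/
def JonesSubgroup : Subgroup ThompsonF where
  carrier := {g | jonesRep g vacuum = vacuum}
  one_mem' := by simp
  mul_mem' := by
    intro g h hg hh
    simp only [Set.mem_ofPred_eq] at hg hh ⊢
    rw [map_mul, mul_apply_eq_comp, hh, hg]
  inv_mem' := by
    intro g hg
    simp only [Set.mem_ofPred_eq] at hg ⊢
    conv_lhs => rw [← hg]
    rw [← mul_apply_eq_comp, ← map_mul, inv_mul_cancel, map_one]
    rfl

/-- `LeftEdge T k i j`: in a copy of `T` whose leaves have the numbers `k, k + 1, …` from left to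
right, the regions `i` and `j` are separated by an edge that leads from a vertex of `T` to its left
child. Here region `i` is the one immediately to the left of the leaf number `i`. The left edge of
the top caret separates the region to the left of the tree from the region between the two
subtrees. -/
def LeftEdge : BinTree → ℕ → ℕ → ℕ → Prop
  | .leaf, _, _, _ => False
  | .node l r, k, i, j => (i = k ∧ j = k + l.leaves) ∨ LeftEdge l k i j ∨
      LeftEdge r (k + l.leaves) i j

/-- The graph `Γ(T, S)` of a pair of trees with the same number of leaves. The vertices are the
regions to the left of the leaves, and two of them are adjacent if they are separated by a left edge
of one of the two trees (these are the edges sloping up from left to right in the tree drawn in the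
upper half plane, and the edges sloping down in the tree drawn upside down in the lower half
plane). -/
def treeGraph (T S : BinTree) : SimpleGraph (Fin T.leaves) :=
  SimpleGraph.fromRel fun i j => LeftEdge T 0 i j ∨ LeftEdge S 0 i j

/-- The group `F_N`, given by generators `x_0, x_1, …` and relations
`x_k⁻¹ x_n x_k = x_{n + N - 1}` for `k < n`. -/
abbrev ThompsonFN (N : ℕ) : Type :=
  PresentedGroup {r : FreeGroup ℕ | ∃ k n, k < n ∧ r = (FreeGroup.of k)⁻¹ * FreeGroup.of n *
    FreeGroup.of k * (FreeGroup.of (n + N - 1))⁻¹}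

end JonesThompson

/-! The inner product of diagrams is a spin model. By `gram_eq_sum_spin` a diagram is a vector
indexed by two-colourings of the boundary points, supported on those that are constant on the
regions on one side of its strings. Such a colouring amounts to a colour `τ k` for the region to the
left of each leaf `k`. In these coordinates the box R is a constraint. With its coefficient, the
summand `id_2` contributes `1` whatever the colour of the new region, and the summand `E`
contributes `-1` exactly when that colour equals the colour on the left. Hence R gives `1` if the
two colours differ and `0` if they agree (`spinCoord_split`). Therefore the vacuum, written in the
space of a tree `T`, is constant on the colourings that change across every left edge of `T`, and
zero elsewhere (`spinCoord_expand`). The left edges form a spanning tree on the regions, so there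
are exactly two such colourings, and they are exchanged by swapping the colours. If `(T, S)`
represents `g`, then `π(g)ξ` and `ξ` are two unit vectors in the space of `S`. They are equal if the
proper colourings of `T` and `S` coincide, and orthogonal otherwise (`mem_jonesSubgroup_iff`). The
proper colourings coincide if and only if one colouring is proper for both trees, that is, if and
only if the graph is bipartite (`treeGraph_isBipartite_iff`). So the Jones subgroup consists of the
elements whose two trees have the same colour word. Adding a caret to corresponding leaves replaces
a letter `c` by `c, !c` in both words, and such moves turn any word into an alternating one of odd
length. A tree with such a word comes from a ternary tree by replacing each ternary caret by `vine
2` (`BinTree.exists_toBin`). Hence the Jones subgroup is the group of pairs of ternary trees. The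
generator `x_j` of the abstract group is sent to the element that grows a ternary caret on leaf `j`
of a long vine. Right multiplication by this element attaches a ternary caret to leaf `j` of the
target tree, which gives the relations. The map is onto because every ternary tree grows from a
single leaf by adding carets. It is injective because every element of the abstract group is a
fraction of two positive words, and a positive word can be recovered in the abstract group from the
tree that it grows: `TernaryTree.lastCode` depends only on the tree, and the relations absorb the
order of growth. -/

namespace JonesThompson

/-! ### Colourings of the regions of a tree -/

/-- The proper colouring, with colour `c` on the leftmost region, of the regions to the left of the
leaves of a tree, in which the regions on the two sides of a left edge get different colours. -/
def BinTree.color : BinTree → Bool → List Bool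
  | .leaf, c => [c]
  | .node l r, c => l.color c ++ r.color (!c)

namespace BinTree

@[simp] theorem length_color (t : BinTree) : ∀ c, (t.color c).length = t.leaves := by
  induction t with
  | leaf => intro c; rfl
  | node l r hl hr => intro c; simp [color, leaves, hl, hr]

theorem head?_color (t : BinTree) : ∀ c, (t.color c).head? = some c := by
  induction t with
  | leaf => intro c; rfl
  | node l r hl hr => intro c; simp [color, List.head?_append, hl]

theorem map_not_color (t : BinTree) : ∀ c, (t.color c).map not = t.color (!c) := by
  induction t with
  | leaf => intro c; rfl
  | node l r hl hr => intro c; simp [color, hl, hr]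

/-- `τ` restricts to the proper colouring of the leaves of `t`, if these have the numbers
`k, k + 1, …`. -/
def Colors (t : BinTree) (k : ℕ) (τ : ℕ → Bool) : Prop :=
  (List.range t.leaves).map (fun i => τ (k + i)) = t.color (τ k)

theorem colors_leaf (k : ℕ) (τ : ℕ → Bool) : leaf.Colors k τ := by
  simp [Colors, leaves, color, List.range_succ]

/-- The word of the caret is cut after the leaves of `l`. Comparing the first letters of the second
halves gives the condition for the top left edge. -/
theorem colors_node (l r : BinTree) (k : ℕ) (τ : ℕ → Bool) : (node l r).Colors k τ ↔
    τ k ≠ τ (k + l.leaves) ∧ l.Colors k τ ∧ r.Colors (k + l.leaves) τ := by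
  unfold Colors
  simp only [leaves, color, List.range_add, List.map_append, List.map_map]
  rw [show ∀ a b c d : List Bool, a.length = c.length → (a ++ b = c ++ d ↔ a = c ∧ b = d) from
    fun a b c d h => ⟨fun h' => List.append_inj h' h, fun ⟨h1, h2⟩ => by rw [h1, h2]⟩]
  swap
  · simp
  constructor
  · rintro ⟨h1, h2⟩
    have h3 := congrArg List.head? h2
    obtain ⟨m, hm⟩ : ∃ m, r.leaves = m + 1 := ⟨r.carets, r.leaves_eq⟩
    rw [head?_color, hm, List.range_succ_eq_map] at h3
    simp only [List.map_cons, List.head?_cons, Function.comp, Option.some.injEq, add_zero] at h3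
    refine ⟨by simp [h3], h1, ?_⟩
    rw [h3, ← h2]
    simp [Function.comp_def, add_assoc]
  · rintro ⟨h1, h2, h3⟩
    refine ⟨h2, ?_⟩
    rw [show (!τ k) = τ (k + l.leaves) by cases h : τ k <;> simp_all, ← h3]
    simp [Function.comp_def, add_assoc]

/-- Both sides satisfy the same recursion at a caret. The lemma links the recursive words, which are
convenient for computation, with the edges that define the graph. -/
theorem colors_iff (t : BinTree) : ∀ (k : ℕ) (τ : ℕ → Bool),
    t.Colors k τ ↔ ∀ i j, LeftEdge t k i j → τ i ≠ τ j := by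
  induction t with
  | leaf => intro k τ; simp [colors_leaf, LeftEdge]
  | node l r hl hr =>
    intro k τ
    rw [colors_node, hl, hr]
    simp only [LeftEdge]
    constructor
    · rintro ⟨h1, h2, h3⟩ i j (⟨rfl, rfl⟩ | h | h)
      exacts [h1, h2 _ _ h, h3 _ _ h]
    · intro h
      exact ⟨h _ _ (.inl ⟨rfl, rfl⟩), fun i j hij => h _ _ (.inr (.inl hij)),
        fun i j hij => h _ _ (.inr (.inr hij))⟩

theorem colors_shift (t : BinTree) {k k' : ℕ} {τ τ' : ℕ → Bool}
    (h : ∀ i, τ (k + i) = τ' (k' + i)) : t.Colors k τ ↔ t.Colors k' τ' := by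
  have h0 := h 0
  simp only [add_zero] at h0
  simp only [Colors, h, h0]

theorem exists_colors (t : BinTree) (c : Bool) : ∃ τ : ℕ → Bool, τ 0 = c ∧ t.Colors 0 τ := by
  have h : (t.color c).getD 0 true = c := by
    have := t.head?_color c
    rw [List.head?_eq_getElem?] at this
    simp [this]
  refine ⟨fun i => (t.color c).getD i true, h, ?_⟩
  unfold Colors
  beta_reduce
  rw [h]
  refine List.ext_getElem (by simp) fun i h1 h2 => ?_
  simp only [List.getElem_map, List.getElem_range, zero_add]
  rw [List.getD_eq_getElem _ _ h2]

theorem color_eq_iff {t s : BinTree} (c : Bool) :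
    t.color c = s.color c ↔ t.color false = s.color false := by
  cases c
  · rfl
  · rw [← Bool.not_false, ← map_not_color, ← map_not_color]
    exact (List.map_injective_iff.2 fun a b => Bool.not_inj).eq_iff

/-- A proper colouring of a tree is determined by its leftmost colour, so a common one forces the
words beginning with `τ 0` to agree. Swapping the colours then allows the normalisation to `false`.
-/
theorem color_eq_of_colors {t s : BinTree} (h : t.leaves = s.leaves) {τ : ℕ → Bool}
    (h1 : t.Colors 0 τ) (h2 : s.Colors 0 τ) : t.color false = s.color false := by
  rw [← color_eq_iff (τ 0), ← h1, ← h2, h]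

theorem colors_congr {t s : BinTree} (h : t.color false = s.color false) (τ : ℕ → Bool) :
    t.Colors 0 τ ↔ s.Colors 0 τ := by
  have hl := congrArg List.length h
  simp only [length_color] at hl
  unfold Colors
  rw [hl, (color_eq_iff (τ 0)).2 h]

theorem leftEdge_lt (t : BinTree) : ∀ {k i j : ℕ}, LeftEdge t k i j →
    i < k + t.leaves ∧ j < k + t.leaves := by
  induction t with
  | leaf => intro k i j h; exact h.elim
  | node l r hl hr =>
    have h1 := l.leaves_pos
    have h2 := r.leaves_pos
    rintro k i j (⟨rfl, rfl⟩ | h | h)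
    · simp only [leaves]; omega
    · have := hl h; simp only [leaves]; omega
    · have := hr h; simp only [leaves]; omega

end BinTree

/-- A two-colouring of the graph is the same as a colouring of the regions that is proper for both
trees. -/
theorem treeGraph_isBipartite_iff {T S : BinTree} (h : T.leaves = S.leaves) :
    (treeGraph T S).IsBipartite ↔ T.color false = S.color false := by
  constructor
  · rintro ⟨C⟩
    -- The value `true` beyond the last region is a dummy: by `leftEdge_lt` no left edge reaches
    -- that far.
    let τ : ℕ → Bool := fun i => if hi : i < T.leaves then decide (C ⟨i, hi⟩ = 0) else true
    have key : ∀ i j, LeftEdge T 0 i j ∨ LeftEdge S 0 i j → i < T.leaves → j < T.leaves →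
        i ≠ j → τ i ≠ τ j := by
      intro i j hij hi hj hne
      have ha : (treeGraph T S).Adj ⟨i, hi⟩ ⟨j, hj⟩ := by
        rw [treeGraph, SimpleGraph.fromRel_adj]
        exact ⟨fun h => hne (Fin.ext_iff.1 h), .inl hij⟩
      have := C.valid ha
      simp only [τ, dif_pos hi, dif_pos hj, ne_eq, decide_eq_decide]
      generalize C ⟨i, hi⟩ = a at *
      generalize C ⟨j, hj⟩ = b at *
      revert a b
      decide
    -- Adjacency in a simple graph requires distinct ends. A left edge has distinct ends because
    -- some proper colouring exists.
    have irr : ∀ (t : BinTree) i j, LeftEdge t 0 i j → i ≠ j := by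
      intro t i j hij hij'
      obtain ⟨σ, -, hσ⟩ := t.exists_colors true
      exact (t.colors_iff 0 σ).1 hσ i j hij (congrArg σ hij')
    refine BinTree.color_eq_of_colors (τ := τ) h ?_ ?_
    · refine (T.colors_iff 0 τ).2 fun i j hij => ?_
      have := T.leftEdge_lt hij
      exact key i j (.inl hij) (by omega) (by omega) (irr T i j hij)
    · refine (S.colors_iff 0 τ).2 fun i j hij => ?_
      have := S.leftEdge_lt hij
      exact key i j (.inr hij) (by omega) (by omega) (irr S i j hij)
  · intro hc
    obtain ⟨τ, -, hT⟩ := T.exists_colors true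
    have hS := (BinTree.colors_congr hc τ).1 hT
    rw [BinTree.colors_iff] at hT hS
    let C : (treeGraph T S).Coloring Bool := SimpleGraph.Coloring.mk (fun i => τ i) (by
      intro i j hij
      rw [treeGraph, SimpleGraph.fromRel_adj] at hij
      obtain ⟨-, (h | h) | (h | h)⟩ := hij
      exacts [hT _ _ h, hS _ _ h, (hT _ _ h).symm, (hS _ _ h).symm])
    simpa [SimpleGraph.IsBipartite] using C.colorable

/-! ### The vacuum vector in spin coordinates -/

/-- The coordinate of a vector of diagrams at the spin configuration `σ`. -/
noncomputable def spinCoord (n : ℕ) (σ : Fin (2 * n) → Bool) : Diagrams →ₗ[ℂ] ℂ :=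
  Finsupp.linearCombination ℂ fun p => (spin n p σ : ℂ)

theorem spinCoord_single (n : ℕ) (σ : Fin (2 * n) → Bool) (p : Diagram) :
    spinCoord n σ (Finsupp.single p 1) = spin n p σ := by
  simp [spinCoord]

/-- This is the sesquilinear extension of `gram_eq_sum_spin`: inner products can be computed from
coordinates alone. -/
theorem form_eq_sum_spinCoord {n : ℕ} {x y : Diagrams} (hx : x ∈ TL n) (hy : y ∈ TL n) :
    form x y = ∑ σ, conj (spinCoord n σ x) * spinCoord n σ y := by
  rw [mem_TL] at hx hy
  simp only [spinCoord, Finsupp.linearCombination_apply, Finsupp.sum, map_sum, smul_eq_mul,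
    map_mul, Complex.conj_ofReal, Finset.sum_mul_sum]
  rw [Finset.sum_comm]
  unfold form
  refine Finset.sum_congr rfl fun p hp => ?_
  rw [Finset.sum_comm]
  refine Finset.sum_congr rfl fun q hq => ?_
  dsimp only
  rw [gram_eq_sum_spin (hx p hp) (hy q hq)]
  push_cast
  rw [Finset.mul_sum]
  refine Finset.sum_congr rfl fun σ _ => ?_
  ring

/-- The spin configuration on boundary points given by a colouring of the regions. -/
def boundarySpin (n : ℕ) (τ : ℕ → Bool) (i : Fin (2 * n)) : Bool := τ (i / 2)

/-- The base diagram joins `2 * k` to `2 * k + 1`, so every diagram is supported on configurations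
that are constant on these pairs. Reading the colours at the even points exhibits such a
configuration as a colouring of the regions. -/
theorem spinCoord_eq_zero {n : ℕ} {σ : Fin (2 * n) → Bool} (h : ∀ τ, σ ≠ boundarySpin n τ)
    (x : Diagrams) : spinCoord n σ x = 0 := by
  rw [spinCoord, Finsupp.linearCombination_apply]
  refine Finset.sum_eq_zero fun p _ => ?_
  dsimp only
  rw [spin, if_neg, Complex.ofReal_zero, smul_zero]
  intro hσ
  refine h (fun k => if hk : 2 * k < 2 * n then σ ⟨2 * k, hk⟩ else true) (funext fun i => ?_)
  have hi := i.2
  simp only [boundarySpin, dif_pos (show 2 * ((i : ℕ) / 2) < 2 * n by omega)]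
  rcases Nat.mod_two_eq_zero_or_one i with h0 | h0
  · congr 1
    ext
    simp
    omega
  · refine hσ _ _ ⟨(baseDiagram n).pair, by simp, ?_⟩
    simp only [baseDiagram, if_pos hi]
    rw [if_neg (by omega)]
    omega

/-- The arcs of the base diagram impose no condition here, as their two ends lie at the same region.
-/
theorem spin_boundarySpin_eq_iff {n : ℕ} (p : Diagram) (τ : ℕ → Bool) :
    (∀ a b, Rel (2 * n) [p.pair, (baseDiagram n).pair] a b →
      boundarySpin n τ a = boundarySpin n τ b) ↔
    ∀ i, i < 2 * n → p.pair i < 2 * n → τ (i / 2) = τ (p.pair i / 2) := by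
  constructor
  · intro h i hi hpi
    exact h ⟨i, hi⟩ ⟨_, hpi⟩ ⟨_, by simp, rfl⟩
  · rintro h a b ⟨f, hf, hab⟩
    simp only [List.mem_cons, List.not_mem_nil, or_false] at hf
    unfold boundarySpin
    rcases hf with rfl | rfl
    · rw [← hab]; exact h a a.2 (hab ▸ b.2)
    · have ha := a.2
      simp only [baseDiagram, if_pos ha] at hab
      congr 1
      split_ifs at hab <;> omega

/-- Skip `d` numbers after `k`. -/
def skip (k d i : ℕ) : ℕ := if i ≤ k then i else i + d

/-- The new arc encloses the new region `k + 1` by itself. Its colour is free and there is one more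
component, which costs a factor `δ`, while the normalisation `√(δ ^ n / δ)` gains `√δ`. -/
theorem spin_insertCup_right {n k : ℕ} {p : Diagram} (hp : p.size = n) (hk : k < n)
    (h : 2 * k + 2 ≤ 2 * p.size) (τ : ℕ → Bool) :
    spin (n + 1) (p.insertCup (2 * k + 2) h) (boundarySpin (n + 1) τ) =
      √δ / δ * spin n p (boundarySpin n (τ ∘ skip k 1)) := by
  subst hp
  have hc := components_all h [(p.insertCup (2 * k + 2) h).pair, (baseDiagram (p.size + 1)).pair]
    (by
      simp only [List.mem_cons, List.not_mem_nil, or_false, forall_eq_or_imp, forall_eq]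
      exact ⟨(p.insertCup (2 * k + 2) h).isMatching, (baseDiagram (p.size + 1)).isMatching⟩)
    (by simp) (by
      simp only [List.mem_cons, List.not_mem_nil, or_false, forall_eq_or_imp, forall_eq]
      refine ⟨insertFun_left _ _, ?_⟩
      simp only [baseDiagram]
      split_ifs <;> omega)
  simp only [List.map] at hc
  rw [capFun_base h, show capFun (2 * k + 2) (p.insertCup (2 * k + 2) h).pair = p.pair from
    capFun_insertFun _ _] at hc
  have hup : ∀ i, τ (up (2 * k + 2) i / 2) = (τ ∘ skip k 1) (i / 2) := by
    intro i
    simp only [Function.comp, up, skip]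
    congr 1
    split_ifs <;> omega
  have hiff : (∀ i, i < 2 * (p.size + 1) → (p.insertCup (2 * k + 2) h).pair i < 2 * (p.size + 1) →
      τ (i / 2) = τ ((p.insertCup (2 * k + 2) h).pair i / 2)) ↔
      ∀ i, i < 2 * p.size → p.pair i < 2 * p.size →
        (τ ∘ skip k 1) (i / 2) = (τ ∘ skip k 1) (p.pair i / 2) := by
    constructor
    · intro H i hi hpi
      have := H (up (2 * k + 2) i) ((up_lt_bound h i).2 hi)
      simp only [Diagram.insertCup, insertFun_up, hup] at this
      exact this ((up_lt_bound h _).2 hpi)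
    · intro H i hi _
      simp only [Diagram.insertCup]
      rcases up_cases (2 * k + 2) i with rfl | rfl | ⟨i, rfl⟩
      · rw [insertFun_left]; congr 1; omega
      · rw [insertFun_right]; congr 1; omega
      · have hi' := (up_lt_bound h i).1 hi
        rw [insertFun_up, hup, hup]
        exact H i hi' (p.pair_lt i hi')
  unfold spin
  simp only [spin_boundarySpin_eq_iff, hiff]
  split_ifs
  · rw [show 2 * (p.size + 1) = 2 * p.size + 2 by ring, hc, pow_succ' δ p.size, mul_div_assoc,
      Real.sqrt_mul δ_pos.le, pow_succ']
    have := δ_pos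
    field_simp
  · simp

/-- The new arc merges the regions `k` and `k + 1`, whose colours must therefore agree. The number
of components is unchanged, so only the factor `√δ` of the normalisation appears. -/
theorem spin_insertCup_left {n k : ℕ} {p : Diagram} (hp : p.size = n) (hk : k < n)
    (h : 2 * k + 1 ≤ 2 * p.size) (τ : ℕ → Bool) :
    spin (n + 1) (p.insertCup (2 * k + 1) h) (boundarySpin (n + 1) τ) =
      if τ k = τ (k + 1) then √δ * spin n p (boundarySpin n (τ ∘ skip k 1)) else 0 := by
  subst hp
  have hc := components_pair_one h (p.insertCup (2 * k + 1) h).isMatching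
    (baseDiagram (p.size + 1)).isMatching (insertFun_left _ _) (by
      simp only [baseDiagram]
      split_ifs <;> omega)
  rw [capFun_base h, show capFun (2 * k + 1) (p.insertCup (2 * k + 1) h).pair = p.pair from
    capFun_insertFun _ _] at hc
  -- The old point `2 * k + 1` moves to `2 * k + 3` and thereby changes from region `k` to region `k
  -- + 1`. This is harmless only if the two colours agree.
  have hup : τ k = τ (k + 1) → ∀ i, τ (up (2 * k + 1) i / 2) = (τ ∘ skip k 1) (i / 2) := by
    intro hτ i
    simp only [Function.comp, up, skip]
    by_cases hi : i = 2 * k + 1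
    · subst hi
      rw [if_neg (by omega), if_pos (by omega), show (2 * k + 1 + 2) / 2 = k + 1 by omega, ← hτ]
      congr 1
      omega
    · congr 1
      split_ifs <;> omega
  have hiff : (∀ i, i < 2 * (p.size + 1) → (p.insertCup (2 * k + 1) h).pair i < 2 * (p.size + 1) →
      τ (i / 2) = τ ((p.insertCup (2 * k + 1) h).pair i / 2)) ↔ τ k = τ (k + 1) ∧
      ∀ i, i < 2 * p.size → p.pair i < 2 * p.size →
        (τ ∘ skip k 1) (i / 2) = (τ ∘ skip k 1) (p.pair i / 2) := by
    constructor
    · intro H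
      have hτ : τ k = τ (k + 1) := by
        have := H (2 * k + 1) (by omega)
        simp only [Diagram.insertCup, insertFun_left] at this
        rw [show (2 * k + 1) / 2 = k by omega, show (2 * k + 1 + 1) / 2 = k + 1 by omega] at this
        exact this (by omega)
      refine ⟨hτ, fun i hi hpi => ?_⟩
      have := H (up (2 * k + 1) i) ((up_lt_bound h i).2 hi)
      simp only [Diagram.insertCup, insertFun_up, hup hτ] at this
      exact this ((up_lt_bound h _).2 hpi)
    · rintro ⟨hτ, H⟩ i hi _
      simp only [Diagram.insertCup]
      rcases up_cases (2 * k + 1) i with rfl | rfl | ⟨i, rfl⟩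
      · rw [insertFun_left, show (2 * k + 1) / 2 = k by omega,
          show (2 * k + 1 + 1) / 2 = k + 1 by omega, hτ]
      · rw [insertFun_right, show (2 * k + 1) / 2 = k by omega,
          show (2 * k + 1 + 1) / 2 = k + 1 by omega, hτ]
      · have hi' := (up_lt_bound h i).1 hi
        rw [insertFun_up, hup hτ, hup hτ]
        exact H i hi' (p.pair_lt i hi')
  unfold spin
  simp only [spin_boundarySpin_eq_iff, hiff]
  by_cases hτ : τ k = τ (k + 1)
  · simp only [hτ, true_and, if_true]
    split_ifs
    · rw [show 2 * (p.size + 1) = 2 * p.size + 2 by ring]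
      rw [show components (2 * p.size + 2) [(p.insertCup (2 * k + 1) h).pair,
        (baseDiagram (p.size + 1)).pair] = _ from hc, pow_succ' δ p.size, mul_div_assoc,
        Real.sqrt_mul δ_pos.le, mul_div_assoc]
    · simp
  · simp [hτ]

/-- With the coefficients of R, the first summand contributes `√δ * (√δ / δ) = 1`. The second
subtracts `√δ * (1 / δ) * √δ = 1` precisely when the colours agree. This cancellation is why the
subgroup is governed by proper colourings. -/
theorem spinCoord_split {n k : ℕ} (hk : k < n) {x : Diagrams} (hx : x ∈ TL n) (τ : ℕ → Bool) :
    spinCoord (n + 1) (boundarySpin (n + 1) τ) (split k x) =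
      if τ k ≠ τ (k + 1) then spinCoord n (boundarySpin n (τ ∘ skip k 1)) x else 0 := by
  rw [mem_TL] at hx
  have hn : ∀ σ, spinCoord n σ x = ∑ p ∈ x.support, x p • (spin n p σ : ℂ) := fun σ => by
    rw [spinCoord, Finsupp.linearCombination_apply]
    rfl
  rw [split, Finsupp.linearCombination_apply, Finsupp.sum, map_sum, hn,
    ← Finset.sum_const_zero (s := x.support), ← Finset.sum_ite_irrel]
  refine Finset.sum_congr rfl fun p hp => ?_
  have hp := hx p hp
  rw [map_smul, splitDiagram, dif_pos (hp ▸ hk), map_smul, map_sub, map_smul, spinCoord_single,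
    spinCoord_single, spin_insertCup_right hp hk, spin_insertCup_left hp hk]
  -- The scalar in R is `√δ` because `δ = √2`.
  have hc : ((2 : ℝ) ^ (1 / 4 : ℝ)) = √δ := by
    rw [δ, Real.sqrt_eq_rpow, Real.sqrt_eq_rpow, ← Real.rpow_mul (by norm_num)]
    norm_num
  rw [hc]
  have hδ := δ_pos
  have h1 : √δ * √δ = δ := Real.mul_self_sqrt hδ.le
  by_cases hτ : τ k = τ (k + 1)
  · simp only [hτ, if_true, ne_eq, not_true, if_false, smul_eq_mul]
    norm_cast
    push_cast
    ring
  · simp only [hτ, if_false, ne_eq, not_false_eq_true, if_true, smul_eq_mul]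
    norm_cast
    push_cast
    congr 1
    rw [mul_zero, sub_zero]
    norm_cast
    rw [← mul_assoc, ← mul_div_assoc, h1, div_self hδ.ne', one_mul]

/-- Each caret contributes the constraint of its own left edge by `spinCoord_split`, and together
these constraints say that the colouring is proper. The coordinate that survives is the old one with
the new regions forgotten. -/
theorem spinCoord_expand (t : BinTree) : ∀ {n k : ℕ}, k < n → ∀ {x : Diagrams}, x ∈ TL n →
    ∀ τ : ℕ → Bool, (¬ t.Colors k τ →
      spinCoord (n + t.carets) (boundarySpin _ τ) (expand t k x) = 0) ∧ (t.Colors k τ →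
      spinCoord (n + t.carets) (boundarySpin _ τ) (expand t k x) =
        spinCoord n (boundarySpin n (τ ∘ skip k t.carets)) x) := by
  induction t with
  | leaf =>
    intro n k hk x hx τ
    refine ⟨fun h => absurd (BinTree.colors_leaf k τ) h, fun _ => ?_⟩
    have : τ ∘ skip k 0 = τ := by funext i; simp [skip]
    simp only [BinTree.carets, expand, this, LinearMap.id_apply]
    rfl
  | node l r hl hr =>
    intro n k hk x hx τ
    have m1 := split_mem (k := k) hx
    have m2 := expand_mem r (k + 1) m1
    have h1 := hr (n := n + 1) (k := k + 1) (by omega) m1 (τ ∘ skip k l.carets)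
    have h2 := hl (n := n + 1 + r.carets) (k := k) (by omega) m2 τ
    have h3 := spinCoord_split hk hx ((τ ∘ skip k l.carets) ∘ skip (k + 1) r.carets)
    -- `expand` splits first, then grows `r`, then `l`. Undoing this removes the new regions of `l`
    -- first, after which index `k + 1` stands for the region `k + l.leaves`, the leftmost one of
    -- `r`.
    have e1 : ((τ ∘ skip k l.carets) ∘ skip (k + 1) r.carets) k = τ k := by simp [skip]
    have e2 : ((τ ∘ skip k l.carets) ∘ skip (k + 1) r.carets) (k + 1) = τ (k + l.leaves) := by
      simp [skip, l.leaves_eq]; congr 1; omega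
    have e3 : ((τ ∘ skip k l.carets) ∘ skip (k + 1) r.carets) ∘ skip k 1 =
        τ ∘ skip k (l.carets + r.carets + 1) := by
      funext i
      simp only [Function.comp, skip]
      congr 1
      split_ifs <;> omega
    have e4 : r.Colors (k + 1) (τ ∘ skip k l.carets) ↔ r.Colors (k + l.leaves) τ := by
      refine r.colors_shift fun i => ?_
      simp only [Function.comp, skip, l.leaves_eq]
      congr 1
      split_ifs <;> omega
    rw [e1, e2, e3] at h3
    rw [e4] at h1
    have e5 : n + (l.carets + r.carets + 1) = n + 1 + r.carets + l.carets := by ring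
    rw [BinTree.colors_node]
    simp only [expand, BinTree.carets, LinearMap.comp_apply]
    rw [e5]
    constructor
    · intro h
      by_cases c1 : l.Colors k τ
      · rw [h2.2 c1]
        by_cases c2 : r.Colors (k + l.leaves) τ
        · rw [h1.2 c2, h3, if_neg (by tauto)]
        · exact h1.1 c2
      · exact h2.1 c1
    · rintro ⟨c0, c1, c2⟩
      rw [h2.2 c1, h1.2 c2, h3, if_pos c0]

/-- The diagram with one vertical string. -/
noncomputable def oneString : Diagrams := Finsupp.single (baseDiagram 1) 1

theorem oneString_mem : oneString ∈ TL 1 := Finsupp.single_mem_supported ℂ 1 rfl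

theorem spinCoord_oneString (τ τ' : ℕ → Bool) : spinCoord 1 (boundarySpin 1 τ) oneString =
    spinCoord 1 (boundarySpin 1 τ') oneString := by
  have : ∀ τ : ℕ → Bool, ∀ i, i < 2 * 1 → (baseDiagram 1).pair i < 2 * 1 →
      τ (i / 2) = τ ((baseDiagram 1).pair i / 2) := by
    intro τ i hi h
    congr 1
    omega
  rw [oneString, spinCoord_single, spinCoord_single, spin, spin,
    if_pos ((spin_boundarySpin_eq_iff _ _).2 (this τ)),
    if_pos ((spin_boundarySpin_eq_iff _ _).2 (this τ'))]

theorem form_oneString : form oneString oneString = 1 := by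
  have h : (baseDiagram 1).loops (baseDiagram 1) = 1 := by
    have h1 := components_all (j := 0) (M := 0) le_rfl [(baseDiagram 1).pair, (baseDiagram 1).pair]
      (by
        simp only [List.mem_cons, List.not_mem_nil, or_false, or_self, forall_eq]
        exact (baseDiagram 1).isMatching) (by simp) (by simp [baseDiagram])
    have h2 : ∀ L, components 0 L = 0 := fun L => by
      rw [components_def, Nat.card_eq_zero]
      exact .inl ⟨fun x => by obtain ⟨x⟩ := x; exact x.elim0⟩
    rw [h2] at h1
    exact h1
  rw [oneString, form_single, gram, if_pos rfl, h]
  simp [δ_pos.ne']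

/-- The coordinate of one string is the same for both colours of its only region. Hence the expanded
vacuum takes a single value on proper colourings, and this value does not depend on `t`. -/
theorem spinCoord_expand_oneString (t : BinTree) (τ : ℕ → Bool) :
    (¬ t.Colors 0 τ → spinCoord (1 + t.carets) (boundarySpin _ τ) (expand t 0 oneString) = 0) ∧
    (t.Colors 0 τ → spinCoord (1 + t.carets) (boundarySpin _ τ) (expand t 0 oneString) =
      spinCoord 1 (boundarySpin 1 fun _ => true) oneString) := by
  have := spinCoord_expand t one_pos oneString_mem τ
  exact ⟨this.1, fun h => (this.2 h).trans (spinCoord_oneString _ _)⟩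

/-- Equal words mean equal proper colourings, so both vectors have the same coordinates. The form is
then the squared norm of the vacuum, which expansion preserves. -/
theorem form_expand_of_color_eq {t s : BinTree} (h : t.color false = s.color false) :
    form (expand t 0 oneString) (expand s 0 oneString) = 1 := by
  have hl := congrArg List.length h
  simp only [BinTree.length_color, BinTree.leaves_eq, add_left_inj] at hl
  have ms := expand_mem s 0 oneString_mem
  have mt := expand_mem t 0 oneString_mem
  rw [← form_oneString, ← form_expand t one_pos oneString_mem oneString_mem]
  have ht := spinCoord_expand_oneString t
  have hs := spinCoord_expand_oneString s
  rw [← hl] at ms hs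
  rw [form_eq_sum_spinCoord mt ms, form_eq_sum_spinCoord mt mt]
  refine Finset.sum_congr rfl fun σ _ => ?_
  congr 1
  by_cases hσ : ∃ τ, σ = boundarySpin _ τ
  · obtain ⟨τ, rfl⟩ := hσ
    by_cases hc : t.Colors 0 τ
    · rw [(ht τ).2 hc, (hs τ).2 ((BinTree.colors_congr h τ).1 hc)]
    · rw [(ht τ).1 hc, (hs τ).1 (fun h' => hc ((BinTree.colors_congr h τ).2 h'))]
  · rw [spinCoord_eq_zero (not_exists.1 hσ), spinCoord_eq_zero (not_exists.1 hσ)]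

/-- The two vectors have disjoint supports, since a configuration in both supports would be a common
proper colouring. -/
theorem form_expand_of_color_ne {t s : BinTree} (hl : t.leaves = s.leaves)
    (h : t.color false ≠ s.color false) :
    form (expand t 0 oneString) (expand s 0 oneString) = 0 := by
  have hl' := hl
  simp only [BinTree.leaves_eq, add_left_inj] at hl'
  have ms := expand_mem s 0 oneString_mem
  have mt := expand_mem t 0 oneString_mem
  have ht := spinCoord_expand_oneString t
  have hs := spinCoord_expand_oneString s
  rw [← hl'] at ms hs
  rw [form_eq_sum_spinCoord mt ms]
  refine Finset.sum_eq_zero fun σ _ => ?_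
  by_cases hσ : ∃ τ, σ = boundarySpin _ τ
  · obtain ⟨τ, rfl⟩ := hσ
    by_cases hc : t.Colors 0 τ
    · rw [(hs τ).1 fun hc' => h (BinTree.color_eq_of_colors hl hc hc'), mul_zero]
    · rw [(ht τ).1 hc, map_zero, zero_mul]
  · rw [spinCoord_eq_zero (not_exists.1 hσ), map_zero, zero_mul]

/-- Membership in the Jones subgroup in terms of colourings. -/
theorem mem_jonesSubgroup_iff {g : ThompsonF} {T S : BinTree}
    (h : Represents (g : unitInterval ≃o unitInterval) T S) :
    g ∈ JonesSubgroup ↔ T.color false = S.color false := by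
  have hT : BinTree.leaf ≤ T := trivial
  have hS : BinTree.leaf ≤ S := trivial
  let v : HSpace .leaf := ⟨oneString, oneString_mem⟩
  -- Here `a` is `π(g)ξ` and `b` is `ξ`, both represented in the space of the target tree `S`.
  set a : PreHilbert := toLimit S (transport h.leaves_eq (inclusion .leaf T hT v)) with ha
  set b : PreHilbert := toLimit S (inclusion .leaf S hS v) with hb
  have e1 : vacuum = (b : Hilbert) := by rw [hb, toLimit_inclusion]; rfl
  have e2 : jonesRep g vacuum = (a : Hilbert) := by
    rw [ha, ← action_toLimit g hT h]
    exact ContinuousLinearMap.completion_apply_coe _ _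
  have hab : inner ℂ a b = form (expand T 0 oneString) (expand S 0 oneString) := inner_toLimit _ _
  have haa : inner ℂ a a = (1 : ℂ) :=
    (inner_toLimit _ _).trans (form_expand_of_color_eq (t := T) rfl)
  have hbb : inner ℂ b b = (1 : ℂ) :=
    (inner_toLimit _ _).trans (form_expand_of_color_eq (t := S) rfl)
  have hg : g ∈ JonesSubgroup ↔ (a : Hilbert) = b := by
    change jonesRep g vacuum = vacuum ↔ _
    rw [e2, e1]
  rw [hg]
  constructor
  · intro hEq
    by_contra hne
    have h0 : inner ℂ (a : Hilbert) (b : Hilbert) = (0 : ℂ) := by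
      rw [UniformSpace.Completion.inner_coe, hab, form_expand_of_color_ne h.leaves_eq hne]
    rw [hEq, UniformSpace.Completion.inner_coe, hbb] at h0
    exact one_ne_zero h0
  · intro hc
    have h1 := hab.trans (form_expand_of_color_eq hc)
    have h2 : inner ℂ b a = (1 : ℂ) := by rw [← inner_conj_symm, h1, map_one]
    -- The squared norm of `a - b` is `1 - 1 - 1 + 1 = 0`. The conclusion is drawn in the
    -- completion, where null vectors vanish.
    rw [← sub_eq_zero, ← @inner_self_eq_zero ℂ, inner_sub_left, inner_sub_right, inner_sub_right]
    simp only [UniformSpace.Completion.inner_coe, h1, h2, haa, hbb, sub_self]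

/-! ### Tree pairs and elements of Thompson's group -/

/-- The list of intervals tiles the interval from `a` to `b`. -/
def Tiles : ℝ → List (ℝ × ℝ) → ℝ → Prop
  | a, [], b => a = b
  | a, I :: A, b => I.1 = a ∧ I.1 < I.2 ∧ Tiles I.2 A b

theorem Tiles.append {A B : List (ℝ × ℝ)} {m b : ℝ} (hB : Tiles m B b) :
    ∀ {a : ℝ}, Tiles a A m → Tiles a (A ++ B) b := by
  induction A with
  | nil => rintro a rfl; exact hB
  | cons I A ih => rintro a ⟨h1, h2, h3⟩; exact ⟨h1, h2, ih h3⟩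

theorem tiles_cells (t : BinTree) : ∀ {a b : ℝ}, a < b → Tiles a (t.cells a b) b := by
  induction t with
  | leaf => intro a b h; exact ⟨rfl, h, rfl⟩
  | node l r hl hr =>
    intro a b h
    exact (hr (by linarith)).append (hl (by linarith))

theorem Tiles.le {A : List (ℝ × ℝ)} {b : ℝ} : ∀ {a : ℝ}, Tiles a A b → a ≤ b := by
  induction A with
  | nil => rintro a rfl; exact le_rfl
  | cons I A ih => rintro a ⟨rfl, h, h'⟩; exact h.le.trans (ih h')

theorem Tiles.le_of_mem {A : List (ℝ × ℝ)} {b : ℝ} :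
    ∀ {a : ℝ}, Tiles a A b → ∀ I ∈ A, a ≤ I.1 := by
  induction A with
  | nil => intro a _ I hI; simp at hI
  | cons J A ih =>
    rintro a ⟨rfl, h2, h3⟩ I hI
    rcases List.mem_cons.1 hI with rfl | hI
    · exact le_rfl
    · exact h2.le.trans (ih h3 I hI)

theorem Tiles.exists_mem {A : List (ℝ × ℝ)} {b : ℝ} : ∀ {a : ℝ}, Tiles a A b → A ≠ [] →
    ∀ {x : ℝ}, a ≤ x → x ≤ b → ∃ I ∈ A, I.1 ≤ x ∧ x ≤ I.2 := by
  induction A with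
  | nil => intro a _ h; exact absurd rfl h
  | cons J A ih =>
    rintro a ⟨rfl, h2, h3⟩ - x hx1 hx2
    by_cases hx : x ≤ J.2
    · exact ⟨J, by simp, hx1, hx⟩
    · cases A with
      | nil => exact absurd (hx2.trans h3.ge) hx
      | cons K A =>
        obtain ⟨I, hI, h⟩ := ih h3 (by simp) (not_le.1 hx).le hx2
        exact ⟨I, List.mem_cons_of_mem _ hI, h⟩

/-- The piecewise affine map is built on the whole line, so that each induction step glues maps at
one break point without any condition at the ends. -/
theorem exists_orderIso_of_tiles {b d : ℝ} (A : List (ℝ × ℝ)) : ∀ (B : List (ℝ × ℝ)) {a c : ℝ},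
    A.length = B.length → Tiles a A b → Tiles c B d → ∃ f : ℝ ≃o ℝ, f a = c ∧ f b = d ∧
    List.Forall₂ (fun I J : ℝ × ℝ => ∀ x, I.1 ≤ x → x ≤ I.2 →
      f x = J.1 + (x - I.1) * ((J.2 - J.1) / (I.2 - I.1))) A B := by
  induction A with
  | nil =>
    rintro (_ | ⟨J, B⟩) a c hl hA hB
    · cases hA
      cases hB
      -- To the right of all cells the map is the translation that takes `b` to `d`.
      exact ⟨OrderIso.addRight (d - b), by simp, by simp, .nil⟩
    · simp at hl
  | cons I A ih =>
    rintro (_ | ⟨J, B⟩) a c hl hA hB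
    · simp at hl
    obtain ⟨rfl, hI, hA⟩ := hA
    obtain ⟨rfl, hJ, hB⟩ := hB
    obtain ⟨f, h1, h2, h3⟩ := ih B (by simpa using hl) hA hB
    have hs : 0 < (J.2 - J.1) / (I.2 - I.1) := div_pos (by linarith) (by linarith)
    have hI' : I.2 - I.1 ≠ 0 := by linarith
    have hJ' : J.2 - J.1 ≠ 0 := by linarith
    have hend : J.1 + (I.2 - I.1) * ((J.2 - J.1) / (I.2 - I.1)) = J.2 := by
      field_simp
      ring
    -- The affine map of the first cell is used on all of `(-∞, I.2]`, overriding the values that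
    -- `f` has there. The two pieces agree at `I.2` by `hend`.
    let F : ℝ → ℝ := fun x =>
      if x ≤ I.2 then J.1 + (x - I.1) * ((J.2 - J.1) / (I.2 - I.1)) else f x
    have hle : ∀ x, I.2 ≤ x → F x = f x := by
      intro x hx
      rcases hx.eq_or_lt with rfl | hx
      · simp only [F, if_pos le_rfl, hend, h1]
      · simp only [F, if_neg (not_le.2 hx)]
    have hmono : StrictMono F := by
      intro x y hxy
      by_cases hy : y ≤ I.2
      · simp only [F, if_pos hy, if_pos (hxy.le.trans hy)]
        have := mul_lt_mul_of_pos_right (sub_lt_sub_right hxy I.1) hs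
        linarith
      · have hy' := not_le.1 hy
        by_cases hx : x ≤ I.2
        · have e1 : F x ≤ J.2 := by
            simp only [F, if_pos hx]
            have := mul_le_mul_of_nonneg_right (sub_le_sub_right hx I.1) hs.le
            linarith
          have e2 : J.2 < F y := by
            rw [hle y hy'.le, ← h1]
            exact f.strictMono hy'
          linarith
        · rw [hle y hy'.le, hle x (not_le.1 hx).le]
          exact f.strictMono hxy
    have hsurj : Function.Surjective F := by
      intro y
      by_cases hy : y ≤ J.2
      · refine ⟨I.1 + (y - J.1) * ((I.2 - I.1) / (J.2 - J.1)), ?_⟩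
        have : I.1 + (y - J.1) * ((I.2 - I.1) / (J.2 - J.1)) ≤ I.2 := by
          have h4 : 0 < (I.2 - I.1) / (J.2 - J.1) := div_pos (by linarith) (by linarith)
          have h5 := mul_le_mul_of_nonneg_right (sub_le_sub_right hy J.1) h4.le
          have h6 : (J.2 - J.1) * ((I.2 - I.1) / (J.2 - J.1)) = I.2 - I.1 := by field_simp
          linarith
        simp only [F, if_pos this]
        field_simp
        ring
      · refine ⟨f.symm y, ?_⟩
        rw [hle, f.apply_symm_apply]
        rw [OrderIso.le_symm_apply, h1]
        exact (not_le.1 hy).le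
    have hb : I.2 ≤ b := hA.le
    refine ⟨hmono.orderIsoOfSurjective F hsurj, ?_, ?_, .cons ?_ ?_⟩
    · simp [F, hI.le]
    · rw [hmono.coe_orderIsoOfSurjective, hle b hb, h2]
    · intro x _ hx
      rw [hmono.coe_orderIsoOfSurjective]
      simp only [F, if_pos hx]
    · have hA' := hA.le_of_mem
      refine (List.forall₂_iff_get.2 ⟨h3.length_eq, fun i hi hi' x hx1 hx2 => ?_⟩)
      rw [hmono.coe_orderIsoOfSurjective, hle x ((hA' _ (List.get_mem _ _)).trans hx1)]
      exact (List.forall₂_iff_get.1 h3).2 i hi hi' x hx1 hx2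

/-- The piecewise affine isomorphism of the line fixes `0` and `1`, hence restricts to the unit
interval. -/
theorem exists_represents {T S : BinTree} (h : T.leaves = S.leaves) :
    ∃ g : ThompsonF, Represents (g : unitInterval ≃o unitInterval) T S := by
  obtain ⟨f, h0, h1, hf⟩ := exists_orderIso_of_tiles (T.cells 0 1) (S.cells 0 1)
    (by rw [T.length_cells, S.length_cells, h]) (tiles_cells T one_pos) (tiles_cells S one_pos)
  have s0 : f.symm 0 = 0 := by rw [f.symm_apply_eq, h0]
  have s1 : f.symm 1 = 1 := by rw [f.symm_apply_eq, h1]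
  let g : unitInterval ≃o unitInterval :=
    { toFun := fun x => ⟨f x, h0 ▸ f.monotone x.2.1, h1 ▸ f.monotone x.2.2⟩
      invFun := fun x => ⟨f.symm x, s0 ▸ f.symm.monotone x.2.1, s1 ▸ f.symm.monotone x.2.2⟩
      left_inv := fun x => Subtype.ext (f.symm_apply_apply _)
      right_inv := fun x => Subtype.ext (f.apply_symm_apply _)
      map_rel_iff' := f.le_iff_le }
  have hg : Represents g T S := by
    refine hf.imp fun I J hIJ => ?_
    intro x h1 h2
    exact hIJ x h1 h2
  exact ⟨⟨g, T, S, hg⟩, hg⟩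

theorem Represents.eq_one {g : unitInterval ≃o unitInterval} {T : BinTree}
    (h : Represents g T T) : g = 1 := by
  ext x
  obtain ⟨I, hI, h1, h2⟩ := (tiles_cells T one_pos).exists_mem
    (by rw [← List.length_pos_iff, T.length_cells]; exact T.leaves_pos) x.2.1 x.2.2
  have h3 := (T.mem_cells one_pos I hI).2.1
  rw [List.forall₂_same.1 h I hI x h1 h2, div_self (by linarith)]
  simp

/-- Identities in Thompson's group are proved below by finding one tree pair that represents both
sides. -/
theorem Represents.eq_of {g h : ThompsonF} {T S : BinTree}
    (hg : Represents (g : unitInterval ≃o unitInterval) T S)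
    (hh : Represents (h : unitInterval ≃o unitInterval) T S) : g = h := by
  have := (hh.inv.mul hg).eq_one
  exact Subtype.ext (mul_inv_eq_one.1 this)

/-! ### Adding carets -/

/-- Replace the letter number `i` of a word by a word. -/
def substAt {α : Type*} (f : α → List α) : List α → ℕ → List α
  | [], _ => []
  | x :: l, 0 => f x ++ l
  | x :: l, i + 1 => x :: substAt f l i

theorem substAt_append_left {α : Type*} (f : α → List α) (l m : List α) :
    ∀ {i : ℕ}, i < l.length → substAt f (l ++ m) i = substAt f l i ++ m := by
  induction l with
  | nil => intro i hi; simp at hi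
  | cons x l ih =>
    rintro (_ | i) hi
    · simp [substAt]
    · simp [substAt, ih (Nat.lt_of_succ_lt_succ hi)]

theorem substAt_append_right {α : Type*} (f : α → List α) (l m : List α) {i : ℕ}
    (hi : l.length ≤ i) : substAt f (l ++ m) i = l ++ substAt f m (i - l.length) := by
  induction l generalizing i with
  | nil => simp
  | cons x l ih =>
    obtain ⟨i, rfl⟩ : ∃ j, i = j + 1 := ⟨i - 1, by simp at hi; omega⟩
    simp only [List.length_cons, add_le_add_iff_right] at hi
    simp [substAt, ih hi]

theorem forall₂_substAt {α β : Type*} {R : α → β → Prop} {f : α → List α} {g : β → List β}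
    {A : List α} {B : List β} (h : List.Forall₂ R A B)
    (hfg : ∀ a ∈ A, ∀ b, R a b → List.Forall₂ R (f a) (g b)) :
    ∀ i, List.Forall₂ R (substAt f A i) (substAt g B i) := by
  induction h with
  | nil => intro i; exact .nil
  | cons h1 h2 ih =>
    rintro (_ | i)
    · exact List.rel_append (hfg _ (by simp) _ h1) h2
    · exact .cons h1 (ih (fun a ha => hfg a (List.mem_cons_of_mem _ ha)) i)

namespace BinTree

/-- The tree that consists of one caret. -/
abbrev caret : BinTree := node leaf leaf

/-- Attach a caret to the leaf number `i`. -/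
def add : BinTree → ℕ → BinTree
  | leaf, _ => caret
  | node l r, i => if i < l.leaves then node (l.add i) r else node l (r.add (i - l.leaves))

@[simp] theorem leaves_add (t : BinTree) : ∀ i, (t.add i).leaves = t.leaves + 1 := by
  induction t with
  | leaf => intro i; rfl
  | node l r hl hr =>
    intro i
    unfold add
    split_ifs <;> simp only [leaves, hl, hr] <;> omega

theorem add_comm (t : BinTree) : ∀ {i j : ℕ}, i < j → j < t.leaves →
    (t.add i).add (j + 1) = (t.add j).add i := by
  induction t with
  | leaf => intro i j h h'; simp only [leaves] at h'; omega
  | node l r hl hr =>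
    intro i j h h'
    simp only [leaves] at h'
    by_cases hi : i < l.leaves
    · by_cases hj : j < l.leaves
      · simp [add, hi, hj, hl h hj, Nat.lt_succ_of_lt hi]
      · simp [add, hi, hj]
    · have hj : ¬ j < l.leaves := by omega
      have hj' : ¬ j + 1 < l.leaves := by omega
      simp only [add, if_neg hi, if_neg hj, if_neg hj']
      rw [show j + 1 - l.leaves = j - l.leaves + 1 by omega, hr (by omega) (by omega)]

theorem cells_add (t : BinTree) : ∀ {i : ℕ}, i < t.leaves → ∀ a b : ℝ,
    (t.add i).cells a b = substAt (fun I => caret.cells I.1 I.2) (t.cells a b) i := by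
  induction t with
  | leaf =>
    intro i hi a b
    simp only [leaves, Nat.lt_one_iff] at hi
    subst hi
    simp [add, cells, substAt]
  | node l r hl hr =>
    intro i hi a b
    simp only [leaves] at hi
    by_cases h : i < l.leaves
    · simp only [add, if_pos h, cells]
      rw [substAt_append_left _ _ _ (by rwa [l.length_cells]), hl h]
      rfl
    · simp only [add, if_neg h, cells]
      rw [substAt_append_right _ _ _ (by rw [l.length_cells]; omega), l.length_cells,
        hr (by omega)]
      rfl

/-- The left edge of the new caret separates region `i` from the new region to its right, which gets
the opposite colour. No other colour changes. -/
theorem color_add (t : BinTree) : ∀ {i : ℕ}, i < t.leaves → ∀ c,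
    (t.add i).color c = substAt (fun c => [c, !c]) (t.color c) i := by
  induction t with
  | leaf =>
    intro i hi c
    simp only [leaves, Nat.lt_one_iff] at hi
    subst hi
    simp [add, color, substAt]
  | node l r hl hr =>
    intro i hi c
    simp only [leaves] at hi
    by_cases h : i < l.leaves
    · simp only [add, if_pos h, color]
      rw [substAt_append_left _ _ _ (by rwa [l.length_color]), hl h]
    · simp only [add, if_neg h, color]
      rw [substAt_append_right _ _ _ (by rw [l.length_color]; omega), l.length_color,
        hr (by omega)]

end BinTree

theorem Represents.add {g : unitInterval ≃o unitInterval} {T S : BinTree}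
    (h : Represents g T S) {i : ℕ} (hi : i < T.leaves) : Represents g (T.add i) (S.add i) := by
  unfold Represents
  rw [T.cells_add hi, S.cells_add (h.leaves_eq ▸ hi)]
  exact forall₂_substAt h (fun I hI J hIJ =>
    affineOn_cells .caret (T.mem_cells one_pos I hI).2.1 hIJ) i

/-! ### The generators of the Jones subgroup -/

namespace BinTree

/-- The tree with `m` carets all of whose carets are attached to the last leaf. -/
def vine : ℕ → BinTree
  | 0 => leaf
  | m + 1 => node leaf (vine m)

@[simp] theorem leaves_vine (m : ℕ) : (vine m).leaves = m + 1 := by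
  induction m with
  | zero => rfl
  | succ m ih => simp only [vine, leaves, ih]; omega

theorem vine_add (m : ℕ) : (vine m).add m = vine (m + 1) := by
  induction m with
  | zero => rfl
  | succ m ih =>
    rw [vine, add, if_neg (by simp [leaves])]
    simp only [leaves, Nat.add_sub_cancel, ih]
    rfl

/-- Attach the tree `vine 2` with three leaves to the leaf number `i`. -/
def addTriple (t : BinTree) (i : ℕ) : BinTree := (t.add i).add (i + 1)

@[simp] theorem leaves_addTriple (t : BinTree) (i : ℕ) :
    (t.addTriple i).leaves = t.leaves + 2 := by
  simp [addTriple]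

/-- Growing at leaf `k` adds two leaves and so renumbers leaf `n` as `n + 2`. This is the defining
relation of the group at the level of trees. -/
theorem addTriple_comm (t : BinTree) {k n : ℕ} (hkn : k < n) (hn : n < t.leaves) :
    (t.addTriple k).addTriple (n + 2) = (t.addTriple n).addTriple k := by
  unfold addTriple
  rw [add_comm (t.add k) (i := k + 1) (j := n + 1) (by omega) (by simp; omega),
    add_comm ((t.add k).add (n + 1)) (i := k + 1) (j := n + 2) (by omega) (by simp; omega),
    add_comm t hkn hn, add_comm (t.add n) (i := k) (j := n + 1) (by omega) (by simp; omega)]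

theorem vine_addTriple_add {m j : ℕ} (h : j < m) :
    ((vine m).addTriple j).add (m + 2) = (vine (m + 1)).addTriple j := by
  unfold addTriple
  rw [add_comm ((vine m).add j) (i := j + 1) (j := m + 1) (by omega) (by simp),
    add_comm (vine m) h (by simp), vine_add]

theorem vine_addTriple_last (m : ℕ) : (vine m).addTriple m = vine (m + 2) := by
  rw [addTriple, vine_add, vine_add]

end BinTree

open BinTree (vine)

theorem Represents.addTriple {g : unitInterval ≃o unitInterval} {T S : BinTree}
    (h : Represents g T S) {i : ℕ} (hi : i < T.leaves) :
    Represents g (T.addTriple i) (S.addTriple i) :=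
  (h.add hi).add (by simp; omega)

/-- Since `j < m`, leaf `j` is not the last one. Attaching a caret to the last leaf of both trees
passes from `m` to `m + 1`, so one element serves for all `m`. -/
theorem exists_generator (j : ℕ) : ∃ y : ThompsonF, ∀ m, j < m →
    Represents (y : unitInterval ≃o unitInterval) (vine (m + 2)) ((vine m).addTriple j) := by
  obtain ⟨y, hy⟩ := exists_represents (T := vine (j + 1 + 2)) (S := (vine (j + 1)).addTriple j)
    (by simp)
  refine ⟨y, fun m hm => ?_⟩
  induction m, hm using Nat.le_induction with
  | base => exact hy
  | succ m hm ih =>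
    have := ih.add (i := m + 2) (by simp)
    rwa [BinTree.vine_add, BinTree.vine_addTriple_add hm] at this

/-- The element of Thompson's group that attaches `vine 2` to the leaf number `j` of a long vine. -/
noncomputable def generator (j : ℕ) : ThompsonF := (exists_generator j).choose

theorem represents_generator {j m : ℕ} (h : j < m) :
    Represents (generator j : unitInterval ≃o unitInterval) (vine (m + 2))
      ((vine m).addTriple j) :=
  (exists_generator j).choose_spec m h

/-- The generator goes from the longer vine to `(vine m).addTriple j`. The pair of `p` is enlarged
at the same leaf `j`, so that its source is this tree. -/
theorem Represents.mul_generator {p : ThompsonF} {T : BinTree} {m j : ℕ}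
    (h : Represents (p : unitInterval ≃o unitInterval) (vine m) T) (hj : j < m) :
    Represents ((p * generator j : ThompsonF) : unitInterval ≃o unitInterval) (vine (m + 2))
      (T.addTriple j) :=
  (represents_generator hj).mul (h.addTriple (by simp; omega))

theorem Represents.mul_prod_generator (w : List ℕ) : ∀ {p : ThompsonF} {T : BinTree} {m : ℕ},
    Represents (p : unitInterval ≃o unitInterval) (vine m) T → (∀ j ∈ w, j < m) →
    Represents ((p * (w.map generator).prod : ThompsonF) : unitInterval ≃o unitInterval)
      (vine (m + 2 * w.length)) (w.foldl BinTree.addTriple T) := by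
  induction w with
  | nil => intro p T m h _; simpa using h
  | cons j w ih =>
    intro p T m h hw
    have := ih (h.mul_generator (hw j (by simp))) fun i hi =>
      (hw i (List.mem_cons_of_mem _ hi)).trans (by omega)
    rw [List.map_cons, List.prod_cons, ← mul_assoc, List.length_cons,
      show m + 2 * (w.length + 1) = m + 2 + 2 * w.length by ring]
    exact this

theorem generator_mul_generator {k n : ℕ} (h : k < n) :
    generator n * generator k = generator k * generator (n + 2) := by
  -- The vine is long enough for the largest letter `n + 2` to be admissible. Both words then grow
  -- the same tree.
  have h0 := represents_one (vine (n + 3))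
  have h1 := Represents.mul_prod_generator [n, k] (p := 1) h0 (by simp; omega)
  have h2 := Represents.mul_prod_generator [k, n + 2] (p := 1) h0 (by simp; omega)
  simp only [List.map_cons, List.map_nil, List.prod_cons, List.prod_nil, mul_one, one_mul,
    List.foldl_cons, List.foldl_nil] at h1 h2
  rw [BinTree.addTriple_comm _ h (by simp)] at h2
  exact h1.eq_of h2

/-! ### Alternating colour words and the generators -/

/-- The word of length `n` with alternating letters that begins with `c`. -/
def alternating : Bool → ℕ → List Bool
  | _, 0 => []
  | c, n + 1 => c :: alternating (!c) n

@[simp] theorem length_alternating (n : ℕ) : ∀ c, (alternating c n).length = n := by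
  induction n with
  | zero => intro c; rfl
  | succ n ih => intro c; simp [alternating, ih]

theorem color_vine (m : ℕ) : ∀ c, (vine m).color c = alternating c (m + 1) := by
  induction m with
  | zero => intro c; rfl
  | succ m ih => intro c; rw [vine, BinTree.color, ih]; rfl

/-- Attaching `vine 2` replaces `c` by `c, !c, c`, which inserts two letters and keeps the
alternation. -/
theorem substAt_substAt_alternating (n : ℕ) : ∀ (c : Bool) {i : ℕ}, i < n →
    substAt (fun c => [c, !c]) (substAt (fun c => [c, !c]) (alternating c n) i) (i + 1) =
      alternating c (n + 2) := by
  induction n with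
  | zero => intro c i hi; omega
  | succ n ih =>
    rintro c (_ | i) hi
    · simp [alternating, substAt]
    · rw [alternating, substAt, substAt, ih (!c) (by omega)]
      rfl

theorem generator_mem (j : ℕ) : generator j ∈ JonesSubgroup := by
  rw [mem_jonesSubgroup_iff (represents_generator (m := j + 1) (by omega)), BinTree.addTriple,
    BinTree.color_add _ (by simp), BinTree.color_add _ (by simp), color_vine, color_vine,
    substAt_substAt_alternating _ _ (by omega)]

/-! ### The abstract group and its fractions of positive words -/

/-- The homomorphism from the abstract group to Thompson's group. -/
noncomputable def fromFN : ThompsonFN 3 →* ThompsonF :=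
  PresentedGroup.toGroup (f := generator) (by
    rintro r ⟨k, n, hkn, rfl⟩
    simp only [map_mul, map_inv, FreeGroup.lift_apply_of]
    rw [mul_assoc _ (generator n), generator_mul_generator hkn]
    simp)

/-- The product of generators of the abstract group given by a word. -/
def posWord (w : List ℕ) : ThompsonFN 3 := (w.map PresentedGroup.of).prod

theorem posWord_cons (i : ℕ) (w : List ℕ) :
    posWord (i :: w) = PresentedGroup.of i * posWord w := by simp [posWord]

@[simp] theorem posWord_nil : posWord [] = 1 := rfl

theorem fromFN_of (j : ℕ) : fromFN (PresentedGroup.of j) = generator j :=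
  PresentedGroup.toGroup.of _

theorem fromFN_posWord (w : List ℕ) : fromFN (posWord w) = (w.map generator).prod := by
  rw [posWord, map_list_prod, List.map_map]
  exact congrArg (fun f => (List.map f w).prod) (funext fromFN_of)

theorem of_mul_of {k n : ℕ} (h : k < n) :
    (PresentedGroup.of n * PresentedGroup.of k : ThompsonFN 3) =
      PresentedGroup.of k * PresentedGroup.of (n + 2) := by
  have h1 : (PresentedGroup.mk _ ((FreeGroup.of k)⁻¹ * FreeGroup.of n * FreeGroup.of k *
      (FreeGroup.of (n + 3 - 1))⁻¹) : ThompsonFN 3) = 1 :=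
    PresentedGroup.one_of_mem ⟨k, n, h, rfl⟩
  simp only [map_mul, map_inv] at h1
  rw [mul_inv_eq_one, mul_assoc, inv_mul_eq_iff_eq_mul] at h1
  exact h1

/-- A single positive letter moves to the left through inverse letters. At each step it survives
with a possibly shifted index or cancels. Since it never multiplies, induction on `q` is enough. -/
theorem exists_inv_mul (q : List ℕ) : ∀ a : List ℕ, a.length ≤ 1 → ∃ a' q' : List ℕ,
    a'.length ≤ 1 ∧ (posWord q)⁻¹ * posWord a = posWord a' * (posWord q')⁻¹ := by
  induction q with
  | nil => intro a ha; exact ⟨a, [], ha, by simp⟩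
  | cons k q ih =>
    rintro (_ | ⟨n, _ | ⟨m, a⟩⟩) ha
    · exact ⟨[], k :: q, by simp, by simp⟩
    -- The hypothesis says `x_k⁻¹ x_n = x_{n'} x_{k'}⁻¹`. The relations provide it with `n' = n +
    -- 2`, `k' = k` for `k < n`, and with `n' = n`, `k' = k + 2` for `n < k`.
    · have key : ∀ n' k' : ℕ, (PresentedGroup.of n * PresentedGroup.of k' : ThompsonFN 3) =
          PresentedGroup.of k * PresentedGroup.of n' → ∃ a' q' : List ℕ, a'.length ≤ 1 ∧
          (posWord (k :: q))⁻¹ * posWord [n] = posWord a' * (posWord q')⁻¹ := by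
        intro n' k' h
        obtain ⟨a', q', ha', e⟩ := ih [n'] (by simp)
        refine ⟨a', k' :: q', ha', ?_⟩
        rw [posWord_cons k', mul_inv_rev, ← mul_assoc (posWord a'), ← e, posWord_cons, posWord_cons,
          posWord_cons]
        have h' : ((PresentedGroup.of k)⁻¹ * PresentedGroup.of n : ThompsonFN 3) =
            PresentedGroup.of n' * (PresentedGroup.of k')⁻¹ := by
          rw [inv_mul_eq_iff_eq_mul, ← mul_assoc, eq_mul_inv_iff_mul_eq, h]
        simp only [posWord_nil, mul_one, mul_inv_rev, mul_assoc, h']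
      rcases lt_trichotomy k n with h | rfl | h
      · exact key _ _ (of_mul_of h)
      · exact ⟨[], q, by simp, by simp [posWord_cons]⟩
      · exact key _ _ (of_mul_of h).symm
    · simp at ha

/-- Multiplying a fraction on the right by `x_i⁻¹` lengthens the denominator. Multiplying by `x_i`
is handled by moving `x_i` through the denominator. -/
theorem exists_posWord_mul_inv (u : ThompsonFN 3) :
    ∃ p q, u = posWord p * (posWord q)⁻¹ := by
  have hu : u ∈ Subgroup.closure (Set.range (PresentedGroup.of (rels :=
      {r : FreeGroup ℕ | ∃ k n, k < n ∧ r = (FreeGroup.of k)⁻¹ * FreeGroup.of n *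
        FreeGroup.of k * (FreeGroup.of (n + 3 - 1))⁻¹}))) := by
    rw [PresentedGroup.closure_range_of]
    trivial
  induction hu using Subgroup.closure_induction_right with
  | one => exact ⟨[], [], by simp⟩
  | mul_right x hx y hy ih =>
    obtain ⟨i, rfl⟩ := hy
    obtain ⟨p, q, rfl⟩ := ih
    obtain ⟨a, q', -, e⟩ := exists_inv_mul q [i] (by simp)
    refine ⟨p ++ a, q', ?_⟩
    rw [posWord_cons, posWord_nil, mul_one] at e
    rw [mul_assoc, e, ← mul_assoc]
    simp only [posWord, List.map_append, List.prod_append]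
  | mul_inv_cancel x hx y hy ih =>
    obtain ⟨i, rfl⟩ := hy
    obtain ⟨p, q, rfl⟩ := ih
    exact ⟨p, i :: q, by rw [posWord_cons, mul_inv_rev, mul_assoc]⟩

/-! ### Ternary trees -/

/-- Finite rooted ternary trees. -/
inductive TernaryTree : Type
  | leaf : TernaryTree
  | node : TernaryTree → TernaryTree → TernaryTree → TernaryTree

namespace TernaryTree

/-- The binary tree in which every ternary caret is replaced by `vine 2`. -/
def toBin : TernaryTree → BinTree
  | leaf => .leaf
  | node a b c => .node a.toBin (.node b.toBin c.toBin)

/-- The number of leaves. -/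
abbrev leaves (t : TernaryTree) : ℕ := t.toBin.leaves

/-- The number of ternary carets. -/
def carets : TernaryTree → ℕ
  | leaf => 0
  | node a b c => a.carets + b.carets + c.carets + 1

theorem leaves_eq (t : TernaryTree) : t.leaves = 2 * t.carets + 1 := by
  induction t with
  | leaf => rfl
  | node a b c ha hb hc =>
    change a.leaves + (b.leaves + c.leaves) = _
    rw [ha, hb, hc, carets]
    ring

theorem toBin_injective (s : TernaryTree) : ∀ t : TernaryTree, s.toBin = t.toBin → s = t := by
  induction s with
  | leaf => rintro (_ | ⟨a, b, c⟩) h <;> simp_all [toBin]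
  | node a b c ha hb hc =>
    rintro (_ | ⟨a', b', c'⟩) h
    · simp [toBin] at h
    · simp only [toBin, BinTree.node.injEq] at h
      rw [ha _ h.1, hb _ h.2.1, hc _ h.2.2]

/-- Attach a ternary caret to the leaf number `i`. -/
def add : TernaryTree → ℕ → TernaryTree
  | leaf, _ => node leaf leaf leaf
  | node a b c, i =>
    if i < a.leaves then node (a.add i) b c
    else if i - a.leaves < b.leaves then node a (b.add (i - a.leaves)) c
    else node a b (c.add (i - a.leaves - b.leaves))

theorem toBin_add (t : TernaryTree) : ∀ {i : ℕ}, i < t.leaves →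
    (t.add i).toBin = t.toBin.addTriple i := by
  induction t with
  | leaf =>
    intro i hi
    simp only [leaves, toBin, BinTree.leaves, Nat.lt_one_iff] at hi
    subst hi
    rfl
  | node a b c ha hb hc =>
    intro i hi
    simp only [leaves, toBin, BinTree.leaves] at hi ha hb hc
    by_cases h1 : i < a.toBin.leaves
    · simp [add, toBin, BinTree.addTriple, BinTree.add, h1, ha h1]
    · have e1 : ¬ i + 1 < a.toBin.leaves := by omega
      have e2 : i + 1 - a.toBin.leaves = i - a.toBin.leaves + 1 := by omega
      by_cases h2 : i - a.toBin.leaves < b.toBin.leaves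
      · simp [add, toBin, BinTree.addTriple, BinTree.add, h1, h2, e1, e2, hb h2]
      · have e3 : ¬ i - a.toBin.leaves + 1 < b.toBin.leaves := by omega
        have e4 : i - a.toBin.leaves + 1 - b.toBin.leaves =
          i - a.toBin.leaves - b.toBin.leaves + 1 := by omega
        simp [add, toBin, BinTree.addTriple, BinTree.add, h1, h2, e1, e2, e3, e4,
          hc (i := i - a.toBin.leaves - b.toBin.leaves) (by omega)]

theorem leaves_add (t : TernaryTree) {i : ℕ} (hi : i < t.leaves) :
    (t.add i).leaves = t.leaves + 2 := by
  rw [leaves, t.toBin_add hi, BinTree.leaves_addTriple]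

/-- The product of the generators that create a tree from the leaf number `k` of a forest. -/
def code : TernaryTree → ℕ → ThompsonFN 3
  | leaf, _ => 1
  | node a b c, k => PresentedGroup.of k * c.code (k + 2) * b.code (k + 1) * a.code k

/-- The variant of `code` that disregards the carets that are attached to the last leaf. -/
def lastCode : TernaryTree → ℕ → ThompsonFN 3
  | leaf, _ => 1
  | node a b c, k => c.lastCode (k + 2) * b.code (k + 1) * a.code k

/-- A caret at a leaf to the right of leaf `k` commutes with growing `t` at leaf `k`. Its index
increases by two for every caret of `t` that it passes. -/
theorem of_mul_code (t : TernaryTree) : ∀ {k j : ℕ}, k < j →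
    PresentedGroup.of j * t.code k = t.code k * PresentedGroup.of (j + 2 * t.carets) := by
  induction t with
  | leaf => intro k j _; simp [code, carets]
  | node a b c ha hb hc =>
    intro k j h
    rw [code, carets, ← mul_assoc, ← mul_assoc, ← mul_assoc, of_mul_of h,
      mul_assoc (PresentedGroup.of k) _ (c.code _), hc (by omega), ← mul_assoc,
      mul_assoc _ _ (b.code _), hb (by omega), ← mul_assoc, mul_assoc _ _ (a.code _),
      ha (by omega), ← mul_assoc]
    congr 2
    ring

/-- `code` grows the subtrees from right to left, so earlier growth leaves the later indices
unchanged. A caret added in a right or middle subtree gives a letter inside the word, and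
`of_mul_code` moves it to the end past the subtrees on its left. Thus the code depends on the tree
and not on the order of growth. -/
theorem code_add (t : TernaryTree) : ∀ {i : ℕ}, i < t.leaves → ∀ k,
    (t.add i).code k = t.code k * PresentedGroup.of (k + i) := by
  induction t with
  | leaf =>
    intro i hi k
    simp only [leaves, toBin, BinTree.leaves, Nat.lt_one_iff] at hi
    subst hi
    simp [add, code]
  | node a b c ha hb hc =>
    intro i hi k
    have la := a.leaves_eq
    have lb := b.leaves_eq
    have hi' : i < a.leaves + (b.leaves + c.leaves) := hi
    unfold add
    split_ifs with h1 h2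
    · rw [code, ha h1, code, ← mul_assoc]
    · rw [code, hb h2, code, ← mul_assoc, mul_assoc _ _ (a.code k), a.of_mul_code (by omega),
        ← mul_assoc]
      congr 2
      omega
    · rw [code, hc (by omega), code, ← mul_assoc, mul_assoc _ _ (b.code _),
        b.of_mul_code (by omega), ← mul_assoc, mul_assoc _ _ (a.code k), a.of_mul_code (by omega),
        ← mul_assoc]
      congr 2
      omega

/-- The bound `i + 1 < t.leaves` excludes the last leaf. A caret there only lengthens the underlying
vine and corresponds to no letter. -/
theorem lastCode_add (t : TernaryTree) : ∀ {i : ℕ}, i + 1 < t.leaves → ∀ k,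
    (t.add i).lastCode k = t.lastCode k * PresentedGroup.of (k + i) := by
  induction t with
  | leaf =>
    intro i hi k
    simp [leaves, toBin, BinTree.leaves] at hi
  | node a b c ha hb hc =>
    intro i hi k
    have la := a.leaves_eq
    have lb := b.leaves_eq
    have hi' : i + 1 < a.leaves + (b.leaves + c.leaves) := hi
    unfold add
    split_ifs with h1 h2
    · rw [lastCode, code_add a h1, lastCode, ← mul_assoc]
    · rw [lastCode, code_add b h2, lastCode, ← mul_assoc, mul_assoc _ _ (a.code k),
        a.of_mul_code (by omega), ← mul_assoc]
      congr 2
      omega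
    · rw [lastCode, hc (by omega), lastCode, mul_assoc _ _ (b.code _),
        b.of_mul_code (by omega), ← mul_assoc, mul_assoc _ _ (a.code k), a.of_mul_code (by omega),
        ← mul_assoc]
      congr 2
      omega

/-- The tree grown by `w` determines `posWord w` up to the code of the initial tree. This recovers a
positive element from its tree. -/
theorem foldl_add (w : List ℕ) : ∀ t : TernaryTree, (∀ j ∈ w, j + 1 < t.leaves) →
    (w.foldl add t).toBin = w.foldl BinTree.addTriple t.toBin ∧
    (w.foldl add t).lastCode 0 = t.lastCode 0 * posWord w := by
  induction w with
  | nil => intro t _; simp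
  | cons j w ih =>
    intro t hw
    have hj := hw j (by simp)
    have := ih (t.add j) fun i hi => by
      rw [t.leaves_add (by omega)]
      exact (hw i (List.mem_cons_of_mem _ hi)).trans (by omega)
    rw [List.foldl_cons, List.foldl_cons, this.1, this.2, t.toBin_add (by omega),
      t.lastCode_add hj, posWord_cons, zero_add, mul_assoc]
    exact ⟨rfl, rfl⟩

/-- The ternary tree that corresponds to `vine (2 * m)`. -/
def vine : ℕ → TernaryTree
  | 0 => leaf
  | m + 1 => node leaf leaf (vine m)

theorem toBin_vine (m : ℕ) : (vine m).toBin = BinTree.vine (2 * m) := by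
  induction m with
  | zero => rfl
  | succ m ih => rw [vine, toBin, ih]; rfl

theorem lastCode_vine (m : ℕ) : ∀ k, (vine m).lastCode k = 1 := by
  induction m with
  | zero => intro k; rfl
  | succ m ih => intro k; simp [vine, lastCode, ih, code]

end TernaryTree

/-- It suffices to compare two positive words with the same image. Growing both from vines yields
tree pairs with a common source, hence with the same target. The two words are then read off from
one tree by `lastCode`. -/
theorem fromFN_injective : Function.Injective fromFN := by
  rw [injective_iff_map_eq_one]
  intro u hu
  obtain ⟨p, q, rfl⟩ := exists_posWord_mul_inv u
  rw [map_mul, map_inv, mul_inv_eq_one, fromFN_posWord, fromFN_posWord] at hu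
  rw [mul_inv_eq_one]
  have hbound : ∃ m, ∀ j ∈ p ++ q, j < 2 * m :=
    ⟨(p ++ q).sum + 1, fun j hj => by have := List.le_sum_of_mem hj; omega⟩
  obtain ⟨m, hm⟩ := hbound
  -- The initial vine for each word has as many extra ternary carets as the other word has letters,
  -- so both source vines end up with the same length.
  have key : ∀ w w' : List ℕ, (∀ j ∈ w, j < 2 * m) →
      Represents (((w.map generator).prod : ThompsonF) : unitInterval ≃o unitInterval)
        (vine (2 * (m + w'.length) + 2 * w.length))
        (w.foldl TernaryTree.add (TernaryTree.vine (m + w'.length))).toBin ∧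
      (w.foldl TernaryTree.add (TernaryTree.vine (m + w'.length))).lastCode 0 = posWord w := by
    intro w w' hw
    have h1 := TernaryTree.foldl_add w (TernaryTree.vine (m + w'.length)) fun j hj => by
      have := hw j hj
      rw [TernaryTree.leaves, TernaryTree.toBin_vine, BinTree.leaves_vine]
      omega
    rw [h1.1, h1.2, TernaryTree.lastCode_vine, one_mul, TernaryTree.toBin_vine]
    have h2 := Represents.mul_prod_generator w (p := 1)
      (represents_one (vine (2 * (m + w'.length)))) fun j hj => (hw j hj).trans_le (by omega)
    rw [one_mul] at h2
    exact ⟨h2, rfl⟩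
  obtain ⟨r1, e1⟩ := key p q fun j hj => hm j (List.mem_append_left _ hj)
  obtain ⟨r2, e2⟩ := key q p fun j hj => hm j (List.mem_append_right _ hj)
  rw [show 2 * (m + p.length) + 2 * q.length = 2 * (m + q.length) + 2 * p.length by ring,
    ← hu] at r2
  rw [← e1, ← e2, TernaryTree.toBin_injective _ _ (r1.unique r2)]

/-! ### Expansion to alternating colours -/

/-- One word arises from another one by replacing a letter `c` by `c, !c`. -/
def WordStep (w w' : List Bool) : Prop :=
  ∃ i, i < w.length ∧ w' = substAt (fun c => [c, !c]) w i

theorem wordStep_cons (c : Bool) {w w' : List Bool} (h : WordStep w w') :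
    WordStep (c :: w) (c :: w') := by
  obtain ⟨i, hi, rfl⟩ := h
  exact ⟨i + 1, by simpa using hi, rfl⟩

theorem wordStep_alternating (n : ℕ) : ∀ c,
    WordStep (alternating c (n + 1)) (alternating c (n + 2)) := by
  induction n with
  | zero => intro c; exact ⟨0, by simp, rfl⟩
  | succ n ih => intro c; exact wordStep_cons c (ih (!c))

/-- The tail is made alternating first. If it then begins with the opposite colour, nothing remains
to be done. Otherwise the first letter `c` is replaced by `c, !c`, which repairs the junction. -/
theorem exists_alternating (w : List Bool) : ∀ c, ∃ n,
    Relation.ReflTransGen WordStep (c :: w) (alternating c (n + 1)) := by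
  induction w with
  | nil => intro c; exact ⟨0, .refl⟩
  | cons d w ih =>
    intro c
    obtain ⟨n, hn⟩ := ih d
    have h1 : Relation.ReflTransGen WordStep (c :: d :: w) (c :: alternating d (n + 1)) :=
      hn.lift (c :: ·) fun _ _ => wordStep_cons c
    by_cases hd : d = !c
    · subst hd
      exact ⟨n + 1, h1⟩
    · have hd : d = c := by revert hd; cases c <;> cases d <;> simp
      subst hd
      exact ⟨n + 2, h1.tail ⟨0, by simp, by simp [alternating, substAt]⟩⟩

/-- If the length is even, one more replacement, at the last letter, lengthens the alternating word
by one. -/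
theorem exists_alternating_odd (w : List Bool) (c : Bool) : ∃ n,
    Relation.ReflTransGen WordStep (c :: w) (alternating c (2 * n + 1)) := by
  obtain ⟨n, hn⟩ := exists_alternating w c
  obtain ⟨m, rfl | rfl⟩ := Nat.even_or_odd' n
  · exact ⟨m, hn⟩
  · exact ⟨m + 1, hn.tail (wordStep_alternating _ c)⟩

/-- Carets attached to corresponding leaves change neither the represented element nor the equality
of the two words, so each word move is realised on both trees at once. -/
theorem Represents.expand_color {g : unitInterval ≃o unitInterval} {T S : BinTree}
    (h : Represents g T S) (hc : T.color false = S.color false) {w : List Bool}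
    (hw : Relation.ReflTransGen WordStep (T.color false) w) :
    ∃ T' S', Represents g T' S' ∧ T'.color false = w ∧ S'.color false = w := by
  induction hw with
  | refl => exact ⟨T, S, h, rfl, hc.symm⟩
  | tail _ h2 ih =>
    obtain ⟨T', S', h', e1, e2⟩ := ih
    obtain ⟨i, hi, rfl⟩ := h2
    rw [← e1, BinTree.length_color] at hi
    refine ⟨_, _, h'.add hi, ?_, ?_⟩
    · rw [BinTree.color_add _ hi, e1]
    · rw [BinTree.color_add _ (h'.leaves_eq ▸ hi), e2]

theorem alternating_add (m n : ℕ) : ∀ c, alternating c (m + n) =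
    alternating c m ++ alternating (if m % 2 = 0 then c else !c) n := by
  induction m with
  | zero => intro c; simp [alternating]
  | succ m ih =>
    intro c
    rw [Nat.add_right_comm, alternating, alternating, ih, List.cons_append]
    congr 3
    rcases Nat.mod_two_eq_zero_or_one m with h | h
    · rw [if_pos h, if_neg (by omega)]
    · rw [if_neg (by omega), if_pos (by omega), Bool.not_not]

/-- The word of `r` begins with `!c`. In an alternating word this letter can stand at position
`l.leaves` only if `l.leaves` is odd. -/
theorem BinTree.color_node_alternating {l r : BinTree} {c : Bool}
    (h : (node l r).color c = alternating c (node l r).leaves) :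
    l.color c = alternating c l.leaves ∧ r.color (!c) = alternating (!c) r.leaves ∧
      l.leaves % 2 = 1 := by
  simp only [color, leaves] at h
  rw [alternating_add] at h
  obtain ⟨h1, h2⟩ := List.append_inj h (by simp)
  obtain ⟨m, hm⟩ : ∃ m, r.leaves = m + 1 := ⟨r.carets, r.leaves_eq⟩
  have h3 := congrArg List.head? h2
  rw [head?_color, hm, alternating, List.head?_cons, Option.some.injEq] at h3
  rw [← h3] at h2
  refine ⟨h1, h2, ?_⟩
  by_contra h4
  rw [if_pos (by omega)] at h3
  cases c <;> simp at h3

/-- At a caret the left subtree has an odd number of leaves, so the right one has an even number and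
is itself a caret. Its left part is odd again, hence so is its right part. These three odd subtrees
are the branches of a ternary caret. The induction is on a bound for the leaves, because two levels
are removed at once. -/
theorem BinTree.exists_toBin (n : ℕ) : ∀ (t : BinTree) (c : Bool), t.leaves ≤ n →
    t.leaves % 2 = 1 → t.color c = alternating c t.leaves →
    ∃ s : TernaryTree, s.toBin = t := by
  induction n with
  | zero => intro t c h; have := t.leaves_pos; omega
  | succ n ih =>
    rintro (_ | ⟨l, _ | ⟨m, r⟩⟩) c hn hodd hc
    · exact ⟨.leaf, rfl⟩
    · obtain ⟨h1, h2, h3⟩ := color_node_alternating hc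
      simp only [leaves] at hodd
      omega
    · obtain ⟨h1, h2, h3⟩ := color_node_alternating hc
      obtain ⟨h4, h5, h6⟩ := color_node_alternating h2
      have p1 := l.leaves_pos
      have p2 := m.leaves_pos
      have p3 := r.leaves_pos
      simp only [leaves] at hn hodd
      obtain ⟨s1, rfl⟩ := ih l c (by omega) h3 h1
      obtain ⟨s2, rfl⟩ := ih m _ (by omega) h6 h4
      obtain ⟨s3, rfl⟩ := ih r _ (by omega) (by omega) h5
      exact ⟨.node s1 s2 s3, rfl⟩

/-! ### Growing ternary trees and the image of the homomorphism -/

namespace TernaryTree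

/-- One ternary tree arises from another one by adding a caret. -/
def Step (s t : TernaryTree) : Prop := ∃ i, i < s.leaves ∧ t = s.add i

theorem reflTransGen_step (t : TernaryTree) : Relation.ReflTransGen Step leaf t := by
  induction t with
  | leaf => exact .refl
  | node a b c ha hb hc =>
    have h0 : Step leaf (node leaf leaf leaf) := ⟨0, by simp [leaves, toBin, BinTree.leaves], rfl⟩
    have h1 : Relation.ReflTransGen Step (node leaf leaf leaf) (node a leaf leaf) := by
      refine ha.lift (fun s => node s leaf leaf) ?_
      rintro s _ ⟨i, hi, rfl⟩
      refine ⟨i, hi.trans_le (Nat.le_add_right _ _), ?_⟩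
      simp [add, hi]
    have h2 : Relation.ReflTransGen Step (node a leaf leaf) (node a b leaf) := by
      refine hb.lift (fun s => node a s leaf) ?_
      rintro s _ ⟨i, hi, rfl⟩
      refine ⟨a.leaves + i, ?_, ?_⟩
      · change a.leaves + i < a.leaves + (s.leaves + 1)
        omega
      · simp [add, hi]
    have h3 : Relation.ReflTransGen Step (node a b leaf) (node a b c) := by
      refine hc.lift (fun s => node a b s) ?_
      rintro s _ ⟨i, hi, rfl⟩
      refine ⟨a.leaves + (b.leaves + i), ?_, ?_⟩
      · change a.leaves + (b.leaves + i) < a.leaves + (b.leaves + s.leaves)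
        omega
      · simp [add]
    exact ((h1.trans h2).trans h3).head h0

/-- The tree is grown caret by caret. A caret at any leaf but the last is a right multiplication by
a generator. -/
theorem exists_represents_fromFN (t : TernaryTree) : ∃ u : ThompsonFN 3,
    Represents (fromFN u : unitInterval ≃o unitInterval) (BinTree.vine (2 * t.carets)) t.toBin := by
  have key : ∃ u : ThompsonFN 3, ∃ m,
      Represents (fromFN u : unitInterval ≃o unitInterval) (BinTree.vine m) t.toBin := by
    induction t.reflTransGen_step with
    | refl =>
      refine ⟨1, 0, ?_⟩
      rw [map_one]
      exact represents_one _
    | tail _ h ih =>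
      obtain ⟨u, m, hu⟩ := ih
      obtain ⟨i, hi, rfl⟩ := h
      rw [toBin_add _ hi]
      have hl := hu.leaves_eq
      rw [BinTree.leaves_vine] at hl
      rcases (show i ≤ m by unfold leaves at hi; omega).lt_or_eq with h | rfl
      · refine ⟨u * PresentedGroup.of i, m + 2, ?_⟩
        rw [map_mul, fromFN_of]
        exact hu.mul_generator h
      -- A caret at the last leaf leaves the element unchanged: it is added to both trees, and the
      -- source stays a vine.
      · refine ⟨u, i + 2, ?_⟩
        have := hu.addTriple (i := i) (by simp)
        rwa [BinTree.vine_addTriple_last] at this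
  obtain ⟨u, m, hu⟩ := key
  have hl := hu.leaves_eq.trans t.leaves_eq
  rw [BinTree.leaves_vine, add_left_inj] at hl
  exact ⟨u, hl ▸ hu⟩

end TernaryTree

/-- The generators lie in the subgroup because their two trees have alternating words. Conversely,
an element of the subgroup is represented by two ternary trees after expansion, and is a quotient of
two elements that start from a common vine. -/
theorem range_fromFN : fromFN.range = JonesSubgroup := by
  apply le_antisymm
  · rintro _ ⟨u, rfl⟩
    obtain ⟨p, q, rfl⟩ := exists_posWord_mul_inv u
    have h : ∀ w, fromFN (posWord w) ∈ JonesSubgroup := fun w => by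
      rw [fromFN_posWord]
      refine Subgroup.list_prod_mem _ fun y hy => ?_
      obtain ⟨j, -, rfl⟩ := List.mem_map.1 hy
      exact generator_mem j
    rw [map_mul, map_inv]
    exact mul_mem (h p) (inv_mem (h q))
  · intro g hg
    obtain ⟨T, S, hr⟩ := g.2
    have hc := (mem_jonesSubgroup_iff hr).1 hg
    obtain ⟨v, hv⟩ : ∃ v, T.color false = false :: v := by
      have := T.head?_color false
      cases h : T.color false with
      | nil => simp [h] at this
      | cons a v => simp only [h, List.head?_cons, Option.some.injEq] at this; exact ⟨v, by rw [this]⟩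
    obtain ⟨n, hn⟩ := exists_alternating_odd v false
    rw [← hv] at hn
    obtain ⟨T', S', hr', e1, e2⟩ := hr.expand_color hc hn
    have l1 := congrArg List.length e1
    have l2 := congrArg List.length e2
    rw [BinTree.length_color, length_alternating] at l1 l2
    obtain ⟨t, rfl⟩ := BinTree.exists_toBin _ T' false le_rfl (by omega) (by rw [e1, l1])
    obtain ⟨s, rfl⟩ := BinTree.exists_toBin _ S' false le_rfl (by omega) (by rw [e2, l2])
    have l3 := t.leaves_eq
    have l4 := s.leaves_eq
    rw [TernaryTree.leaves] at l3 l4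
    obtain ⟨u, hu⟩ := t.exists_represents_fromFN
    obtain ⟨v, hv⟩ := s.exists_represents_fromFN
    -- Both colour words have length `2 * n + 1`, so the ternary trees have equally many carets and
    -- the source vines coincide.
    rw [show s.carets = t.carets by omega] at hv
    refine ⟨v * u⁻¹, ?_⟩
    rw [map_mul, map_inv]
    exact Represents.eq_of (hu.inv.mul hv) hr'

end JonesThompson

theorem mainTheorem3 :
    Nonempty (JonesThompson.JonesSubgroup ≃* JonesThompson.ThompsonFN 3) ∧
    ∀ (g : JonesThompson.ThompsonF) (T S : JonesThompson.BinTree),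
      JonesThompson.Represents (g : unitInterval ≃o unitInterval) T S →
      (g ∈ JonesThompson.JonesSubgroup ↔ (JonesThompson.treeGraph T S).IsBipartite) := by
  refine ⟨⟨((MonoidHom.ofInjective JonesThompson.fromFN_injective).trans
    (MulEquiv.subgroupCongr JonesThompson.range_fromFN)).symm⟩, fun g T S h => ?_⟩
  rw [JonesThompson.mem_jonesSubgroup_iff h, JonesThompson.treeGraph_isBipartite_iff h.leaves_eq]
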